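/- Let $q$ be a prime power and $n\ge 1$ with $\gcd(q,n)=1$. For $g=\sum_i a_i x^i\in\mathbb F_{q^2}[x]$ put $\overline g=\sum_i a_i^q x^i$ and, if $g(0)\ne 0$, $g^*=g(0)^{-1}x^{\deg g}g(x^{-1})$. Choose monic irreducible polynomials $f_j\in\mathbb F_{q^2}[x]$ $(j\in J)$ with $$x^n-1=\prod_{j\in J_0}f_j\prod_{j\in J_1}f_j\overline{f_j}\prod_{j\in J_2\cup J_3}f_jf_j^*\prod_{j\in J_4}f_jf_j^*\,\overline{f_j}\,\overline{f_j^*},$$ where $j\in J_0$ iff $f_j=\overline{f_j}=f_j^*$ (so $f_j=x\mp1$); $j\in J_1$ iff $f_j=f_j^*\ne\overline{f_j}$; $j\in J_2$ iff $f_j=\overline{f_j}\ne f_j^*$; $j\in J_3$ iff $\overline{f_j}=f_j^*\ne f_j$; and $j\in J_4$ iff $f_j,\overline{f_j},f_j^*$ are pairwise different. Let $r_j=\deg f_j$ and let $\alpha_j$ be a root of $f_j$ in a fixed extension field of $\mathbb F_{q^2}$. Put $$A_j=\begin{cases}\mathbb F_{q^2}\oplus\mathbb F_{q^2}& j\in J_0,\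 \operatorname{char}\ne2,\\ \mathbb F_{q^2}[C_2]=\left\{\begin{bmatrix}x&y\\y&x\end{bmatrix}:x,y\in\mathbb F_{q^2}\right\}& j\in J_0,\ \operatorname{char}=2,\\ \mathcal M_2(\mathbb F_{q^2}(\alpha_j+\alpha_j^{-1}))\oplus\mathcal M_2(\mathbb F_{q^2}(\alpha_j^q+\alpha_j^{-q}))& j\in J_1,\\ \mathcal M_2(\mathbb F_{q^2}(\alpha_j))& j\in J_2\cup J_3,\\ \mathcal M_2(\mathbb F_{q^2}(\alpha_j))\oplus\mathcal M_2(\mathbb F_{q^2}(\alpha_j^q))& j\in J_4.\end{cases}$$ Let $D_n=\langle a,b\mid a^n=b^2=1,\ bab=a^{-1}\rangle$ (of order $2n$). For a nonzero $\beta$ write $R_\beta=\begin{bmatrix}\beta&0\\0&\beta^{-1}\end{bmatrix}$, $S=\begin{bmatrix}0&1\\1&0\end{bmatrix}$, and, when $\beta\neq\beta^{-1}$, $Z_\beta=\begin{bmatrix}1&-\beta\\1&-\beta^{-1}\end{bmatrix}$ and $\sigma_\beta(M)=Z_\beta^{-1}MZ_\beta$. Then there is an isomorphism of $\mathbb F_{q^2}$-algebras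 $\rho=\bigoplus_j\rho_j:\mathbb F_{q^2}[D_n]\to\bigoplus_{j\in J}A_j$ with * $j\in J_0$, $\operatorname{char}\ne2$: $\rho_j(a)=(1,1)$ if $f_j=x-1$, $\rho_j(a)=(-1,-1)$ if $f_j=x+1$, and $\rho_j(b)=(1,-1)$; * $j\in J_0$, $\operatorname{char}=2$: $\rho_j(a)=I$, $\rho_j(b)=S$; * $j\in J_1$: $\rho_j(a)=\sigma_{\alpha_j}(R_{\alpha_j})\oplus\sigma_{\alpha_j^q}(R_{\alpha_j^q})$, $\rho_j(b)=\sigma_{\alpha_j}(S)\oplus\sigma_{\alpha_j^q}(S)$; * $j\in J_2\cup J_3$: $\rho_j(a)=R_{\alpha_j}$, $\rho_j(b)=S$; * $j\in J_4$: $\rho_j(a)=R_{\alpha_j}\oplus R_{\alpha_j^q}$, $\rho_j(b)=S\oplus S$. Let $\mathcal C\subseteq\mathbb F_{q^2}^{2n}$ be a $D_n$-code, i.e. a linear code such that, for some bijection $\phi:\{1,\dots,2n\}\to D_n$, the set $I_{\mathcal C}=\{\sum_i c_i\phi(i): c\in\mathcal C\}$ is a left ideal of $\mathbb F_{q^2}[D_n]$,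 and fix such a $\phi$. Then $\rho(I_{\mathcal C})=\bigoplus_{j\in J}\mathcal I_j$ for unique left ideals $\mathcal I_j$ of $A_j$, where for $j\in J_1\cup J_4$ the ideal $\mathcal I_j$ is a direct sum of a left ideal of each of the two summands of $A_j$. Let $\mathcal C^{\perp_H}=\{y:\sum_i x_iy_i^q=0\ \ \forall x\in\mathcal C\}$, and let $\langle M\rangle$ denote the left ideal generated by $M$. Then $\mathcal C\subseteq\mathcal C^{\perp_H}$ if and only if all of the following hold. 1. If $j\in J_0$ and $\operatorname{char}(\mathbb F_{q^2})\ne2$, then $\mathcal I_j=\mathbf 0\oplus\mathbf 0$. 2. If $j\in J_0$ and $\operatorname{char}(\mathbb F_{q^2})=2$, then $\mathcal I_j=\mathbf 0$ or $\mathcal I_j=\left\langle\begin{bmatrix}1&1\\1&1\end{bmatrix}\right\rangle$. 3. If $j\in J_1$, then one of the two summands of $\mathcal I_j$ is $\mathbf 0$, or $\mathcal I_j=\left\langle\begin{bmatrix}0&1\\0&0\end{bmatrix}\right\rangle\oplus\left\langle\begin{bmatrix}2&-(\alpha_j^q+\alpha_j^{-q})\\0&0\end{bmatrix}\right\rangle$,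 or $\mathcal I_j=\left\langle\begin{bmatrix}1&\lambda\\0&0\end{bmatrix}\right\rangle\oplus\left\langle\begin{bmatrix}(2\lambda+\alpha_j+\alpha_j^{-1})^q&(-2-\lambda(\alpha_j+\alpha_j^{-1}))^q\\0&0\end{bmatrix}\right\rangle$ for some $\lambda\in\mathbb F_{q^2}(\alpha_j+\alpha_j^{-1})$ (a field with $q^{r_j}$ elements). 4. If $j\in J_2$, then $\mathcal I_j$ is $\mathbf 0$, or $\left\langle\begin{bmatrix}0&1\\0&0\end{bmatrix}\right\rangle$, or $\left\langle\begin{bmatrix}1&\lambda\\0&0\end{bmatrix}\right\rangle$ for some $\lambda\in\mathbb F_{q^2}(\alpha_j)$ with $\lambda=-\lambda^{q^{r_j}}$. 5. If $j\in J_3$, then $\mathcal I_j$ is $\mathbf 0$, or $\left\langle\begin{bmatrix}1&\lambda\\0&0\end{bmatrix}\right\rangle$ for some $\lambda\in\mathbb F_{q^2}(\alpha_j)$ with $0\ne\lambda=-\lambda^{-q^{r_j}}$. 6. If $j\in J_4$, then one of the two summands of $\mathcal I_j$ is $\mathbf 0$, or $\mathcal I_j=\left\langle\begin{bmatrix}0&1\\0&0\end{bmatrix}\right\rangle\oplus\left\langle\begin{bmatrix}0&1\\0&0\end{bmatrix}\right\rangle$,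 or $\mathcal I_j=\left\langle\begin{bmatrix}1&\lambda\\0&0\end{bmatrix}\right\rangle\oplus\left\langle\begin{bmatrix}1&-\lambda^q\\0&0\end{bmatrix}\right\rangle$ for some $\lambda\in\mathbb F_{q^2}(\alpha_j)$ (a field with $q^{2r_j}$ elements). -/

import Mathlib

open Polynomial
open scoped IntermediateField

noncomputable section

namespace DihedralCode

/-! ### Codes, group codes, hermitian duality -/

/-- The hermitian dual of a code `C ⊆ F ^ ι`, where `F` has `q ^ 2` elements:
all `y` with `∑ i, x i * (y i) ^ q = 0` for every `x` in `C`. -/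
def hermitianDual {F ι : Type*} [Field F] [Fintype ι] (q : ℕ) (C : Submodule F (ι → F)) :
    Set (ι → F) :=
  {y | ∀ x ∈ C, ∑ i, x i * y i ^ q = 0}

/-- The subset `{∑ i, c i • φ i | c ∈ C}` of the group algebra `F[G]` attached to a linear code `C`
and to a bijection `φ` between the coordinates and the group `G`. The code is a (left) `G`-code
when, for some `φ`, this set is a left ideal. -/
def codeSet {F ι G : Type*} [Field F] [Fintype ι] (φ : ι ≃ G) (C : Submodule F (ι → F)) :
    Set (MonoidAlgebra F G) :=
  {x | ∃ c ∈ C, x = ∑ i, MonoidAlgebra.single (φ i) (c i)}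

/-! ### The factorisation of `X ^ n - 1` -/

section Polynomials

variable {F : Type*} [Field F]

/-- The conjugate polynomial: every coefficient is raised to the power `q`. -/
def conjPoly (q : ℕ) (g : F[X]) : F[X] := g.sum fun i c => C (c ^ q) * X ^ i

/-- The reciprocal polynomial `g(0)⁻¹ X ^ deg g * g(X⁻¹)`. -/
def recipPoly (g : F[X]) : F[X] := C (g.coeff 0)⁻¹ * g.reverse

/-- `g = conjPoly g = recipPoly g`. -/
def IsJ0 (q : ℕ) (g : F[X]) : Prop := g = conjPoly q g ∧ g = recipPoly g

/-- `g = recipPoly g`, but `g ≠ conjPoly g`. -/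
def IsJ1 (q : ℕ) (g : F[X]) : Prop := g = recipPoly g ∧ g ≠ conjPoly q g

/-- `g = conjPoly g`, but `g ≠ recipPoly g`. -/
def IsJ2 (q : ℕ) (g : F[X]) : Prop := g = conjPoly q g ∧ g ≠ recipPoly g

/-- `conjPoly g = recipPoly g`, but `g ≠ recipPoly g`. -/
def IsJ3 (q : ℕ) (g : F[X]) : Prop := conjPoly q g = recipPoly g ∧ g ≠ recipPoly g

/-- `g`, `conjPoly g` and `recipPoly g` are pairwise different. -/
def IsJ4 (q : ℕ) (g : F[X]) : Prop := g ≠ conjPoly q g ∧ g ≠ recipPoly g ∧ conjPoly q g ≠ recipPoly g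

open Classical in
/-- The monic irreducible polynomials `f j` are representatives of the irreducible factors of
`X ^ n - 1` up to conjugation and reciprocation. -/
structure IsFactorisation {J : Type*} [Fintype J] (q n : ℕ) (f : J → F[X]) : Prop where
  monic : ∀ j, (f j).Monic
  irreducible : ∀ j, Irreducible (f j)
  prod_eq : (X ^ n - 1 : F[X]) =
    (∏ j with IsJ0 q (f j), f j) *
    (∏ j with IsJ1 q (f j), f j * conjPoly q (f j)) *
    (∏ j with IsJ2 q (f j) ∨ IsJ3 q (f j), f j * recipPoly (f j)) *
    (∏ j with IsJ4 q (f j), f j * recipPoly (f j) * conjPoly q (f j) * conjPoly q (recipPoly (f j)))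

end Polynomials

/-! ### The Wedderburn-type decomposition of the group algebra of a dihedral group -/

/-- `2 × 2` matrices. -/
abbrev Mat (R : Type*) := Matrix (Fin 2) (Fin 2) R

/-- The group algebra `F[C₂]` of the group of order two generated by the matrix `[0, 1; 1, 0]`,
realised as the algebra of all matrices `[x, y; y, x]`. -/
abbrev GroupAlgC2 (F : Type*) [Field F] : Subalgebra F (Mat F) :=
  Algebra.adjoin F {(!![0, 1; 1, 0] : Mat F)}

section Decomposition

variable {F K J : Type*} [Field F] [Field K] [Algebra F K]

/-- The algebra `⨁ j, A j`. For a root `α j` of `f j`, the summand `A j` is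
* `F ⊕ F` for `j ∈ J₀` when the characteristic is not two,
* `F[C₂]` for `j ∈ J₀` when the characteristic is two,
* `M₂(F(α + α⁻¹)) ⊕ M₂(F(α ^ q + α ^ (-q)))` for `j ∈ J₁`,
* `M₂(F(α))` for `j ∈ J₂` and for `j ∈ J₃`,
* `M₂(F(α)) ⊕ M₂(F(α ^ q))` for `j ∈ J₄`. -/
abbrev DecompAlg (q : ℕ) (f : J → F[X]) (α : J → K) :=
  (∀ _ : {j // IsJ0 q (f j) ∧ ringChar F ≠ 2}, F × F) ×
  (∀ _ : {j // IsJ0 q (f j) ∧ ringChar F = 2}, GroupAlgC2 F) ×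
  (∀ j : {j // IsJ1 q (f j)},
    Mat F⟮α j + (α j)⁻¹⟯ × Mat F⟮α j ^ q + (α j ^ q)⁻¹⟯) ×
  (∀ j : {j // IsJ2 q (f j)}, Mat F⟮α j⟯) ×
  (∀ j : {j // IsJ3 q (f j)}, Mat F⟮α j⟯) ×
  (∀ j : {j // IsJ4 q (f j)}, Mat F⟮α j⟯ × Mat F⟮α j ^ q⟯)

/-- A matrix over an intermediate field, viewed as a matrix over the big field. -/
abbrev liftMat {E : IntermediateField F K} (M : Mat E) : Mat K := M.map (algebraMap E K)

/-- The diagonal matrix with entries `β` and `β⁻¹`. -/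
abbrev rot (β : K) : Mat K := !![β, 0; 0, β⁻¹]

/-- The matrix that exchanges the two basis vectors. -/
abbrev swapMat (R : Type*) [Zero R] [One R] : Mat R := !![0, 1; 1, 0]

/-- The matrix `Z` with rows `(1, -β)` and `(1, -β⁻¹)`. -/
abbrev zmat (β : K) : Mat K := !![1, -β; 1, -β⁻¹]

/-- The map `X ↦ Z⁻¹ X Z`. -/
abbrev sigma (β : K) (M : Mat K) : Mat K := (zmat β)⁻¹ * M * zmat β

/-- `ρ` takes the prescribed values on the generators `a` (rotation) and `b` (reflection) of the
dihedral group `⟨a, b | a ^ n = b ^ 2 = 1, b a b = a⁻¹⟩`. -/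
structure IsStandard {n q : ℕ} {f : J → F[X]} {α : J → K}
    (ρ : MonoidAlgebra F (DihedralGroup n) ≃ₐ[F] DecompAlg q f α) : Prop where
  a0_one : ∀ j, f j.1 = X - 1 → (ρ (MonoidAlgebra.single (.r 1) 1)).1 j = (1, 1)
  a0_neg : ∀ j, f j.1 = X + 1 → (ρ (MonoidAlgebra.single (.r 1) 1)).1 j = (-1, -1)
  b0 : ∀ j, (ρ (MonoidAlgebra.single (.sr 0) 1)).1 j = (1, -1)
  a0_two : ∀ j, ((ρ (MonoidAlgebra.single (.r 1) 1)).2.1 j : Mat F) = 1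
  b0_two : ∀ j, ((ρ (MonoidAlgebra.single (.sr 0) 1)).2.1 j : Mat F) = swapMat F
  a1_left : ∀ j, liftMat ((ρ (MonoidAlgebra.single (.r 1) 1)).2.2.1 j).1 =
    sigma (α j) (rot (α j))
  a1_right : ∀ j, liftMat ((ρ (MonoidAlgebra.single (.r 1) 1)).2.2.1 j).2 =
    sigma (α j ^ q) (rot (α j ^ q))
  b1_left : ∀ j, liftMat ((ρ (MonoidAlgebra.single (.sr 0) 1)).2.2.1 j).1 =
    sigma (α j) (swapMat K)
  b1_right : ∀ j, liftMat ((ρ (MonoidAlgebra.single (.sr 0) 1)).2.2.1 j).2 =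
    sigma (α j ^ q) (swapMat K)
  a2 : ∀ j, liftMat ((ρ (MonoidAlgebra.single (.r 1) 1)).2.2.2.1 j) = rot (α j)
  b2 : ∀ j, liftMat ((ρ (MonoidAlgebra.single (.sr 0) 1)).2.2.2.1 j) = swapMat K
  a3 : ∀ j, liftMat ((ρ (MonoidAlgebra.single (.r 1) 1)).2.2.2.2.1 j) = rot (α j)
  b3 : ∀ j, liftMat ((ρ (MonoidAlgebra.single (.sr 0) 1)).2.2.2.2.1 j) = swapMat K
  a4_left : ∀ j, liftMat ((ρ (MonoidAlgebra.single (.r 1) 1)).2.2.2.2.2 j).1 = rot (α j)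
  a4_right : ∀ j, liftMat ((ρ (MonoidAlgebra.single (.r 1) 1)).2.2.2.2.2 j).2 = rot (α j ^ q)
  b4_left : ∀ j, liftMat ((ρ (MonoidAlgebra.single (.sr 0) 1)).2.2.2.2.2 j).1 = swapMat K
  b4_right : ∀ j, liftMat ((ρ (MonoidAlgebra.single (.sr 0) 1)).2.2.2.2.2 j).2 = swapMat K

/-- A family of left ideals, one for each `A j`; for `j` in `J₁` or `J₄`, the ideal of `A j` is
given by its two summands. -/
structure IdealFamily (q : ℕ) (f : J → F[X]) (α : J → K) where
  I0 : {j // IsJ0 q (f j) ∧ ringChar F ≠ 2} → Ideal (F × F)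
  I0two : {j // IsJ0 q (f j) ∧ ringChar F = 2} → Ideal (GroupAlgC2 F)
  I1left : ∀ j : {j // IsJ1 q (f j)}, Ideal (Mat F⟮α j + (α j)⁻¹⟯)
  I1right : ∀ j : {j // IsJ1 q (f j)}, Ideal (Mat F⟮α j ^ q + (α j ^ q)⁻¹⟯)
  I2 : ∀ j : {j // IsJ2 q (f j)}, Ideal (Mat F⟮α j⟯)
  I3 : ∀ j : {j // IsJ3 q (f j)}, Ideal (Mat F⟮α j⟯)
  I4left : ∀ j : {j // IsJ4 q (f j)}, Ideal (Mat F⟮α j⟯)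
  I4right : ∀ j : {j // IsJ4 q (f j)}, Ideal (Mat F⟮α j ^ q⟯)

/-- The underlying set of the direct sum of a family of left ideals. -/
def IdealFamily.directSum {q : ℕ} {f : J → F[X]} {α : J → K} (S : IdealFamily q f α) :
    Set (DecompAlg q f α) :=
  {y | (∀ j, y.1 j ∈ S.I0 j) ∧
    (∀ j, y.2.1 j ∈ S.I0two j) ∧
    (∀ j, (y.2.2.1 j).1 ∈ S.I1left j ∧ (y.2.2.1 j).2 ∈ S.I1right j) ∧
    (∀ j, y.2.2.2.1 j ∈ S.I2 j) ∧
    (∀ j, y.2.2.2.2.1 j ∈ S.I3 j) ∧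
    (∀ j, (y.2.2.2.2.2 j).1 ∈ S.I4left j ∧ (y.2.2.2.2.2 j).2 ∈ S.I4right j)}

/-- The left ideal `I` of `M₂(E)` is generated by the matrix with rows `(x, y)` and `(0, 0)`, whose
entries `x`, `y` are given as elements of the big field and have to lie in `E`. -/
def GeneratedByRow {E : IntermediateField F K} (I : Ideal (Mat E)) (x y : K) : Prop :=
  ∃ M : Mat E, liftMat M = !![x, y; 0, 0] ∧ I = Ideal.span {M}

/-- The list of admissible components. -/
structure IdealFamily.IsAdmissible {q : ℕ} {f : J → F[X]} {α : J → K}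
    (S : IdealFamily q f α) : Prop where
  h0 : ∀ j, S.I0 j = ⊥
  h0two : ∀ j, S.I0two j = ⊥ ∨
    ∃ M : GroupAlgC2 F, (M : Mat F) = !![1, 1; 1, 1] ∧ S.I0two j = Ideal.span {M}
  h1 : ∀ j, S.I1left j = ⊥ ∨ S.I1right j = ⊥ ∨
    (GeneratedByRow (S.I1left j) 0 1 ∧
      GeneratedByRow (S.I1right j) 2 (-(α j ^ q + (α j ^ q)⁻¹))) ∨
    ∃ l : F⟮α j + (α j)⁻¹⟯, GeneratedByRow (S.I1left j) 1 l ∧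
      GeneratedByRow (S.I1right j)
        ((2 * l + (α j + (α j)⁻¹)) ^ q) ((-2 - l * (α j + (α j)⁻¹)) ^ q)
  h2 : ∀ j, S.I2 j = ⊥ ∨ GeneratedByRow (S.I2 j) 0 1 ∨
    ∃ l : F⟮α j⟯, l = -l ^ q ^ (f j).natDegree ∧ GeneratedByRow (S.I2 j) 1 l
  h3 : ∀ j, S.I3 j = ⊥ ∨
    ∃ l : F⟮α j⟯, l ≠ 0 ∧ l = -(l ^ q ^ (f j).natDegree)⁻¹ ∧ GeneratedByRow (S.I3 j) 1 l
  h4 : ∀ j, S.I4left j = ⊥ ∨ S.I4right j = ⊥ ∨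
    (GeneratedByRow (S.I4left j) 0 1 ∧ GeneratedByRow (S.I4right j) 0 1) ∨
    ∃ l : F⟮α j⟯, GeneratedByRow (S.I4left j) 1 l ∧ GeneratedByRow (S.I4right j) 1 (-(l : K) ^ q)

end Decomposition

end DihedralCode

end

open DihedralCode

open DihedralCode

namespace DihedralCode

/-! ### Algebra homomorphisms on the group algebra of a dihedral group -/

section Lift

variable {n : ℕ} [NeZero n] {M : Type*} [Monoid M]

/-! The hermitian form becomes a product in the group algebra. Let `hat` send `∑ c g` to `∑ c ^ q
g⁻¹`. The coefficient of `x * hat y` at `1` is the hermitian product of `x` and `y`, and its other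
coefficients are of the same kind with `x` translated. Since `I` is a left ideal, the code is
self-orthogonal exactly when `x * hat y = 0` for all `x, y ∈ I` (`subset_hermitianDual_iff`).

Vanishing in the group algebra is tested by two-dimensional representations. For `β ^ n = 1`,
`dihedralRep` sends the rotation to `diag(β, β⁻¹)` and the reflection to the swap matrix `S`. The
first column of the image consists of two polynomials of degree less than `n` in `β`, and their
coefficients are those of the group algebra element; so an element killed at all `n` roots of unity
is zero. Embeddings over `F` carry vanishing from one root of `f j` to all others, and conjugation
by `S` carries it from `β` to `β⁻¹`. It therefore suffices to test at every `α j`, and at `α j ^ q`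
for the types `J₁` and `J₄` (`IsFactorisation.eq_zero_of_dihedralRep`). The components of `rho`
determine these representations, so `rho` is injective. A dimension count bounds the target by `2 *
n`, which makes `rho` an isomorphism (`rho_bijective`).

On representations, `hat` acts by transposing, raising entries to the power `q` and conjugating by
`S`, while `β` is replaced by `β ^ q` (`dihedralRep_hat`). Self-orthogonality thus says that, for
every `j`, the image of `x` at `α j ^ q`, times `S`, times the transposed `q`-power of the image of
`y` at `α j`, is zero (`IsFactorisation.mul_hat_eq_zero_iff`).

This condition involves only the component at `j`. In types `J₁` and `J₄` it pairs the two summands,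
which are independent. In types `J₂` and `J₃`, Galois theory of the finite field `F(α)` gives that
the degree `r` is odd and that `α ^ q`, respectively `α ^ (-q)`, equals `α ^ (q ^ (r + 1))`
(`root_zpow_eq`). The condition then becomes self-orthogonality of one ideal for a form twisted by
`x ↦ x ^ (q ^ r)`, with matrix `S`, respectively `1`. In type `J₁` the change of basis `Z` turns `S`
into a multiple of `!![2, s; s, 2]`, where `s` is the trace at `α ^ q`. Proper nonzero left ideals
of `M₂(E)` correspond to lines in `E ^ 2`, and the orthogonal of a line under an invertible form is
a line that can be written down (`orthogonal_iff`). This yields the lists for `J₁` to `J₄`; in type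
`J₀` the component is a commutative algebra of circulants and is computed directly. -/

lemma pow_val_add {u : M} (hu : u ^ n = 1) (i j : ZMod n) :
    u ^ (i + j).val = u ^ i.val * u ^ j.val := by
  rw [ZMod.val_add, ← pow_eq_pow_mod _ hu, pow_add]

lemma pow_mul_mul_pow {u v : M} (huv : u * v * u = v) (k : ℕ) : u ^ k * v * u ^ k = v := by
  induction k with
  | zero => simp
  | succ k ih =>
    calc u ^ (k + 1) * v * u ^ (k + 1) = u ^ k * (u * v * u) * u ^ k := by
          rw [pow_succ u k]; nth_rewrite 2 [← pow_succ]; rw [pow_succ']; simp only [mul_assoc]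
      _ = v := by rw [huv, ih]

/-- Powers of `u` on both sides of `v` cancel, so moving `v` across a power of `u` negates the
exponent. No inverses are used, as `M` is only a monoid. -/
lemma pow_val_mul {u v : M} (hu : u ^ n = 1) (huv : u * v * u = v) (i : ZMod n) :
    u ^ i.val * v = v * u ^ (-i).val := by
  have h : u ^ i.val * u ^ (-i).val = 1 := by rw [← pow_val_add hu]; simp
  calc u ^ i.val * v = u ^ i.val * v * (u ^ i.val * u ^ (-i).val) := by rw [h, mul_one]
    _ = (u ^ i.val * v * u ^ i.val) * u ^ (-i).val := by simp only [mul_assoc]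
    _ = _ := by rw [pow_mul_mul_pow huv]

/-- The homomorphism from the dihedral group determined by images of the two generators that
satisfy the defining relations. -/
def dihedralHom (u v : M) (hu : u ^ n = 1) (hv : v * v = 1) (huv : u * v * u = v) :
    DihedralGroup n →* M where
  toFun
    | .r i => u ^ i.val
    | .sr i => v * u ^ i.val
  map_one' := by
    show u ^ (0 : ZMod n).val = 1
    simp
  map_mul' := by
    rintro (i | i) (j | j)
    · simp [DihedralGroup.r_mul_r, pow_val_add hu]
    · rw [DihedralGroup.r_mul_sr]
      simp only [← mul_assoc]
      rw [pow_val_mul hu huv, mul_assoc, ← pow_val_add hu, neg_add_eq_sub]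
    · rw [DihedralGroup.sr_mul_r]
      simp only [mul_assoc]
      rw [pow_val_add hu]
    · rw [DihedralGroup.sr_mul_sr]
      simp only
      calc u ^ (j - i).val = v * v * u ^ (-i).val * u ^ j.val := by
            rw [hv, one_mul, ← pow_val_add hu, neg_add_eq_sub]
        _ = _ := by rw [mul_assoc v v, ← pow_val_mul hu huv]; simp only [mul_assoc]

variable (F : Type*) [Field F] {A : Type*} [Ring A] [Algebra F A]

/-- The algebra homomorphism from the group algebra of the dihedral group determined by images of
the two generators that satisfy the defining relations. -/
noncomputable def dihedralLift (u v : A) (hu : u ^ n = 1) (hv : v * v = 1) (huv : u * v * u = v) :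
    MonoidAlgebra F (DihedralGroup n) →ₐ[F] A :=
  MonoidAlgebra.lift F A (DihedralGroup n) (dihedralHom u v hu hv huv)

variable {F}

lemma dihedralLift_single (u v : A) (hu : u ^ n = 1) (hv : v * v = 1) (huv : u * v * u = v)
    (g : DihedralGroup n) (c : F) :
    dihedralLift F u v hu hv huv (MonoidAlgebra.single g c) =
      c • dihedralHom u v hu hv huv g := by
  simp [dihedralLift]

omit [NeZero n] in
lemma pow_val_one {u : M} (hu : u ^ n = 1) : u ^ (1 : ZMod n).val = u := by
  have : ((1 : ℕ) : ZMod n).val = 1 % n := ZMod.val_natCast n 1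
  rw [Nat.cast_one] at this
  -- For `n = 1` the exponent `1 % n` is `0`; reducing modulo `n` through `u ^ n = 1` covers this
  -- case too.
  rw [this, ← pow_eq_pow_mod _ hu, pow_one]

lemma dihedralLift_r (u v : A) (hu : u ^ n = 1) (hv : v * v = 1) (huv : u * v * u = v) :
    dihedralLift F u v hu hv huv (MonoidAlgebra.single (.r 1) 1) = u := by
  rw [dihedralLift_single, one_smul]
  exact pow_val_one hu

lemma dihedralLift_sr (u v : A) (hu : u ^ n = 1) (hv : v * v = 1) (huv : u * v * u = v) :
    dihedralLift F u v hu hv huv (MonoidAlgebra.single (.sr 0) 1) = v := by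
  rw [dihedralLift_single, one_smul]
  show v * u ^ (0 : ZMod n).val = v
  simp

lemma dihedral_algHom_ext {φ ψ : MonoidAlgebra F (DihedralGroup n) →ₐ[F] A}
    (hr : φ (MonoidAlgebra.single (.r 1) 1) = ψ (MonoidAlgebra.single (.r 1) 1))
    (hs : φ (MonoidAlgebra.single (.sr 0) 1) = ψ (MonoidAlgebra.single (.sr 0) 1)) : φ = ψ := by
  have key : ∀ i : ZMod n, φ (MonoidAlgebra.single (.r i) 1) = ψ (MonoidAlgebra.single (.r i) 1) := by
    intro i
    have : (MonoidAlgebra.single (.r i) 1 : MonoidAlgebra F (DihedralGroup n)) =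
        (MonoidAlgebra.single (.r 1) 1) ^ i.val := by
      rw [MonoidAlgebra.single_pow, DihedralGroup.r_one_pow, one_pow, ZMod.natCast_zmod_val]
    rw [this, map_pow, map_pow, hr]
  apply MonoidAlgebra.algHom_ext
  · rintro (i | i)
    · exact key i
    · have : (MonoidAlgebra.single (.sr i) 1 : MonoidAlgebra F (DihedralGroup n)) =
          MonoidAlgebra.single (.sr 0) 1 * MonoidAlgebra.single (.r i) 1 := by
        rw [MonoidAlgebra.single_mul_single, DihedralGroup.sr_mul_r, zero_add, one_mul]
      rw [this, map_mul, map_mul, hs, key]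
  · ext

end Lift

/-! ### The Frobenius map of order `q` -/

section Frobenius

variable (F : Type*) [Field F] [Fintype F] (L : Type*) [Field L] [Algebra F L]

variable {F} in
omit [Field F] in
lemma ne_zero_of_card_eq_sq [Nonempty F] {q : ℕ} (hq : Fintype.card F = q ^ 2) : q ≠ 0 := by
  rintro rfl
  have := Fintype.card_pos (α := F)
  omega

/-- The ring endomorphism `x ↦ x ^ q` of an extension of the field with `q ^ 2` elements. -/
def powHom {q : ℕ} (hq : Fintype.card F = q ^ 2) : L →+* L where
  __ := powMonoidHom q
  map_zero' := zero_pow (ne_zero_of_card_eq_sq hq)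
  map_add' x y := by
    obtain ⟨p, _, m, hp, hcard⟩ := FiniteField.card' F
    have : CharP L p := charP_of_injective_algebraMap' F p
    have : ExpChar L p := .prime hp
    -- `q` divides `q ^ 2 = p ^ m`, hence is a power of the characteristic `p`, and `x ↦ x ^ q` is
    -- an iterate of the Frobenius map.
    obtain ⟨k, -, rfl⟩ := (Nat.dvd_prime_pow hp).1 (hcard ▸ hq ▸ dvd_pow_self q two_ne_zero)
    exact add_pow_expChar_pow ..

variable {q : ℕ} (hq : Fintype.card F = q ^ 2)

@[simp] lemma powHom_apply (x : L) : powHom F L hq x = x ^ q := rfl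

lemma powHom_iterate (k : ℕ) (x : L) : (powHom F L hq)^[k] x = x ^ q ^ k := by
  show (fun y : L => y ^ q)^[k] x = _
  rw [pow_iterate]

end Frobenius

end DihedralCode

namespace DihedralCode

/-! ### Two-dimensional representations of the dihedral group -/

section Rep

variable {n : ℕ} [NeZero n] {F K : Type*} [Field F] [Field K] [Algebra F K]

lemma ne_zero_of_pow_eq_one {β : K} (hβ : β ^ n = 1) : β ≠ 0 := by
  rintro rfl
  simp [zero_pow (NeZero.ne n)] at hβ

lemma rot_pow (β : K) (k : ℕ) : rot β ^ k = !![β ^ k, 0; 0, β⁻¹ ^ k] := by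
  induction k with
  | zero => ext i j; fin_cases i <;> fin_cases j <;> simp
  | succ k ih => rw [pow_succ, ih]; simp [pow_succ]

omit [NeZero n] in
lemma rot_pow_eq_one {β : K} (hβ : β ^ n = 1) : rot β ^ n = 1 := by
  rw [rot_pow, inv_pow, hβ, inv_one, Matrix.one_fin_two]

lemma swapMat_mul_self (R : Type*) [CommRing R] : swapMat R * swapMat R = 1 := by
  simp [Matrix.one_fin_two]

lemma rot_mul_swapMat_mul_rot {β : K} (hβ : β ≠ 0) : rot β * swapMat K * rot β = swapMat K := by
  simp [hβ]

variable (F) in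
/-- The representation of the dihedral group that sends the rotation to `diag (β, β⁻¹)` and the
reflection to the permutation matrix. -/
noncomputable def dihedralRep (β : K) (hβ : β ^ n = 1) :
    MonoidAlgebra F (DihedralGroup n) →ₐ[F] Mat K :=
  dihedralLift F (rot β) (swapMat K) (rot_pow_eq_one hβ) (swapMat_mul_self K)
    (rot_mul_swapMat_mul_rot (ne_zero_of_pow_eq_one hβ))

lemma dihedralRep_r {β : K} (hβ : β ^ n = 1) (i : ZMod n) (c : F) :
    dihedralRep F β hβ (MonoidAlgebra.single (.r i) c) =
      !![algebraMap F K c * β ^ i.val, 0; 0, algebraMap F K c * β⁻¹ ^ i.val] := by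
  rw [dihedralRep, dihedralLift_single]
  show c • (rot β) ^ i.val = _
  rw [rot_pow]
  ext i j; fin_cases i <;> fin_cases j <;> simp [Algebra.smul_def]

lemma dihedralRep_sr {β : K} (hβ : β ^ n = 1) (i : ZMod n) (c : F) :
    dihedralRep F β hβ (MonoidAlgebra.single (.sr i) c) =
      !![0, algebraMap F K c * β⁻¹ ^ i.val; algebraMap F K c * β ^ i.val, 0] := by
  rw [dihedralRep, dihedralLift_single]
  show c • (swapMat K * (rot β) ^ i.val) = _
  rw [rot_pow]
  ext i j; fin_cases i <;> fin_cases j <;> simp [Algebra.smul_def]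

/-- The proof of `β ^ n = 1` is an argument of `dihedralRep`, so an equation for `β` cannot simply
be rewritten under it. -/
lemma dihedralRep_congr {β γ : K} (h : β = γ) (hβ : β ^ n = 1) (hγ : γ ^ n = 1)
    (z : MonoidAlgebra F (DihedralGroup n)) : dihedralRep F β hβ z = dihedralRep F γ hγ z := by
  subst h; rfl

lemma dihedralRep_map {L : Type*} [Field L] [Algebra F L] (φ : K →ₐ[F] L) {β : K} (hβ : β ^ n = 1)
    (hφ : φ β ^ n = 1) (z : MonoidAlgebra F (DihedralGroup n)) :
    dihedralRep F (φ β) hφ z = (dihedralRep F β hβ z).map φ := by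
  induction z using MonoidAlgebra.induction_linear with
  | zero => simp
  | add x y hx hy => rw [map_add, map_add, hx, hy, Matrix.map_add _ (map_add φ)]
  | single g c =>
    obtain i | i := g
    · rw [dihedralRep_r, dihedralRep_r]
      ext i j; fin_cases i <;> fin_cases j <;> simp
    · rw [dihedralRep_sr, dihedralRep_sr]
      ext i j; fin_cases i <;> fin_cases j <;> simp

/-- Exchanging the basis vectors exchanges the eigenvalues of the rotation and fixes the swap
matrix. Hence one member of each pair of mutually inverse roots of unity is enough. -/
lemma dihedralRep_inv {β : K} (hβ : β ^ n = 1) (hβ' : β⁻¹ ^ n = 1)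
    (z : MonoidAlgebra F (DihedralGroup n)) :
    dihedralRep F β⁻¹ hβ' z = swapMat K * dihedralRep F β hβ z * swapMat K := by
  induction z using MonoidAlgebra.induction_linear with
  | zero => simp
  | add x y hx hy => rw [map_add, map_add, hx, hy, mul_add, add_mul]
  | single g c =>
    obtain i | i := g
    · simp [dihedralRep_r]
    · simp [dihedralRep_sr]

/-- `f` is the minimal polynomial of `α`, so `F(α)` has the universal property of `F[X]/(f)`. With
`L = F(α)` this is the source of all automorphisms used below. -/
lemma exists_algHom_adjoin {L : Type*} [Field L] [Algebra F L] {f : F[X]}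
    (hf : f.Monic) (hfi : Irreducible f) {α : K} (hα : aeval α f = 0)
    {δ : L} (hδ : aeval δ f = 0) :
    ∃ φ : F⟮α⟯ →ₐ[F] L, φ (IntermediateField.AdjoinSimple.gen F α) = δ := by
  have hint : IsIntegral F α := ⟨f, hf, hα⟩
  have hmin : minpoly F α = f := (minpoly.eq_of_irreducible_of_monic hfi hα hf).symm
  have hgen : aeval δ (minpoly F (IntermediateField.adjoin.powerBasis hint).gen) = 0 := by
    rw [IntermediateField.adjoin.powerBasis_gen, IntermediateField.minpoly_gen, hmin, hδ]
  exact ⟨(IntermediateField.adjoin.powerBasis hint).lift δ hgen,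
    (IntermediateField.adjoin.powerBasis hint).lift_gen δ hgen⟩

/-- The representation at `α ^ k` already lives over `F(α)` and vanishes there; the embedding that
sends `α` to `δ` transports it to `δ ^ k`. The exponents needed are `1` and `q`. -/
lemma dihedralRep_eq_zero_of_root {L : Type*} [Field L] [Algebra F L] {f : F[X]}
    (hf : f.Monic) (hfi : Irreducible f) {α : K} (hα : aeval α f = 0)
    {δ : L} (hδ : aeval δ f = 0) (k : ℕ) (hαk : (α ^ k) ^ n = 1) (hδk : (δ ^ k) ^ n = 1)
    {z : MonoidAlgebra F (DihedralGroup n)} (hz : dihedralRep F (α ^ k) hαk z = 0) :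
    dihedralRep F (δ ^ k) hδk z = 0 := by
  obtain ⟨φ, hφ1⟩ := exists_algHom_adjoin hf hfi hα hδ
  set g : F⟮α⟯ := IntermediateField.AdjoinSimple.gen F α
  have hφ : φ (g ^ k) = δ ^ k := by rw [map_pow, hφ1]
  have hgn : (g ^ k) ^ n = 1 := by
    apply (algebraMap F⟮α⟯ K).injective
    simpa [g] using hαk
  have hg : dihedralRep F (g ^ k) hgn z = 0 := by
    have h1 := dihedralRep_map (IsScalarTower.toAlgHom F F⟮α⟯ K) hgn (by simpa [g] using hαk) z
    rw [dihedralRep_congr (γ := α ^ k) (by simp [g]) _ hαk, hz] at h1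
    ext i j
    have := congrFun (congrFun h1 i) j
    simpa using this.symm
  rw [dihedralRep_congr hφ.symm hδk (by rw [hφ, hδk]), dihedralRep_map φ hgn, hg]
  ext i j; simp

/-- The entries of the first column are the polynomials in `γ` whose coefficients are those of `z`
on rotations and on reflections. Their degree is less than `n`, so `n` distinct zeros force them to
vanish. -/
lemma eq_zero_of_dihedralRep_eq_zero {L : Type*} [Field L] [Algebra F L]
    (s : Finset L) (hs : n ≤ s.card) (hsn : ∀ γ ∈ s, γ ^ n = 1)
    {z : MonoidAlgebra F (DihedralGroup n)}
    (hz : ∀ γ (hγ : γ ∈ s), dihedralRep F γ (hsn γ hγ) z = 0) : z = 0 := by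
  have hentry : ∀ γ (hγ : γ ^ n = 1) (z : MonoidAlgebra F (DihedralGroup n)),
      dihedralRep F γ hγ z 0 0 = ∑ i : ZMod n, algebraMap F L (z.coeff (.r i)) * γ ^ i.val ∧
      dihedralRep F γ hγ z 1 0 = ∑ i : ZMod n, algebraMap F L (z.coeff (.sr i)) * γ ^ i.val := by
    intro γ hγ z
    classical
    induction z using MonoidAlgebra.induction_linear with
    | zero => simp
    | add x y hx hy => simp [hx.1, hx.2, hy.1, hy.2, add_mul, Finset.sum_add_distrib]
    | single g c =>
      obtain j | j := g
      · simp [dihedralRep_r, Finsupp.single_apply, apply_ite (algebraMap F L), ite_mul]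
      · simp [dihedralRep_sr, Finsupp.single_apply, apply_ite (algebraMap F L), ite_mul]
  have hpoly : ∀ a : ZMod n → F, (∀ γ ∈ s, ∑ i, algebraMap F L (a i) * γ ^ i.val = 0) →
      ∀ i, a i = 0 := by
    intro a ha i
    set p : L[X] := ∑ i : ZMod n, C (algebraMap F L (a i)) * X ^ i.val with hp
    have hdeg : p.natDegree < s.card := by
      refine lt_of_lt_of_le ?_ hs
      have : p.natDegree ≤ n - 1 := by
        refine natDegree_sum_le_of_forall_le _ _ fun i _ => ?_
        refine (natDegree_C_mul_X_pow_le _ _).trans ?_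
        have := ZMod.val_lt i
        omega
      have := NeZero.pos n
      omega
    have h0 : p = 0 := by
      refine Polynomial.eq_zero_of_natDegree_lt_card_of_eval_eq_zero' p s (fun γ hγ => ?_) hdeg
      rw [hp, eval_finsetSum]
      simpa using ha γ hγ
    have hc : p.coeff i.val = algebraMap F L (a i) := by
      rw [hp, finsetSum_coeff, Finset.sum_eq_single i]
      · simp
      · intro b _ hb
        rw [coeff_C_mul_X_pow, if_neg]
        exact fun h => hb (ZMod.val_injective n h.symm)
      · simp
    rw [h0, coeff_zero] at hc
    exact (map_eq_zero (algebraMap F L)).1 hc.symm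
  have h1 := hpoly (fun i => z.coeff (.r i)) fun γ hγ => by
    rw [← (hentry γ (hsn γ hγ) z).1, hz γ hγ]; rfl
  have h2 := hpoly (fun i => z.coeff (.sr i)) fun γ hγ => by
    rw [← (hentry γ (hsn γ hγ) z).2, hz γ hγ]; rfl
  ext g
  obtain i | i := g
  · exact h1 i
  · exact h2 i

end Rep

/-! ### The semilinear involution of the group algebra -/

section Hat

open scoped Matrix

variable {F G : Type*} [Field F] [Fintype F] [Group G] [Fintype G] {q : ℕ}

/-- The map `∑ c g ↦ ∑ c ^ q g⁻¹`. -/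
noncomputable def hat (hq : Fintype.card F = q ^ 2) : MonoidAlgebra F G →+ MonoidAlgebra F G where
  toFun z := ∑ g : G, MonoidAlgebra.single g⁻¹ (powHom F F hq (z.coeff g))
  map_zero' := by simp only [MonoidAlgebra.coeff_zero, Finsupp.zero_apply, map_zero,
    MonoidAlgebra.single_zero, Finset.sum_const_zero]
  map_add' x y := by
    simp only [MonoidAlgebra.coeff_add, Finsupp.add_apply, map_add, MonoidAlgebra.single_add,
      Finset.sum_add_distrib]

lemma hat_apply (hq : Fintype.card F = q ^ 2) (z : MonoidAlgebra F G) :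
    hat hq z = ∑ g : G, MonoidAlgebra.single g⁻¹ (powHom F F hq (z.coeff g)) := rfl

lemma hat_single (hq : Fintype.card F = q ^ 2) (g : G) (c : F) :
    hat hq (MonoidAlgebra.single g c) = MonoidAlgebra.single g⁻¹ (c ^ q) := by
  classical
  rw [hat_apply, Finset.sum_eq_single g]
  · simp
  · intro b _ hb
    rw [MonoidAlgebra.coeff_single, Finsupp.single_apply, if_neg hb.symm, map_zero, MonoidAlgebra.single_zero]
  · simp

/-- This is what `hat` is made for: the hermitian form is the identity coefficient of a product. -/
lemma coeff_mul_hat (hq : Fintype.card F = q ^ 2) (x y : MonoidAlgebra F G) :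
    (x * hat hq y).coeff 1 = ∑ g, x.coeff g * y.coeff g ^ q := by
  rw [hat_apply, Finset.mul_sum, MonoidAlgebra.coeff_sum, Finsupp.finsetSum_apply]
  simp

variable {K : Type*} [Field K] [Algebra F K] {n : ℕ} [NeZero n]

lemma pow_val_neg {β : K} (hβ : β ^ n = 1) (i : ZMod n) : β ^ (-i).val = (β ^ i.val)⁻¹ := by
  refine eq_inv_of_mul_eq_one_left ?_
  rw [← pow_val_add hβ]; simp

lemma swapMat_mul_transpose_mul_swapMat {R : Type*} [CommRing R] (M : Mat R) :
    swapMat R * Mᵀ * swapMat R = !![M 1 1, M 0 1; M 1 0, M 0 0] := by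
  rw [Matrix.eta_fin_two Mᵀ]
  simp

/-- For every group element, `S gᵀ S` is the image of `g⁻¹`: on diagonal matrices the conjugation by
`S` inverts, and on reflections it undoes the transposition. Raising scalars to the power `q` costs
the change from `β` to `β ^ q`. -/
lemma dihedralRep_hat (hq : Fintype.card F = q ^ 2) {β : K} (hβ : β ^ n = 1)
    (hβq : (β ^ q) ^ n = 1) (z : MonoidAlgebra F (DihedralGroup n)) :
    dihedralRep F (β ^ q) hβq (hat hq z) =
      swapMat K * ((dihedralRep F β hβ z).map (powHom F K hq))ᵀ * swapMat K := by
  have hq0 := ne_zero_of_card_eq_sq hq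
  rw [swapMat_mul_transpose_mul_swapMat]
  simp only [Matrix.map_apply]
  induction z using MonoidAlgebra.induction_linear with
  | zero => ext i j; fin_cases i <;> fin_cases j <;> simp [hq0]
  | add x y hx hy =>
    rw [map_add, map_add, map_add, hx, hy]
    ext i j; fin_cases i <;> fin_cases j <;> simp [-powHom_apply]
  | single g c =>
    rw [hat_single]
    obtain i | i := g
    · rw [DihedralGroup.inv_r, dihedralRep_r, dihedralRep_r, pow_val_neg hβq, inv_pow,
        pow_val_neg hβq]
      ext i j; fin_cases i <;> fin_cases j <;>
        simp [mul_pow, ← pow_mul, mul_comm q, hq0]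
    · rw [DihedralGroup.inv_sr, dihedralRep_sr, dihedralRep_sr]
      ext i j; fin_cases i <;> fin_cases j <;>
        simp [mul_pow, ← pow_mul, mul_comm q, hq0]

end Hat

end DihedralCode

namespace DihedralCode

/-! ### Conjugate and reciprocal polynomials -/

section Roots

variable {F : Type*} [Field F] {L : Type*} [Field L] [Algebra F L]

lemma conjPoly_eq_map [Fintype F] {q : ℕ} (hq : Fintype.card F = q ^ 2) (g : F[X]) :
    conjPoly q g = g.map (powHom F F hq) := by
  rw [conjPoly, Polynomial.map, eval₂_eq_sum]
  rfl

lemma aeval_conjPoly [Fintype F] {q : ℕ} (hq : Fintype.card F = q ^ 2) (g : F[X]) (x : L) :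
    aeval (x ^ q) (conjPoly q g) = aeval x g ^ q := by
  rw [conjPoly_eq_map hq, aeval_def, eval₂_map, ← powHom_apply F L hq (aeval x g), aeval_def,
    hom_eval₂]
  congr 1
  ext c
  simp

lemma aeval_recipPoly {g : F[X]} (hg : g.coeff 0 ≠ 0) {x : L} (hx : x ≠ 0) :
    aeval x (recipPoly g) = 0 ↔ aeval x⁻¹ g = 0 := by
  let _ : Invertible x⁻¹ := invertibleOfNonzero (inv_ne_zero hx)
  have := eval₂_reverse_eq_zero_iff (algebraMap F L) x⁻¹ g
  rw [invOf_eq_inv, inv_inv] at this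
  rw [recipPoly, map_mul, aeval_C, aeval_def, mul_eq_zero, this, aeval_def]
  simp [hg]

lemma coeff_zero_ne_zero_of_root {g : F[X]} (hg : Irreducible g) (hgm : g.Monic) {x : L}
    (hx : x ≠ 0) (hroot : aeval x g = 0) : g.coeff 0 ≠ 0 := by
  rw [minpoly.eq_of_irreducible_of_monic hg hroot hgm]
  exact fun h => hx ((minpoly.coeff_zero_eq_zero ⟨g, hgm, hroot⟩).1 h)

end Roots

/-! ### Roots of unity and the factorisation -/

section Factorisation

variable {F : Type*} [Field F] {J : Type*} [Fintype J] {q n : ℕ} {f : J → F[X]}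

lemma class_cases (q : ℕ) (g : F[X]) :
    IsJ0 q g ∨ IsJ1 q g ∨ IsJ2 q g ∨ IsJ3 q g ∨ IsJ4 q g := by
  unfold IsJ0 IsJ1 IsJ2 IsJ3 IsJ4
  by_cases h1 : g = conjPoly q g <;> by_cases h2 : g = recipPoly g <;>
    by_cases h3 : conjPoly q g = recipPoly g <;> tauto

lemma IsFactorisation.dvd (hf : IsFactorisation q n f) (j : J) : f j ∣ X ^ n - 1 := by
  classical
  rw [hf.prod_eq]
  obtain h | h | h | h | h := class_cases q (f j)
  · refine Dvd.dvd.mul_right (Dvd.dvd.mul_right (Dvd.dvd.mul_right ?_ _) _) _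
    exact Finset.dvd_prod_of_mem _ (by simpa using h)
  · refine Dvd.dvd.mul_right (Dvd.dvd.mul_right (Dvd.dvd.mul_left ?_ _) _) _
    exact (dvd_mul_right _ _).trans (Finset.dvd_prod_of_mem _ (by simpa using h))
  · refine Dvd.dvd.mul_right (Dvd.dvd.mul_left ?_ _) _
    exact (dvd_mul_right _ _).trans
      (Finset.dvd_prod_of_mem (fun j => f j * recipPoly (f j)) (by simpa using Or.inl h))
  · refine Dvd.dvd.mul_right (Dvd.dvd.mul_left ?_ _) _
    exact (dvd_mul_right _ _).trans
      (Finset.dvd_prod_of_mem (fun j => f j * recipPoly (f j)) (by simpa using Or.inr h))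
  · refine Dvd.dvd.mul_left ?_ _
    exact (((dvd_mul_right _ _).mul_right _).mul_right _).trans
      (Finset.dvd_prod_of_mem
        (fun j => f j * recipPoly (f j) * conjPoly q (f j) * conjPoly q (recipPoly (f j)))
        (by simpa using h))

lemma IsFactorisation.root_pow_eq_one (hf : IsFactorisation q n f) {K : Type*} [Field K]
    [Algebra F K] {j : J} {x : K} (hx : aeval x (f j) = 0) : x ^ n = 1 := by
  obtain ⟨g, hg⟩ := hf.dvd j
  have := congrArg (aeval x) hg
  rw [map_mul, hx, zero_mul] at this
  simpa [sub_eq_zero] using this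

/-- A root of `X ^ n - 1` is a root of some factor in the product, and roots of conjugate and
reciprocal polynomials are `q`-th powers and inverses of roots of the original. -/
lemma IsFactorisation.exists_root [Fintype F] (hq : Fintype.card F = q ^ 2) [NeZero n]
    (hf : IsFactorisation q n f)
    {L : Type*} [Field L] [Algebra F L] [IsAlgClosed L] {γ : L} (hγ : γ ^ n = 1)
    (hroot : ∀ j, ∃ x : L, aeval x (f j) = 0) :
    ∃ j, ∃ δ : L, aeval δ (f j) = 0 ∧ (γ = δ ∨ γ = δ⁻¹ ∨
      (IsJ1 q (f j) ∨ IsJ4 q (f j)) ∧ (γ = δ ^ q ∨ γ = (δ ^ q)⁻¹)) := by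
  classical
  have hq0 := ne_zero_of_card_eq_sq hq
  have hγ0 : γ ≠ 0 := ne_zero_of_pow_eq_one hγ
  have hcoeff : ∀ j, (f j).coeff 0 ≠ 0 := fun j => by
    obtain ⟨x, hx⟩ := hroot j
    exact coeff_zero_ne_zero_of_root (hf.irreducible j) (hf.monic j)
      (ne_zero_of_pow_eq_one (hf.root_pow_eq_one hx)) hx
  -- A `q`-th root of `γ` is extracted because a root of `conjPoly q g` is recognised only as the
  -- `q`-th power of a root of `g`.
  obtain ⟨ε, rfl⟩ := IsAlgClosed.exists_pow_nat_eq γ (Nat.pos_of_ne_zero hq0)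
  have hε0 : ε ≠ 0 := by rintro rfl; exact hγ0 (zero_pow hq0)
  have hconj : ∀ g : F[X], aeval (ε ^ q) (conjPoly q g) = 0 → aeval ε g = 0 := fun g hg => by
    rw [aeval_conjPoly hq] at hg
    exact eq_zero_of_pow_eq_zero hg
  have h := congrArg (aeval (ε ^ q)) hf.prod_eq
  rw [map_sub, map_pow, aeval_X, map_one, hγ, sub_self] at h
  simp only [map_mul, map_prod] at h
  obtain ((h | h) | h) | h := by simpa only [zero_eq_mul, mul_eq_zero] using h
  · obtain ⟨j, hj, h⟩ := Finset.prod_eq_zero_iff.1 h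
    exact ⟨j, _, h, Or.inl rfl⟩
  · obtain ⟨j, hj, h⟩ := Finset.prod_eq_zero_iff.1 h
    obtain h | h := mul_eq_zero.1 h
    · exact ⟨j, _, h, Or.inl rfl⟩
    · exact ⟨j, ε, hconj _ h, Or.inr (Or.inr ⟨Or.inl (by simpa using hj), Or.inl rfl⟩)⟩
  · obtain ⟨j, hj, h⟩ := Finset.prod_eq_zero_iff.1 h
    obtain h | h := mul_eq_zero.1 h
    · exact ⟨j, _, h, Or.inl rfl⟩
    · exact ⟨j, (ε ^ q)⁻¹, (aeval_recipPoly (hcoeff j) hγ0).1 h, Or.inr (Or.inl (by simp))⟩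
  · obtain ⟨j, hj, h⟩ := Finset.prod_eq_zero_iff.1 h
    obtain ((h | h) | h) | h := by simpa only [mul_eq_zero] using h
    · exact ⟨j, _, h, Or.inl rfl⟩
    · exact ⟨j, (ε ^ q)⁻¹, (aeval_recipPoly (hcoeff j) hγ0).1 h, Or.inr (Or.inl (by simp))⟩
    · exact ⟨j, ε, hconj _ h, Or.inr (Or.inr ⟨Or.inr (by simpa using hj), Or.inl rfl⟩)⟩
    · exact ⟨j, ε⁻¹, (aeval_recipPoly (hcoeff j) hε0).1 (hconj _ h),
        Or.inr (Or.inr ⟨Or.inr (by simpa using hj), Or.inr (by simp)⟩)⟩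

/-- `q` is zero in `F`, so a Bézout relation between `q` and `n` would read `0 = 1` if `n` were zero
too. -/
lemma natCast_ne_zero_of_coprime [Fintype F] (hq : Fintype.card F = q ^ 2)
    (hqn : Nat.Coprime q n) : (n : F) ≠ 0 := by
  intro hn
  have hq' : (q : F) = 0 := by
    have : ((q ^ 2 : ℕ) : F) = 0 := by rw [← hq]; exact FiniteField.cast_card_eq_zero F
    rw [Nat.cast_pow] at this
    exact eq_zero_of_pow_eq_zero this
  obtain ⟨a, b, hab⟩ := Nat.isCoprime_iff_coprime.2 hqn
  have := congrArg (Int.cast : ℤ → F) hab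
  push_cast at this
  rw [hq', hn] at this
  simp at this

variable {K : Type*} [Field K] [Algebra F K] {α : J → K}

lemma IsFactorisation.pow_eq_one (hf : IsFactorisation q n f) (hα : ∀ j, aeval (α j) (f j) = 0)
    (j : J) : α j ^ n = 1 := hf.root_pow_eq_one (hα j)

lemma pow_pow_eq_one {x : K} (hx : x ^ n = 1) (k : ℕ) : (x ^ k) ^ n = 1 := by
  rw [← pow_mul, mul_comm, pow_mul, hx, one_pow]

/-- Over an algebraic closure `X ^ n - 1` has `n` distinct roots, because `n` is invertible in `F`.
Each of them is reached from a root of some `f j` by inversion and, in types `J₁` and `J₄`, the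
`q`-th power. -/
lemma IsFactorisation.eq_zero_of_dihedralRep [Fintype F] (hq : Fintype.card F = q ^ 2)
    (hqn : Nat.Coprime q n) [NeZero n] (hf : IsFactorisation q n f)
    (hα : ∀ j, aeval (α j) (f j) = 0) {z : MonoidAlgebra F (DihedralGroup n)}
    (h1 : ∀ j, dihedralRep F (α j) (hf.pow_eq_one hα j) z = 0)
    (h2 : ∀ j, IsJ1 q (f j) ∨ IsJ4 q (f j) →
      dihedralRep F (α j ^ q) (pow_pow_eq_one (hf.pow_eq_one hα j) q) z = 0) : z = 0 := by
  classical
  set L := AlgebraicClosure K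
  set p : L[X] := X ^ n - 1
  have hp0 : p ≠ 0 := X_pow_sub_C_ne_zero (NeZero.pos n) 1
  have hmem : ∀ γ, γ ∈ p.roots.toFinset ↔ γ ^ n = 1 := fun γ => by
    rw [Multiset.mem_toFinset, mem_roots hp0]
    simp [p, sub_eq_zero]
  have hcard : n ≤ p.roots.toFinset.card := by
    have hsep : p.Separable := by
      refine (X_pow_sub_one_separable_iff (F := L)).2 ?_
      rw [← map_natCast (algebraMap F L)]
      exact (_root_.map_ne_zero _).2 (natCast_ne_zero_of_coprime hq hqn)
    rw [Multiset.toFinset_card_of_nodup (nodup_roots hsep),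
      (IsAlgClosed.splits p).natDegree_eq_card_roots.symm]
    exact (natDegree_X_pow_sub_C (n := n) (r := (1 : L))).ge
  refine eq_zero_of_dihedralRep_eq_zero p.roots.toFinset hcard (fun γ h => (hmem γ).1 h) ?_
  intro γ hγ
  have hroot : ∀ j, ∃ x : L, aeval x (f j) = 0 := fun j =>
    ⟨algebraMap K L (α j), by rw [aeval_algebraMap_apply, hα, map_zero]⟩
  obtain ⟨j, δ, hδ, h⟩ := hf.exists_root hq ((hmem γ).1 hγ) hroot
  have hδn := hf.root_pow_eq_one hδ
  have hδ1 : dihedralRep F δ hδn z = 0 := by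
    have := dihedralRep_eq_zero_of_root (hf.monic j) (hf.irreducible j) (hα j) hδ 1
      (by rw [pow_one]; exact hf.pow_eq_one hα j) (by rw [pow_one]; exact hδn) (z := z)
      (by rw [dihedralRep_congr (pow_one _) _ (hf.pow_eq_one hα j)]; exact h1 j)
    rwa [dihedralRep_congr (pow_one _) _ hδn] at this
  have hδ2 : IsJ1 q (f j) ∨ IsJ4 q (f j) →
      dihedralRep F (δ ^ q) (pow_pow_eq_one hδn q) z = 0 := fun hj =>
    dihedralRep_eq_zero_of_root (hf.monic j) (hf.irreducible j) (hα j) hδ q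
      _ _ (h2 j hj)
  obtain rfl | rfl | ⟨hj, rfl | rfl⟩ := h
  · exact hδ1
  · rw [dihedralRep_inv hδn, hδ1, mul_zero, zero_mul]
  · exact hδ2 hj
  · rw [dihedralRep_inv (pow_pow_eq_one hδn q), hδ2 hj, mul_zero, zero_mul]

end Factorisation

/-! ### The Galois theory of a simple extension -/

section Galois

variable {F : Type*} [Field F] [Fintype F]

lemma exists_eq_frobenius_pow {E : Type*} [Field E] [Finite E] [Algebra F E] (g : E →ₐ[F] E) :
    ∃ k : ℕ, g = FiniteField.frobeniusAlgHom F E ^ k := by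
  obtain ⟨k, hk⟩ := (FiniteField.bijective_frobeniusAlgHom_pow F E).2 g
  exact ⟨k, hk.symm⟩

lemma frobenius_pow_apply {E : Type*} [CommRing E] [Algebra F E] (k : ℕ) (x : E) :
    (FiniteField.frobeniusAlgHom F E ^ k) x = x ^ Fintype.card F ^ k := by
  rw [AlgHom.coe_pow, FiniteField.coe_frobeniusAlgHom, pow_iterate]

/-- The automorphism group is cyclic of order `r`, generated by the Frobenius. A square root `φ ^ k`
of the generator needs `2k ≡ 1` modulo `r`, which forces `r` odd and `k ≡ (r + 1) / 2`. -/
lemma odd_finrank_of_comp_self {E : Type*} [Field E] [Finite E] [Algebra F E] {g : E →ₐ[F] E}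
    (hg : g * g = FiniteField.frobeniusAlgHom F E) :
    Odd (Module.finrank F E) ∧
      g = FiniteField.frobeniusAlgHom F E ^ ((Module.finrank F E + 1) / 2) := by
  obtain ⟨k, rfl⟩ := exists_eq_frobenius_pow g
  have hord := FiniteField.orderOf_frobeniusAlgHom F E
  set φ := FiniteField.frobeniusAlgHom F E
  set r := Module.finrank F E
  have hmod : k + k ≡ 1 [MOD r] := by
    have hfin : IsOfFinOrder φ := orderOf_pos_iff.1 (hord ▸ Module.finrank_pos)
    have : φ ^ (k + k) = φ ^ 1 := by rw [pow_add, hg, pow_one]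
    rw [← hord]
    exact hfin.pow_eq_pow_iff_modEq.1 this
  have hodd : Odd r := by
    rw [← Nat.not_even_iff_odd]
    intro he
    have := hmod.of_dvd he.two_dvd
    rw [Nat.ModEq] at this
    omega
  refine ⟨hodd, ?_⟩
  obtain ⟨m, hm⟩ := hodd
  have hfin : IsOfFinOrder φ := orderOf_pos_iff.1 (hord ▸ Module.finrank_pos)
  refine hfin.pow_eq_pow_iff_modEq.2 ?_
  rw [hord]
  refine Nat.ModEq.cancel_left_of_coprime (c := 2) ?_ ?_
  · rw [hm]; simp
  · have h2 : 2 * ((r + 1) / 2) = 1 + r := by omega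
    rw [h2, two_mul]
    exact hmod.trans (by simp [Nat.ModEq])

variable {K : Type*} [Field K] [Algebra F K] {f : F[X]}

lemma finite_adjoin_root (hf : f.Monic) {α : K} (hα : aeval α f = 0) : Finite F⟮α⟯ := by
  have := IntermediateField.adjoin.finiteDimensional (K := F) (x := α) ⟨f, hf, hα⟩
  exact Module.finite_of_finite F

omit [Fintype F] in
lemma finrank_adjoin_root (hf : f.Monic) (hfi : Irreducible f) {α : K} (hα : aeval α f = 0) :
    Module.finrank F F⟮α⟯ = f.natDegree := by
  rw [IntermediateField.adjoin.finrank ⟨f, hf, hα⟩,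
    ← minpoly.eq_of_irreducible_of_monic hfi hα hf]

omit [Fintype F] in
lemma adjoin_algHom_ext {L : Type*} [Field L] [Algebra F L] (hf : f.Monic) {α : K}
    (hα : aeval α f = 0) {g h : F⟮α⟯ →ₐ[F] L}
    (hgh : g (IntermediateField.AdjoinSimple.gen F α) =
      h (IntermediateField.AdjoinSimple.gen F α)) : g = h :=
  (IntermediateField.adjoin.powerBasis ⟨f, hf, hα⟩).algHom_ext hgh

omit [Fintype F] in
lemma aeval_gen_zpow {α : K} (e : ℤ) (h : aeval (α ^ e) f = 0) :
    aeval (IntermediateField.AdjoinSimple.gen F α ^ e) f = 0 := by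
  apply (algebraMap F⟮α⟯ K).injective
  rw [← aeval_algebraMap_apply, map_zpow₀, IntermediateField.AdjoinSimple.algebraMap_gen, h,
    map_zero]

/-- Used with `e = q` and `e = -q`. The automorphism `α ↦ α ^ e` of `F(α)` squares to `α ↦ α ^ (q ^
2)`, the Frobenius over `F`; so it is the Frobenius to the power `(r + 1) / 2`, that is `x ↦ x ^ (q
^ (r + 1))`. -/
lemma root_zpow_eq {q : ℕ} (hq : Fintype.card F = q ^ 2) (hf : f.Monic) (hfi : Irreducible f)
    {α : K} (hα : aeval α f = 0) {e : ℤ} (he : e * e = q ^ 2) (hroot : aeval (α ^ e) f = 0) :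
    Odd f.natDegree ∧ α ^ e = α ^ (q ^ (f.natDegree + 1)) := by
  have := finite_adjoin_root hf hα
  obtain ⟨g, hg⟩ := exists_algHom_adjoin hf hfi hα (aeval_gen_zpow e hroot)
  have hgg : g * g = FiniteField.frobeniusAlgHom F F⟮α⟯ := by
    refine adjoin_algHom_ext hf hα ?_
    rw [AlgHom.mul_apply, hg, map_zpow₀, hg, ← zpow_mul, he,
      FiniteField.coe_frobeniusAlgHom, hq]
    norm_cast
  obtain ⟨hodd, hg'⟩ := odd_finrank_of_comp_self hgg
  rw [finrank_adjoin_root hf hfi hα] at hodd hg'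
  refine ⟨hodd, ?_⟩
  rw [hg', frobenius_pow_apply, hq, ← pow_mul] at hg
  have h2 : 2 * ((f.natDegree + 1) / 2) = f.natDegree + 1 := by
    obtain ⟨m, hm⟩ := hodd
    omega
  rw [h2] at hg
  have := congrArg (algebraMap F⟮α⟯ K) hg
  rw [map_zpow₀, map_pow, IntermediateField.AdjoinSimple.algebraMap_gen] at this
  exact this.symm

/-- `α ↦ α⁻¹` is an automorphism whose square is trivial, in a group of odd order; hence it is
trivial. -/
lemma inv_eq_self_of_odd (hf : f.Monic) (hfi : Irreducible f) (hodd : Odd f.natDegree)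
    {α : K} (hα : aeval α f = 0) (hroot : aeval α⁻¹ f = 0) : α⁻¹ = α := by
  have := finite_adjoin_root hf hα
  rw [← zpow_neg_one] at hroot
  obtain ⟨g, hg⟩ := exists_algHom_adjoin hf hfi hα (aeval_gen_zpow (-1) hroot)
  have hgg : g * g = 1 := by
    refine adjoin_algHom_ext hf hα ?_
    rw [AlgHom.mul_apply, hg, map_zpow₀, hg, AlgHom.one_apply]
    simp
  have h1 : g = 1 := by
    obtain ⟨k, rfl⟩ := exists_eq_frobenius_pow g
    rw [← pow_add] at hgg
    have hd := orderOf_dvd_of_pow_eq_one hgg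
    rw [FiniteField.orderOf_frobeniusAlgHom, finrank_adjoin_root hf hfi hα, ← two_mul] at hd
    refine orderOf_dvd_iff_pow_eq_one.1 ?_
    rw [FiniteField.orderOf_frobeniusAlgHom, finrank_adjoin_root hf hfi hα]
    exact hodd.coprime_two_right.dvd_of_dvd_mul_left hd
  rw [h1, AlgHom.one_apply, zpow_neg_one] at hg
  have := congrArg (algebraMap F⟮α⟯ K) hg
  rw [map_inv₀, IntermediateField.AdjoinSimple.algebraMap_gen] at this
  exact this.symm

omit [Fintype F] in
lemma eq_X_sub_one_or (hf : f.Monic) (hfi : Irreducible f) {α : K} (hα : aeval α f = 0)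
    (h0 : α ≠ 0) (h : α⁻¹ = α) : α = 1 ∧ f = X - 1 ∨ α = -1 ∧ f = X + 1 := by
  have hmin := minpoly.eq_of_irreducible_of_monic hfi hα hf
  have hsq : α * α = 1 := by
    nth_rewrite 1 [← h]
    exact inv_mul_cancel₀ h0
  obtain rfl | rfl := mul_self_eq_one_iff.1 hsq
  · left
    refine ⟨rfl, ?_⟩
    rw [hmin, ← map_one (algebraMap F K), minpoly.eq_X_sub_C, map_one]
  · right
    refine ⟨rfl, ?_⟩
    rw [hmin, ← map_one (algebraMap F K), ← map_neg, minpoly.eq_X_sub_C]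
    simp

omit [Fintype F] in
-- `F(α + α⁻¹)` is a proper subfield of `F(α)`, being fixed by the nontrivial conjugation `α ↦ α⁻¹`,
-- so the relative degree is at least two.
lemma two_mul_finrank_adjoin_add_inv_le (hf : f.Monic) (hfi : Irreducible f) {α : K}
    (hα : aeval α f = 0) (hroot : aeval α⁻¹ f = 0) (hne : α⁻¹ ≠ α) :
    2 * Module.finrank F F⟮α + α⁻¹⟯ ≤ f.natDegree := by
  rw [← finrank_adjoin_root hf hfi hα]
  have := IntermediateField.adjoin.finiteDimensional (K := F) (x := α) ⟨f, hf, hα⟩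
  have hmem : α ∈ F⟮α⟯ := IntermediateField.mem_adjoin_simple_self F α
  have hle : F⟮α + α⁻¹⟯ ≤ F⟮α⟯ := by
    rw [IntermediateField.adjoin_simple_le_iff]
    exact add_mem hmem (inv_mem hmem)
  have hnot : ¬ F⟮α⟯ ≤ F⟮α + α⁻¹⟯ := by
    intro hle'
    obtain ⟨g, hg⟩ := exists_algHom_adjoin hf hfi hα hroot
    -- If `α` were a rational expression in `α + α⁻¹`, applying the embedding `α ↦ α⁻¹` would leave
    -- that expression unchanged and give `α⁻¹ = α`.
    obtain ⟨r, t, hrt⟩ := IntermediateField.mem_adjoin_simple_iff F α |>.1 (hle' hmem)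
    set x := IntermediateField.AdjoinSimple.gen F α
    have hx : algebraMap F⟮α⟯ K x = α := IntermediateField.AdjoinSimple.algebraMap_gen F α
    have hxrt : x = aeval (x + x⁻¹) r / aeval (x + x⁻¹) t := by
      apply (algebraMap F⟮α⟯ K).injective
      rw [map_div₀, ← aeval_algebraMap_apply, ← aeval_algebraMap_apply, map_add, map_inv₀, hx]
      exact hrt
    have := congrArg g hxrt
    rw [map_div₀, ← aeval_algHom_apply, ← aeval_algHom_apply, map_add, map_inv₀, hg, inv_inv,
      add_comm α⁻¹, ← hrt] at this
    exact hne this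
  have hmul := IntermediateField.finrank_bot_mul_relfinrank hle
  have h1 : IntermediateField.relfinrank F⟮α + α⁻¹⟯ F⟮α⟯ ≠ 1 := by
    rwa [Ne, IntermediateField.relfinrank_eq_one_iff]
  have h0 : IntermediateField.relfinrank F⟮α + α⁻¹⟯ F⟮α⟯ ≠ 0 := by
    intro h
    rw [h, mul_zero] at hmul
    exact Module.finrank_pos.ne hmul
  rw [← hmul, mul_comm]
  exact Nat.mul_le_mul_left _ (by omega)

end Galois

end DihedralCode

namespace DihedralCode

/-! ### Self-orthogonal codes and products in the group algebra -/

section SelfOrthogonal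

open scoped Matrix

variable {F : Type*} [Field F] [Fintype F] {q : ℕ}

omit [Fintype F] in
lemma coeff_sum_single {ι G : Type*} [Fintype ι] (φ : ι ≃ G) (c : ι → F) (i : ι) :
    (∑ i, MonoidAlgebra.single (φ i) (c i)).coeff (φ i) = c i := by
  classical
  rw [MonoidAlgebra.coeff_sum, Finsupp.finsetSum_apply, Finset.sum_eq_single i]
  · simp
  · intro j _ hj
    simp [hj]
  · simp

lemma subset_hermitianDual_iff {ι G : Type*} [Fintype ι] [Group G] [Fintype G]
    (hq : Fintype.card F = q ^ 2) (φ : ι ≃ G) (C : Submodule F (ι → F))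
    (I : Ideal (MonoidAlgebra F G)) (hI : (I : Set (MonoidAlgebra F G)) = codeSet φ C) :
    (C : Set (ι → F)) ⊆ hermitianDual q C ↔ ∀ x ∈ I, ∀ y ∈ I, x * hat hq y = 0 := by
  have hmem : ∀ x, x ∈ I ↔ ∃ c ∈ C, x = ∑ i, MonoidAlgebra.single (φ i) (c i) := fun x => by
    rw [← SetLike.mem_coe, hI]; rfl
  have hform : ∀ c d : ι → F, ((∑ i, MonoidAlgebra.single (φ i) (c i)) *
      hat hq (∑ i, MonoidAlgebra.single (φ i) (d i))).coeff 1 = ∑ i, c i * d i ^ q := by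
    intro c d
    rw [coeff_mul_hat, ← φ.sum_comp]
    exact Finset.sum_congr rfl fun i _ => by rw [coeff_sum_single, coeff_sum_single]
  constructor
  · intro h x hx y hy
    ext g
    -- Left translation by `g⁻¹` moves the coefficient at `g` to the identity, where it is a
    -- hermitian product of two codewords.
    have hx' : MonoidAlgebra.single g⁻¹ 1 * x ∈ I := I.mul_mem_left _ hx
    obtain ⟨c, hc, hxc⟩ := (hmem _).1 hx'
    obtain ⟨d, hd, rfl⟩ := (hmem _).1 hy
    have h1 := hform c d
    rw [← hxc, mul_assoc, MonoidAlgebra.coeff_single_mul_apply, inv_inv, mul_one, one_mul] at h1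
    rw [h1]
    exact h hd c hc
  · intro h d hd c hc
    rw [← hform c d, h _ ((hmem _).2 ⟨c, hc, rfl⟩) _ ((hmem _).2 ⟨d, hd, rfl⟩)]
    rfl

variable {J : Type*} [Fintype J] {n : ℕ} [NeZero n] {f : J → F[X]} {K : Type*} [Field K]
  [Algebra F K] {α : J → K}

omit [Fintype F] [NeZero n] in
lemma IsFactorisation.pow_q_pow_eq_one (hf : IsFactorisation q n f)
    (hα : ∀ j, aeval (α j) (f j) = 0) (j : J) : (α j ^ q) ^ n = 1 :=
  pow_pow_eq_one (hf.pow_eq_one hα j) q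

lemma mul_swapMat_eq_zero_iff (M : Mat K) : M * swapMat K = 0 ↔ M = 0 := by
  refine ⟨fun h => ?_, fun h => by rw [h, zero_mul]⟩
  rw [← mul_one M, ← swapMat_mul_self, ← mul_assoc, h, zero_mul]

lemma transpose_swapMat : (swapMat K)ᵀ = swapMat K := by
  ext i j; fin_cases i <;> fin_cases j <;> rfl

lemma map_swapMat {L : Type*} [Field L] (θ : K →+* L) : (swapMat K).map θ = swapMat L := by
  ext i j; fin_cases i <;> fin_cases j <;> simp

/-- Testing at every `α j ^ q` suffices, although the vanishing criterion also asks for `α j`. The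
condition is symmetric in the pair: interchanging `x` and `y`, transposing and raising to the power
`q` turns it into vanishing at `α j ^ (q ^ 2)`, a conjugate of `α j` over `F`. -/
lemma IsFactorisation.mul_hat_eq_zero_iff (hq : Fintype.card F = q ^ 2)
    (hqn : Nat.Coprime q n) (hf : IsFactorisation q n f) (hα : ∀ j, aeval (α j) (f j) = 0)
    (I : Ideal (MonoidAlgebra F (DihedralGroup n))) :
    (∀ x ∈ I, ∀ y ∈ I, x * hat hq y = 0) ↔ ∀ j, ∀ x ∈ I, ∀ y ∈ I,
      dihedralRep F (α j ^ q) (hf.pow_q_pow_eq_one hα j) x * swapMat K *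
        ((dihedralRep F (α j) (hf.pow_eq_one hα j) y).map (powHom F K hq))ᵀ = 0 := by
  have key : ∀ {β : K} (hβ : β ^ n = 1) (x y : MonoidAlgebra F (DihedralGroup n)),
      dihedralRep F (β ^ q) (pow_pow_eq_one hβ q) (x * hat hq y) =
        dihedralRep F (β ^ q) (pow_pow_eq_one hβ q) x * swapMat K *
        ((dihedralRep F β hβ y).map (powHom F K hq))ᵀ * swapMat K := by
    intro β hβ x y
    rw [map_mul, dihedralRep_hat hq hβ]
    simp only [mul_assoc]
  constructor
  · intro h j x hx y hy
    have := key (hf.pow_eq_one hα j) x y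
    rw [h x hx y hy, map_zero] at this
    exact (mul_swapMat_eq_zero_iff _).1 this.symm
  · intro h x hx y hy
    have h1 : ∀ j, dihedralRep F (α j ^ q) (hf.pow_q_pow_eq_one hα j) (x * hat hq y) = 0 := by
      intro j
      rw [key (hf.pow_eq_one hα j), h j x hx y hy, zero_mul]
    refine hf.eq_zero_of_dihedralRep hq hqn hα (fun j => ?_) fun j _ => h1 j
    have hα1 := hf.pow_eq_one hα j
    -- Since `x ↦ x ^ (q ^ 2)` is the Frobenius over `F`, the representation at `α j ^ (q ^ 2)` is
    -- the entrywise `q ^ 2`-power of the one at `α j`.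
    have hpow : FiniteField.frobeniusAlgHom F K (α j) = (α j ^ q) ^ q := by
      rw [FiniteField.frobeniusAlgHom_apply, hq, sq, pow_mul]
    have hsq : ∀ z, dihedralRep F ((α j ^ q) ^ q)
        (pow_pow_eq_one (hf.pow_q_pow_eq_one hα j) q) z =
        ((dihedralRep F (α j) hα1 z).map (powHom F K hq)).map (powHom F K hq) := by
      intro z
      rw [dihedralRep_congr hpow.symm _ (by rw [hpow]; exact pow_pow_eq_one (hf.pow_q_pow_eq_one hα j) q),
        dihedralRep_map _ hα1]
      ext a b
      simp [hq, sq, pow_mul]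
    have h2 := key (hf.pow_q_pow_eq_one hα j) x y
    -- The hypothesis is used with `x` and `y` interchanged, then transposed and raised to the power
    -- `q`.
    have h3 := congrArg (fun M : Mat K => Mᵀ.map (powHom F K hq)) (h j y hy x hx)
    simp only [Matrix.transpose_mul, Matrix.transpose_transpose, transpose_swapMat,
      Matrix.map_mul, map_swapMat] at h3
    rw [← mul_assoc, Matrix.transpose_map, Matrix.transpose_zero,
      Matrix.map_zero _ (map_zero _)] at h3
    rw [hsq x, h3, zero_mul, hsq] at h2
    ext a b
    have := congrFun (congrFun h2 a) b
    rw [Matrix.map_apply, Matrix.map_apply, Matrix.zero_apply, map_eq_zero, map_eq_zero] at this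
    exact this

end SelfOrthogonal

end DihedralCode

namespace DihedralCode

/-! ### Left ideals of the algebra of `2 × 2` matrices -/

section RowIdeal

open scoped Matrix

variable {E : Type*} [Field E]

/-- The left ideal of `M₂(E)` generated by the matrix with rows `(x, y)` and `(0, 0)`. -/
def rowIdeal (x y : E) : Ideal (Mat E) := Ideal.span {!![x, y; 0, 0]}

lemma mem_rowIdeal {x y : E} {M : Mat E} :
    M ∈ rowIdeal x y ↔ ∃ a b, M = !![a * x, a * y; b * x, b * y] := by
  rw [rowIdeal, Ideal.mem_span_singleton']
  constructor
  · rintro ⟨A, rfl⟩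
    refine ⟨A 0 0, A 1 0, ?_⟩
    conv_lhs => rw [Matrix.eta_fin_two A]
    simp
  · rintro ⟨a, b, rfl⟩
    exact ⟨!![a, 0; b, 0], by simp⟩

lemma row_mem_of_mem {I : Ideal (Mat E)} {M : Mat E} (hM : M ∈ I) (a b : E) :
    !![a * M 0 0 + b * M 1 0, a * M 0 1 + b * M 1 1; 0, 0] ∈ I := by
  convert I.mul_mem_left !![a, b; 0, 0] hM using 1
  ext i j; fin_cases i <;> fin_cases j <;> simp [Matrix.mul_apply, Fin.sum_univ_two]

lemma mem_of_rows {I : Ideal (Mat E)} {a b c d : E} (h0 : !![a, b; 0, 0] ∈ I)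
    (h1 : !![c, d; 0, 0] ∈ I) : !![a, b; c, d] ∈ I := by
  have := I.add_mem h0 (I.mul_mem_left !![0, 0; 1, 0] h1)
  simpa using this

lemma rowIdeal_le_iff {I : Ideal (Mat E)} {x y : E} :
    rowIdeal x y ≤ I ↔ !![x, y; 0, 0] ∈ I := by
  rw [rowIdeal, Ideal.span_singleton_le_iff_mem]

lemma rowIdeal_smul {c : E} (hc : c ≠ 0) (x y : E) : rowIdeal (c * x) (c * y) = rowIdeal x y := by
  apply le_antisymm
  · rw [rowIdeal_le_iff, mem_rowIdeal]
    exact ⟨c, 0, by simp⟩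
  · rw [rowIdeal_le_iff, mem_rowIdeal]
    exact ⟨c⁻¹, 0, by simp [hc]⟩

lemma mul_eq_mul_of_rowIdeal_eq {x y x' y' : E} (h : rowIdeal x y = rowIdeal x' y') :
    x * y' = y * x' := by
  have h1 := rowIdeal_le_iff.1 h.le
  obtain ⟨a, b, hab⟩ := mem_rowIdeal.1 h1
  have h0 := congrFun (congrFun hab 0) 0
  have h1 := congrFun (congrFun hab 0) 1
  simp at h0 h1
  rw [h0, h1]
  ring

/-- The ideal of a line is minimal: some row of a nonzero member is a nonzero multiple of `(x, y)`
and can be scaled back. -/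
lemma eq_bot_or_eq_of_le_rowIdeal {I : Ideal (Mat E)} {x y : E} (h : I ≤ rowIdeal x y) :
    I = ⊥ ∨ I = rowIdeal x y := by
  refine or_iff_not_imp_left.2 fun hI => le_antisymm h ?_
  obtain ⟨M, hM, hM0⟩ := Submodule.exists_mem_ne_zero_of_ne_bot hI
  obtain ⟨a, b, rfl⟩ := mem_rowIdeal.1 (h hM)
  rw [rowIdeal_le_iff]
  by_cases ha : a = 0
  · have hb : b ≠ 0 := by
      rintro rfl
      apply hM0
      ext i j; fin_cases i <;> fin_cases j <;> simp [ha]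
    simpa [hb] using row_mem_of_mem hM 0 b⁻¹
  · simpa [ha] using row_mem_of_mem hM a⁻¹ 0

/-- A left ideal is determined by the subspace of `E ^ 2` formed by the rows of its members. The
subspaces are `0`, the plane, the line through `(0, 1)` and the lines through `(1, l)`. -/
lemma left_ideal_cases (I : Ideal (Mat E)) :
    I = ⊥ ∨ I = ⊤ ∨ I = rowIdeal 0 1 ∨ ∃ l, I = rowIdeal 1 l := by
  by_cases h : ∃ l, !![1, l; 0, 0] ∈ I
  · obtain ⟨l, hl⟩ := h
    by_cases h' : !![0, 1; 0, 0] ∈ I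
    · refine Or.inr (Or.inl ((Ideal.eq_top_iff_one I).2 ?_))
      have h1 : !![1, 0; 0, 0] ∈ I := by
        convert I.sub_mem hl (I.mul_mem_left !![l, 0; 0, 0] h') using 1
        ext i j; fin_cases i <;> fin_cases j <;> simp
      rw [Matrix.one_fin_two]
      exact mem_of_rows h1 h'
    · refine Or.inr (Or.inr (Or.inr ⟨l, le_antisymm (fun M hM => ?_) (rowIdeal_le_iff.2 hl)⟩))
      have key : ∀ a b, !![a, b; 0, 0] ∈ I → b = a * l := by
        intro a b hab
        by_contra hne
        apply h'
        have hne' : b - a * l ≠ 0 := sub_ne_zero.2 hne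
        have h1 := I.sub_mem hab (I.mul_mem_left !![a, 0; 0, 0] hl)
        simpa [hne'] using row_mem_of_mem h1 (b - a * l)⁻¹ 0
      rw [mem_rowIdeal]
      refine ⟨M 0 0, M 1 0, ?_⟩
      rw [Matrix.eta_fin_two M, ← key _ _ (by simpa using row_mem_of_mem hM 1 0),
        ← key _ _ (by simpa using row_mem_of_mem hM 0 1)]
      simp
  · have key : ∀ a b, !![a, b; 0, 0] ∈ I → a = 0 := by
      intro a b hab
      by_contra ha
      exact h ⟨a⁻¹ * b, by simpa [ha] using row_mem_of_mem hab a⁻¹ 0⟩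
    have hle : I ≤ rowIdeal 0 1 := fun M hM => by
      rw [mem_rowIdeal]
      refine ⟨M 0 1, M 1 1, ?_⟩
      rw [Matrix.eta_fin_two M, key (M 0 0) (M 0 1) (by simpa using row_mem_of_mem hM 1 0),
        key (M 1 0) (M 1 1) (by simpa using row_mem_of_mem hM 0 1)]
      simp
    obtain h | h := eq_bot_or_eq_of_le_rowIdeal hle
    · exact Or.inl h
    · exact Or.inr (Or.inr (Or.inl h))

variable {E' : Type*} [Field E'] (θ : E →+* E')

lemma exists_eq_mul_of_dot_eq_zero {c d x y : E'} (h : c ≠ 0 ∨ d ≠ 0) (hxy : x * c + y * d = 0) :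
    ∃ a, x = a * d ∧ y = a * -c := by
  by_cases hd : d = 0
  · have hc : c ≠ 0 := by simpa [hd] using h
    have hx : x = 0 := by simpa [hd, hc] using hxy
    exact ⟨-y * c⁻¹, by simp [hd, hx], by field_simp⟩
  · refine ⟨x * d⁻¹, by field_simp, ?_⟩
    field_simp
    linear_combination hxy

/-- The condition says that all rows of `R` are orthogonal to the column `(c, d)` obtained by
applying `B` to `θ(x, y)`. It is nonzero as `B` is invertible, so its orthogonal is the line through
`(d, -c)`, whose ideal is minimal. -/
lemma orthogonal_rowIdeal_iff {R : Ideal (Mat E')} {B : Mat E'} (hB : B.det ≠ 0) {x y : E}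
    (hxy : x ≠ 0 ∨ y ≠ 0) :
    (∀ M ∈ rowIdeal x y, ∀ N ∈ R, N * B * (M.map θ)ᵀ = 0) ↔
      R = ⊥ ∨ R = rowIdeal (B 1 0 * θ x + B 1 1 * θ y) (-(B 0 0 * θ x + B 0 1 * θ y)) := by
  set c := B 0 0 * θ x + B 0 1 * θ y with hc
  set d := B 1 0 * θ x + B 1 1 * θ y with hd
  have hcd : c ≠ 0 ∨ d ≠ 0 := by
    by_contra! h
    rw [Matrix.det_fin_two] at hB
    have hx : (B 0 0 * B 1 1 - B 0 1 * B 1 0) * θ x = 0 := by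
      linear_combination B 1 1 * (hc.symm.trans h.1) - B 0 1 * (hd.symm.trans h.2)
    have hy : (B 0 0 * B 1 1 - B 0 1 * B 1 0) * θ y = 0 := by
      linear_combination B 0 0 * (hd.symm.trans h.2) - B 1 0 * (hc.symm.trans h.1)
    have hx' := (mul_eq_zero.1 hx).resolve_left hB
    have hy' := (mul_eq_zero.1 hy).resolve_left hB
    rw [map_eq_zero] at hx' hy'
    tauto
  have hmul : ∀ (N : Mat E') (a b : E), N * B * ((!![a * x, a * y; b * x, b * y] : Mat E).map θ)ᵀ =
      !![(N 0 0 * c + N 0 1 * d) * θ a, (N 0 0 * c + N 0 1 * d) * θ b;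
        (N 1 0 * c + N 1 1 * d) * θ a, (N 1 0 * c + N 1 1 * d) * θ b] := by
    intro N a b
    ext i j
    fin_cases i <;> fin_cases j <;>
      simp [Matrix.mul_apply, Fin.sum_univ_two, hc, hd] <;> ring
  constructor
  · intro h
    apply eq_bot_or_eq_of_le_rowIdeal
    intro N hN
    have h1 := h _ (mem_rowIdeal.2 ⟨1, 0, rfl⟩) N hN
    rw [hmul] at h1
    have h00 := congrFun (congrFun h1 0) 0
    have h10 := congrFun (congrFun h1 1) 0
    simp only [map_one, mul_one] at h00 h10
    obtain ⟨a, ha0, ha1⟩ := exists_eq_mul_of_dot_eq_zero hcd h00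
    obtain ⟨b, hb0, hb1⟩ := exists_eq_mul_of_dot_eq_zero hcd h10
    rw [mem_rowIdeal]
    refine ⟨a, b, ?_⟩
    rw [Matrix.eta_fin_two N, ha0, ha1, hb0, hb1]
  · rintro (rfl | rfl) M hM N hN
    · rw [(Submodule.mem_bot _).1 hN, zero_mul, zero_mul]
    · obtain ⟨a, b, rfl⟩ := mem_rowIdeal.1 hM
      obtain ⟨a', b', rfl⟩ := mem_rowIdeal.1 hN
      rw [hmul]
      ext i j
      fin_cases i <;> fin_cases j <;> simp <;> left <;> ring

/-- If `L` is everything, `M = 1` and the invertibility of `B` give `R = ⊥`; if `L` comes from a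
line, `R` is zero or belongs to the orthogonal line. -/
lemma orthogonal_iff {L : Ideal (Mat E)} {R : Ideal (Mat E')} {B : Mat E'} (hB : B.det ≠ 0) :
    (∀ M ∈ L, ∀ N ∈ R, N * B * (M.map θ)ᵀ = 0) ↔ L = ⊥ ∨ R = ⊥ ∨
      (L = rowIdeal 0 1 ∧ R = rowIdeal (B 1 1) (-B 0 1)) ∨
      ∃ l, L = rowIdeal 1 l ∧
        R = rowIdeal (B 1 0 + B 1 1 * θ l) (-(B 0 0 + B 0 1 * θ l)) := by
  have h01 := orthogonal_rowIdeal_iff θ (R := R) hB (x := 0) (y := 1) (Or.inr one_ne_zero)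
  have h1l := fun l => orthogonal_rowIdeal_iff θ (R := R) hB (x := 1) (y := l) (Or.inl one_ne_zero)
  simp only [map_zero, map_one, mul_zero, mul_one, zero_add] at h01 h1l
  constructor
  · intro h
    obtain hL | hL | hL | ⟨l, hL⟩ := left_ideal_cases L
    · exact Or.inl hL
    · refine Or.inr (Or.inl ((Submodule.eq_bot_iff _).2 fun N hN => ?_))
      have h1 := h 1 (hL ▸ Submodule.mem_top) N hN
      rw [Matrix.map_one _ (map_zero θ) (map_one θ), Matrix.transpose_one, mul_one] at h1
      have hu : IsUnit B := (Matrix.isUnit_iff_isUnit_det B).2 (isUnit_iff_ne_zero.2 hB)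
      exact hu.mul_left_eq_zero.1 h1
    · rw [hL, h01] at h
      tauto
    · rw [hL, h1l] at h
      obtain h | h := h
      · exact Or.inr (Or.inl h)
      · exact Or.inr (Or.inr (Or.inr ⟨l, hL, h⟩))
  · rintro (hL | hR | ⟨hL, hR⟩ | ⟨l, hL, hR⟩)
    · rintro M hM N -
      rw [hL] at hM
      rw [(Submodule.mem_bot _).1 hM, Matrix.map_zero _ (map_zero θ), Matrix.transpose_zero, mul_zero]
    · rintro M - N hN
      rw [hR] at hN
      rw [(Submodule.mem_bot _).1 hN, zero_mul, zero_mul]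
    · rw [hL]
      exact h01.2 (Or.inr hR)
    · rw [hL]
      exact (h1l l).2 (Or.inr hR)

lemma det_swapMat (R : Type*) [CommRing R] : (swapMat R).det = -1 := by
  simp [Matrix.det_fin_two]

lemma orthogonal_swapMat_iff {L : Ideal (Mat E)} {R : Ideal (Mat E')} :
    (∀ M ∈ L, ∀ N ∈ R, N * swapMat E' * (M.map θ)ᵀ = 0) ↔ L = ⊥ ∨ R = ⊥ ∨
      (L = rowIdeal 0 1 ∧ R = rowIdeal 0 1) ∨
      ∃ l, L = rowIdeal 1 l ∧ R = rowIdeal 1 (-θ l) := by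
  rw [orthogonal_iff θ (by rw [det_swapMat]; exact neg_ne_zero.2 one_ne_zero)]
  have : rowIdeal (0 : E') (-1) = rowIdeal 0 1 := by
    simpa using rowIdeal_smul (neg_ne_zero.2 one_ne_zero : (-1 : E') ≠ 0) 0 1
  simp [this]

/-- The line through `(0, 1)` is its own orthogonal, while that of `(1, l)` is the line through `(1,
-θ l)`; the two agree exactly when `l = -θ l`. -/
lemma self_orthogonal_swapMat_iff (θ : E →+* E) {I : Ideal (Mat E)} :
    (∀ M ∈ I, ∀ N ∈ I, N * swapMat E * (M.map θ)ᵀ = 0) ↔ I = ⊥ ∨ I = rowIdeal 0 1 ∨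
      ∃ l, l = -θ l ∧ I = rowIdeal 1 l := by
  rw [orthogonal_swapMat_iff]
  constructor
  · rintro (h | h | ⟨h, -⟩ | ⟨l, h, h'⟩)
    · exact Or.inl h
    · exact Or.inl h
    · exact Or.inr (Or.inl h)
    · refine Or.inr (Or.inr ⟨l, ?_, h⟩)
      have := mul_eq_mul_of_rowIdeal_eq (h.symm.trans h')
      simpa using this.symm
  · rintro (h | h | ⟨l, hl, h⟩)
    · exact Or.inl h
    · exact Or.inr (Or.inr (Or.inl ⟨h, h⟩))
    · exact Or.inr (Or.inr (Or.inr ⟨l, h, hl ▸ h⟩))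

/-- The orthogonal of `(0, 1)` is a different line, and that of `(1, l)` is the line through `(θ l,
-1)`. They coincide exactly when `l * θ l = -1`, which also excludes `l = 0`. -/
lemma self_orthogonal_one_iff (θ : E →+* E) {I : Ideal (Mat E)} :
    (∀ M ∈ I, ∀ N ∈ I, N * (M.map θ)ᵀ = 0) ↔ I = ⊥ ∨
      ∃ l, l ≠ 0 ∧ l = -(θ l)⁻¹ ∧ I = rowIdeal 1 l := by
  have := orthogonal_iff θ (L := I) (R := I) (B := 1) (by simp)
  simp only [mul_one] at this
  rw [this]
  simp only [Matrix.one_apply_eq, ne_eq, one_ne_zero, not_false_eq_true, Matrix.one_apply_ne,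
    zero_ne_one, zero_add, neg_zero, one_mul, zero_mul, add_zero]
  constructor
  · rintro (h | h | ⟨h, h'⟩ | ⟨l, h, h'⟩)
    · exact Or.inl h
    · exact Or.inl h
    · have := mul_eq_mul_of_rowIdeal_eq (h.symm.trans h')
      simp at this
    · have := mul_eq_mul_of_rowIdeal_eq (h.symm.trans h')
      have hl : l ≠ 0 := by rintro rfl; simp at this
      refine Or.inr ⟨l, hl, ?_, h⟩
      have hθ : θ l ≠ 0 := (_root_.map_ne_zero θ).2 hl
      field_simp
      linear_combination -this
  · rintro (h | ⟨l, hl0, hl, h⟩)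
    · exact Or.inl h
    · refine Or.inr (Or.inr (Or.inr ⟨l, h, ?_⟩))
      have hθ : θ l ≠ 0 := (_root_.map_ne_zero θ).2 hl0
      rw [h, ← rowIdeal_smul hθ 1 l]
      congr 1
      · rw [mul_one]
      · nth_rewrite 2 [hl]
        field_simp

end RowIdeal

/-! ### Row ideals over an intermediate field -/

section GeneratedByRow

variable {F K : Type*} [Field F] [Field K] [Algebra F K] {E : IntermediateField F K}

lemma generatedByRow_iff {I : Ideal (Mat E)} {x y : K} (x' y' : E) (hx : (x' : K) = x)
    (hy : (y' : K) = y) : GeneratedByRow I x y ↔ I = rowIdeal x' y' := by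
  subst hx hy
  have hlift : liftMat (!![x', y'; 0, 0] : Mat E) = !![(x' : K), (y' : K); 0, 0] := by
    ext i j; fin_cases i <;> fin_cases j <;> simp
  constructor
  · rintro ⟨M, hM, rfl⟩
    have : M = !![x', y'; 0, 0] :=
      Matrix.map_injective (algebraMap E K).injective (hM.trans hlift.symm)
    rw [this, rowIdeal]
  · rintro rfl
    exact ⟨_, hlift, rfl⟩

end GeneratedByRow

end DihedralCode

namespace DihedralCode

/-! ### Consequences of the type of a factor for its roots -/

section ClassFacts

variable {F : Type*} [Field F] [Fintype F] {K : Type*} [Field K] [Algebra F K] {q : ℕ}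
  {g : F[X]} {x : K}

lemma aeval_pow_of_eq_conjPoly (hq : Fintype.card F = q ^ 2) (h : g = conjPoly q g)
    (hx : aeval x g = 0) : aeval (x ^ q) g = 0 := by
  rw [h, aeval_conjPoly hq, hx, zero_pow (ne_zero_of_card_eq_sq hq)]

omit [Fintype F] in
lemma aeval_inv_of_eq_recipPoly (hg : g.Monic) (hgi : Irreducible g) (hx0 : x ≠ 0)
    (hx : aeval x g = 0) (h : g = recipPoly g) : aeval x⁻¹ g = 0 := by
  rw [← aeval_recipPoly (coeff_zero_ne_zero_of_root hgi hg hx0 hx) hx0, ← h, hx]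

/-- Invariance under conjugation makes the degree odd; invariance under reciprocation then makes `x`
its own inverse. -/
lemma IsJ0.root (hq : Fintype.card F = q ^ 2) (hg : g.Monic) (hgi : Irreducible g) (hx0 : x ≠ 0)
    (hx : aeval x g = 0) (h : IsJ0 q g) : x = 1 ∧ g = X - 1 ∨ x = -1 ∧ g = X + 1 := by
  have h1 := root_zpow_eq hq hg hgi hx (e := q) (by norm_cast; ring)
    (by rw [zpow_natCast]; exact aeval_pow_of_eq_conjPoly hq h.1 hx)
  exact eq_X_sub_one_or hg hgi hx hx0
    (inv_eq_self_of_odd hg hgi h1.1 hx (aeval_inv_of_eq_recipPoly hg hgi hx0 hx h.2))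

lemma IsJ0.inv_root (hq : Fintype.card F = q ^ 2) (hg : g.Monic) (hgi : Irreducible g)
    (hx0 : x ≠ 0) (hx : aeval x g = 0) (h : IsJ0 q g) : x⁻¹ = x := by
  obtain ⟨rfl, -⟩ | ⟨rfl, -⟩ := h.root hq hg hgi hx0 hx <;> simp [inv_neg]

omit [Fintype F] in
-- Names the root `±1` inside `F` without a case distinction, as needed to define the image of the
-- rotation.
lemma algebraMap_neg_coeff_zero (h : x = 1 ∧ g = X - 1 ∨ x = -1 ∧ g = X + 1) :
    algebraMap F K (-g.coeff 0) = x := by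
  obtain ⟨rfl, rfl⟩ | ⟨rfl, rfl⟩ := h <;> simp

omit [Fintype F] in
lemma neg_one_eq_one_of_ringChar (h : ringChar F = 2) : (-1 : K) = 1 := by
  have : CharP F 2 := ringChar.of_eq h
  have h2 : CharP K 2 := charP_of_injective_algebraMap' F 2
  exact CharTwo.neg_eq 1

lemma IsJ0.root_eq_one (hq : Fintype.card F = q ^ 2) (hg : g.Monic) (hgi : Irreducible g)
    (hx0 : x ≠ 0) (hx : aeval x g = 0) (h : IsJ0 q g) (h2 : ringChar F = 2) : x = 1 := by
  obtain ⟨hx1, -⟩ | ⟨hx1, -⟩ := h.root hq hg hgi hx0 hx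
  · exact hx1
  · rw [hx1, neg_one_eq_one_of_ringChar h2]

lemma IsJ0.pow_root (hq : Fintype.card F = q ^ 2) (hg : g.Monic) (hgi : Irreducible g)
    (hx0 : x ≠ 0) (hx : aeval x g = 0) (h : IsJ0 q g) : x ^ q = x := by
  obtain ⟨rfl, -⟩ | ⟨rfl, -⟩ := h.root hq hg hgi hx0 hx
  · simp
  · rw [← powHom_apply F K hq, map_neg, map_one]

/-- A self-inverse root would make `g` equal to `X - 1` or `X + 1`, and both are fixed by
conjugation. -/
lemma IsJ1.inv_root_ne (hq : Fintype.card F = q ^ 2) (hg : g.Monic) (hgi : Irreducible g)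
    (hx0 : x ≠ 0) (hx : aeval x g = 0) (h : IsJ1 q g) : x⁻¹ ≠ x := by
  intro hinv
  apply h.2
  rw [conjPoly_eq_map hq]
  obtain ⟨-, rfl⟩ | ⟨-, rfl⟩ := eq_X_sub_one_or hg hgi hx hx0 hinv <;> simp

omit [Algebra F K] in
variable (F) in
lemma inv_pow_q_ne (hq : Fintype.card F = q ^ 2) [Algebra F K] (h : x⁻¹ ≠ x) :
    (x ^ q)⁻¹ ≠ x ^ q := by
  rw [← inv_pow, ← powHom_apply F K hq, ← powHom_apply F K hq]
  exact fun h' => h ((powHom F K hq).injective h')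

lemma IsJ2.root_pow (hq : Fintype.card F = q ^ 2) (hg : g.Monic) (hgi : Irreducible g)
    (hx : aeval x g = 0) (h : IsJ2 q g) :
    Odd g.natDegree ∧ x ^ q = x ^ q ^ (g.natDegree + 1) := by
  have h1 := root_zpow_eq hq hg hgi hx (e := q) (by norm_cast; ring)
    (by rw [zpow_natCast]; exact aeval_pow_of_eq_conjPoly hq h.1 hx)
  rwa [zpow_natCast] at h1

lemma IsJ3.root_pow (hq : Fintype.card F = q ^ 2) (hg : g.Monic) (hgi : Irreducible g)
    (hx0 : x ≠ 0) (hx : aeval x g = 0) (h : IsJ3 q g) :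
    Odd g.natDegree ∧ (x ^ q)⁻¹ = x ^ q ^ (g.natDegree + 1) := by
  have hroot : aeval (x ^ q)⁻¹ g = 0 := by
    rw [← aeval_recipPoly (coeff_zero_ne_zero_of_root hgi hg hx0 hx) (pow_ne_zero q hx0), ← h.1,
      aeval_conjPoly hq, hx, zero_pow (ne_zero_of_card_eq_sq hq)]
  have h1 := root_zpow_eq hq hg hgi hx (e := -q) (by simp; ring)
    (by rw [zpow_neg, zpow_natCast]; exact hroot)
  rwa [zpow_neg, zpow_natCast] at h1

end ClassFacts

/-! ### Matrices over the real subfield -/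

section Sigma

variable {F K : Type*} [Field F] [Field K] [Algebra F K] {β : K}

lemma det_zmat (β : K) : (zmat β).det = β - β⁻¹ := by
  rw [Matrix.det_fin_two]; simp; ring

lemma isUnit_det_zmat (h : β⁻¹ ≠ β) : IsUnit (zmat β).det := by
  rw [det_zmat, isUnit_iff_ne_zero, sub_ne_zero]
  exact h.symm

variable (F) in
/-- The map `sigma` as a homomorphism of algebras. -/
noncomputable def sigmaHom (h : β⁻¹ ≠ β) : Mat K →ₐ[F] Mat K :=
  AlgHom.ofLinearMap
    { toFun := sigma β
      map_add' := fun A B => by simp [sigma, mul_add, add_mul]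
      map_smul' := fun c A => by simp [sigma] }
    (by simp [sigma, Matrix.nonsing_inv_mul _ (isUnit_det_zmat h)])
    (fun A B => by
      show (zmat β)⁻¹ * (A * B) * zmat β =
        ((zmat β)⁻¹ * A * zmat β) * ((zmat β)⁻¹ * B * zmat β)
      have := Matrix.mul_nonsing_inv _ (isUnit_det_zmat h)
      calc (zmat β)⁻¹ * (A * B) * zmat β = (zmat β)⁻¹ * A * 1 * B * zmat β := by
            simp only [mul_assoc, one_mul]
        _ = _ := by rw [← this]; simp only [mul_assoc])

lemma sigmaHom_apply (h : β⁻¹ ≠ β) (M : Mat K) : sigmaHom F h M = sigma β M := rfl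

lemma sigma_eq_of_mul_eq (h : β⁻¹ ≠ β) {M N : Mat K} (hMN : M * zmat β = zmat β * N) :
    sigma β M = N := by
  rw [sigma, mul_assoc, hMN, ← mul_assoc, Matrix.nonsing_inv_mul _ (isUnit_det_zmat h), one_mul]

lemma zmat_mul_sigma (h : β⁻¹ ≠ β) (M : Mat K) :
    zmat β * sigma β M * (zmat β)⁻¹ = M := by
  rw [sigma]
  have := Matrix.mul_nonsing_inv _ (isUnit_det_zmat h)
  calc _ = (zmat β * (zmat β)⁻¹) * M * (zmat β * (zmat β)⁻¹) := by simp only [mul_assoc]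
    _ = M := by rw [this, one_mul, mul_one]

/-- Conjugation by `zmat β` gives the rotation its companion form, so its entries, like those of the
reflection below, lie in the subfield generated by the trace `β + β⁻¹`. -/
lemma sigma_rot (h0 : β ≠ 0) (h : β⁻¹ ≠ β) : sigma β (rot β) = !![0, 1; -1, β + β⁻¹] := by
  apply sigma_eq_of_mul_eq h
  ext i j
  fin_cases i <;> fin_cases j <;> simp <;> field_simp <;> ring

lemma sigma_swapMat (h : β⁻¹ ≠ β) :
    sigma β (swapMat K) = !![1, -(β + β⁻¹); 0, -1] := by
  apply sigma_eq_of_mul_eq h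
  ext i j
  fin_cases i <;> fin_cases j <;> simp

end Sigma

/-! ### The isomorphism -/

section Rho

variable {F K J : Type*} [Field F] [Field K] [Algebra F K] {q : ℕ} {f : J → F[X]} {α : J → K}

/-- The diagonal matrix `diag (x, x⁻¹)` over `F(x)`. -/
abbrev rotGen (F : Type*) [Field F] [Algebra F K] (x : K) : Mat F⟮x⟯ :=
  !![IntermediateField.AdjoinSimple.gen F x, 0; 0, (IntermediateField.AdjoinSimple.gen F x)⁻¹]

/-- The image of the rotation in `M₂(F(s))`, where `s` is the trace of the rotation. -/
abbrev companionR (F : Type*) [Field F] [Algebra F K] (s : K) : Mat F⟮s⟯ :=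
  !![0, 1; -1, IntermediateField.AdjoinSimple.gen F s]

/-- The image of the reflection in `M₂(F(s))`, where `s` is the trace of the rotation. -/
abbrev companionS (F : Type*) [Field F] [Algebra F K] (s : K) : Mat F⟮s⟯ :=
  !![1, -IntermediateField.AdjoinSimple.gen F s; 0, -1]

lemma liftMat_rotGen (x : K) : liftMat (rotGen F x) = rot x := by
  ext i j; fin_cases i <;> fin_cases j <;> simp

lemma liftMat_swapMat (E : IntermediateField F K) : liftMat (swapMat E) = swapMat K := by
  ext i j; fin_cases i <;> fin_cases j <;> simp

lemma liftMat_companionR {x : K} (h0 : x ≠ 0) (h : x⁻¹ ≠ x) :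
    liftMat (companionR F (x + x⁻¹)) = sigma x (rot x) := by
  rw [sigma_rot h0 h]
  ext i j; fin_cases i <;> fin_cases j <;> simp

lemma liftMat_companionS {x : K} (h : x⁻¹ ≠ x) :
    liftMat (companionS F (x + x⁻¹)) = sigma x (swapMat K) := by
  rw [sigma_swapMat h]
  ext i j; fin_cases i <;> fin_cases j <;> simp

/-- The inclusion `M₂(E) ⊆ M₂(K)` as a homomorphism of algebras. -/
abbrev liftHom (E : IntermediateField F K) : Mat E →ₐ[F] Mat K := E.val.mapMatrix

lemma liftHom_apply {E : IntermediateField F K} (M : Mat E) : liftHom E M = liftMat M := rfl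

lemma liftHom_injective (E : IntermediateField F K) : Function.Injective (liftHom E) :=
  Matrix.map_injective E.val.injective

/-- `u` and `v` satisfy the relations of the dihedral group. -/
structure DihedralRelations {M : Type*} [Monoid M] (n : ℕ) (u v : M) : Prop where
  pow : u ^ n = 1
  mul_self : v * v = 1
  conj : u * v * u = v

lemma DihedralRelations.map {M N : Type*} [Monoid M] [Monoid N] {n : ℕ} {u v : M}
    (h : DihedralRelations n u v) (φ : M →* N) : DihedralRelations n (φ u) (φ v) where
  pow := by rw [← map_pow, h.pow, map_one]
  mul_self := by rw [← map_mul, h.mul_self, map_one]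
  conj := by rw [← map_mul, ← map_mul, h.conj]

/-- Allows the relations over `F(α)` and `F(α + α⁻¹)` to be checked for the diagonal form over `K`.
-/
lemma DihedralRelations.of_injective {M N : Type*} [Monoid M] [Monoid N] {n : ℕ} {u v : M}
    {φ : M →* N} (hφ : Function.Injective φ) (h : DihedralRelations n (φ u) (φ v)) :
    DihedralRelations n u v where
  pow := hφ (by rw [map_pow, h.pow, map_one])
  mul_self := hφ (by rw [map_mul, h.mul_self, map_one])
  conj := hφ (by rw [map_mul, map_mul, h.conj])

lemma DihedralRelations.prodMk {M N : Type*} [Monoid M] [Monoid N] {n : ℕ} {u v : M} {u' v' : N}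
    (h : DihedralRelations n u v) (h' : DihedralRelations n u' v') :
    DihedralRelations n (u, u') (v, v') where
  pow := Prod.ext h.pow h'.pow
  mul_self := Prod.ext h.mul_self h'.mul_self
  conj := Prod.ext h.conj h'.conj

lemma DihedralRelations.piMk {ι : Type*} {M : ι → Type*} [∀ i, Monoid (M i)] {n : ℕ}
    {u v : ∀ i, M i} (h : ∀ i, DihedralRelations n (u i) (v i)) : DihedralRelations n u v where
  pow := funext fun i => (h i).pow
  mul_self := funext fun i => (h i).mul_self
  conj := funext fun i => (h i).conj

lemma dihedralRelations_rot {n : ℕ} [NeZero n] {x : K} (hx : x ^ n = 1) :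
    DihedralRelations n (rot x) (swapMat K) :=
  ⟨rot_pow_eq_one hx, swapMat_mul_self K, rot_mul_swapMat_mul_rot (ne_zero_of_pow_eq_one hx)⟩

lemma dihedralRelations_rotGen {n : ℕ} [NeZero n] {x : K} (hx : x ^ n = 1) :
    DihedralRelations n (rotGen F x) (swapMat F⟮x⟯) := by
  refine .of_injective (φ := (liftHom F⟮x⟯ : Mat F⟮x⟯ →* Mat K)) (liftHom_injective _) ?_
  show DihedralRelations n (liftMat _) (liftMat _)
  rw [liftMat_rotGen, liftMat_swapMat]
  exact dihedralRelations_rot hx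

lemma dihedralRelations_companion {n : ℕ} [NeZero n] {x : K} (hx : x ^ n = 1) (h : x⁻¹ ≠ x) :
    DihedralRelations n (companionR F (x + x⁻¹)) (companionS F (x + x⁻¹)) := by
  refine .of_injective (φ := (liftHom F⟮x + x⁻¹⟯ : Mat F⟮x + x⁻¹⟯ →* Mat K))
    (liftHom_injective _) ?_
  show DihedralRelations n (liftMat _) (liftMat _)
  rw [liftMat_companionR (ne_zero_of_pow_eq_one hx) h, liftMat_companionS h]
  exact (dihedralRelations_rot hx).map (sigmaHom F h : Mat K →* Mat K)

lemma dihedralRelations_sign {n : ℕ} {ε : F} (hε : ε ^ n = 1) (hε2 : ε * ε = 1) :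
    DihedralRelations n ((ε, ε) : F × F) (1, -1) where
  pow := Prod.ext hε hε
  mul_self := by ext <;> simp
  conj := by ext <;> simp [hε2]

variable (F) in
/-- The generator of `GroupAlgC2 F`. -/
def swapC2 : GroupAlgC2 F := ⟨swapMat F, Algebra.subset_adjoin rfl⟩

lemma dihedralRelations_C2 (n : ℕ) : DihedralRelations n (1 : GroupAlgC2 F) (swapC2 F) where
  pow := one_pow n
  mul_self := Subtype.ext (swapMat_mul_self F)
  conj := by rw [one_mul, mul_one]

variable (q f α) in
/-- The image of the rotation in the decomposition. -/
noncomputable def imageR : DecompAlg q f α :=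
  (fun j => (-(f j.1).coeff 0, -(f j.1).coeff 0), fun _ => 1,
    fun j => (companionR F (α j.1 + (α j.1)⁻¹), companionR F (α j.1 ^ q + (α j.1 ^ q)⁻¹)),
    fun j => rotGen F (α j.1), fun j => rotGen F (α j.1),
    fun j => (rotGen F (α j.1), rotGen F (α j.1 ^ q)))

variable (q f α) in
/-- The image of the reflection in the decomposition. -/
noncomputable def imageS : DecompAlg q f α :=
  (fun _ => (1, -1), fun _ => swapC2 F,
    fun j => (companionS F (α j.1 + (α j.1)⁻¹), companionS F (α j.1 ^ q + (α j.1 ^ q)⁻¹)),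
    fun _ => swapMat _, fun _ => swapMat _, fun _ => (swapMat _, swapMat _))

lemma dihedralRelations_image [Fintype F] [Fintype J] {n : ℕ} [NeZero n]
    (hq : Fintype.card F = q ^ 2) (hf : IsFactorisation q n f)
    (hα : ∀ j, aeval (α j) (f j) = 0) :
    DihedralRelations n (imageR q f α) (imageS q f α) := by
  have hα1 := hf.pow_eq_one hα
  have hα0 : ∀ j, α j ≠ 0 := fun j => ne_zero_of_pow_eq_one (hα1 j)
  refine .prodMk (.piMk fun j => ?_) (.prodMk (.piMk fun j => ?_) (.prodMk (.piMk fun j => ?_)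
    (.prodMk (.piMk fun j => ?_) (.prodMk (.piMk fun j => ?_) (.piMk fun j => ?_)))))
  · have h := j.2.1.root hq (hf.monic j) (hf.irreducible j) (hα0 j) (hα j)
    have he := algebraMap_neg_coeff_zero h
    refine dihedralRelations_sign ?_ ?_
    · apply (algebraMap F K).injective
      rw [map_pow, he, hα1, map_one]
    · apply (algebraMap F K).injective
      rw [map_mul, he, map_one]
      obtain ⟨h, -⟩ | ⟨h, -⟩ := h <;> simp [h]
  · exact dihedralRelations_C2 n
  · have h := j.2.inv_root_ne hq (hf.monic j) (hf.irreducible j) (hα0 j) (hα j)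
    exact (dihedralRelations_companion (hα1 j) h).prodMk
      (dihedralRelations_companion (hf.pow_q_pow_eq_one hα j) (inv_pow_q_ne F hq h))
  · exact dihedralRelations_rotGen (hα1 j)
  · exact dihedralRelations_rotGen (hα1 j)
  · exact (dihedralRelations_rotGen (hα1 j)).prodMk
      (dihedralRelations_rotGen (hf.pow_q_pow_eq_one hα j))

/-- The homomorphism from the group algebra to its decomposition. -/
noncomputable def rho [Fintype F] [Fintype J] {n : ℕ} [NeZero n]
    (hq : Fintype.card F = q ^ 2) (hf : IsFactorisation q n f)
    (hα : ∀ j, aeval (α j) (f j) = 0) :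
    MonoidAlgebra F (DihedralGroup n) →ₐ[F] DecompAlg q f α :=
  dihedralLift F (imageR q f α) (imageS q f α) (dihedralRelations_image hq hf hα).pow
    (dihedralRelations_image hq hf hα).mul_self (dihedralRelations_image hq hf hα).conj

end Rho

end DihedralCode

namespace DihedralCode

/-! ### The components of `rho` and the representations they describe -/

section Components

variable {F K J : Type*} [Field F] [Fintype F] [Field K] [Algebra F K] [Fintype J] {q n : ℕ}
  [NeZero n] {f : J → F[X]} {α : J → K}

/-- The isomorphism of `F × F` with the algebra of matrices `!![x, y; y, x]`. -/
noncomputable def circulantHom (h2 : (2 : K) ≠ 0) : F × F →ₐ[F] Mat K :=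
  AlgHom.ofLinearMap
    -- A circulant `!![x, y; y, x]` has eigenvalues `x + y` and `x - y`; these are to be the two
    -- coordinates of `p`.
    { toFun := fun p => !![(algebraMap F K p.1 + algebraMap F K p.2) / 2,
        (algebraMap F K p.1 - algebraMap F K p.2) / 2;
        (algebraMap F K p.1 - algebraMap F K p.2) / 2,
        (algebraMap F K p.1 + algebraMap F K p.2) / 2]
      map_add' := fun p p' => by
        ext i j; fin_cases i <;> fin_cases j <;> simp <;> ring
      map_smul' := fun c p => by
        ext i j; fin_cases i <;> fin_cases j <;> simp [Algebra.smul_def] <;> ring }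
    (by ext i j; fin_cases i <;> fin_cases j <;> simp; all_goals field_simp; norm_num)
    (fun p p' => by
      ext i j
      fin_cases i <;> fin_cases j <;> simp [Matrix.mul_apply, Fin.sum_univ_two] <;>
        field_simp <;> ring)

omit [Fintype F] in
lemma circulantHom_apply (h2 : (2 : K) ≠ 0) (p : F × F) :
    circulantHom h2 p = !![(algebraMap F K p.1 + algebraMap F K p.2) / 2,
        (algebraMap F K p.1 - algebraMap F K p.2) / 2;
        (algebraMap F K p.1 - algebraMap F K p.2) / 2,
        (algebraMap F K p.1 + algebraMap F K p.2) / 2] := rfl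

omit [Fintype F] in
lemma circulantHom_injective (h2 : (2 : K) ≠ 0) :
    Function.Injective (circulantHom h2 : F × F →ₐ[F] Mat K) := by
  refine (injective_iff_map_eq_zero _).2 fun p hp => ?_
  rw [circulantHom_apply] at hp
  have h0 := congrFun (congrFun hp 0) 0
  have h1 := congrFun (congrFun hp 0) 1
  simp [h2] at h0 h1
  have hp1 : algebraMap F K p.1 = 0 := by
    have : 2 * algebraMap F K p.1 = 0 := by linear_combination h0 + h1
    simpa [h2] using this
  rw [hp1, zero_add] at h0
  rw [map_eq_zero] at h0 hp1
  exact Prod.ext hp1 h0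

variable (hq : Fintype.card F = q ^ 2) (hf : IsFactorisation q n f)
  (hα : ∀ j, aeval (α j) (f j) = 0)

lemma rho_r : rho hq hf hα (MonoidAlgebra.single (.r 1) 1) = imageR q f α := dihedralLift_r ..

lemma rho_sr : rho hq hf hα (MonoidAlgebra.single (.sr 0) 1) = imageS q f α := dihedralLift_sr ..

/-- A homomorphism on the decomposition that sends the images of the generators to `rot x` and
`swapMat K` describes the representation `dihedralRep`. -/
lemma apply_rho_eq_dihedralRep (φ : DecompAlg q f α →ₐ[F] Mat K) {x : K} (hx : x ^ n = 1)
    (hr : φ (imageR q f α) = rot x) (hs : φ (imageS q f α) = swapMat K)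
    (z : MonoidAlgebra F (DihedralGroup n)) :
    φ (rho hq hf hα z) = dihedralRep F x hx z := by
  have : φ.comp (rho hq hf hα) = dihedralRep F x hx := by
    apply dihedral_algHom_ext
    · rw [AlgHom.comp_apply, rho_r, hr, dihedralRep, dihedralLift_r]
    · rw [AlgHom.comp_apply, rho_sr, hs, dihedralRep, dihedralLift_sr]
  exact congrFun (congrArg DFunLike.coe this) z

lemma apply_rho_eq_sigma (φ : DecompAlg q f α →ₐ[F] Mat K) {x : K} (hx : x ^ n = 1)
    (hne : x⁻¹ ≠ x) (hr : φ (imageR q f α) = sigma x (rot x))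
    (hs : φ (imageS q f α) = sigma x (swapMat K))
    (z : MonoidAlgebra F (DihedralGroup n)) :
    φ (rho hq hf hα z) = sigma x (dihedralRep F x hx z) := by
  have : φ.comp (rho hq hf hα) = (sigmaHom F hne).comp (dihedralRep F x hx) := by
    apply dihedral_algHom_ext
    · rw [AlgHom.comp_apply, rho_r, hr, AlgHom.comp_apply, dihedralRep, dihedralLift_r,
        sigmaHom_apply]
    · rw [AlgHom.comp_apply, rho_sr, hs, AlgHom.comp_apply, dihedralRep, dihedralLift_sr,
        sigmaHom_apply]
  exact congrFun (congrArg DFunLike.coe this) z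

section Projections

variable (F q f α)

/-- The projection to the components of the first kind. -/
def proj0 : DecompAlg q f α →ₐ[F] ∀ _ : {j // IsJ0 q (f j) ∧ ringChar F ≠ 2}, F × F :=
  AlgHom.fst F _ _

/-- The projection to the group algebras of the group with two elements. -/
def proj0two : DecompAlg q f α →ₐ[F] ∀ _ : {j // IsJ0 q (f j) ∧ ringChar F = 2}, GroupAlgC2 F :=
  (AlgHom.fst F _ _).comp (AlgHom.snd F _ _)

/-- The projection to the components of type `J₁`. -/
def proj1 : DecompAlg q f α →ₐ[F] ∀ j : {j // IsJ1 q (f j)},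
    Mat F⟮α j + (α j)⁻¹⟯ × Mat F⟮α j ^ q + (α j ^ q)⁻¹⟯ :=
  (AlgHom.fst F _ _).comp ((AlgHom.snd F _ _).comp (AlgHom.snd F _ _))

/-- The projection to the components of type `J₂`. -/
def proj2 : DecompAlg q f α →ₐ[F] ∀ j : {j // IsJ2 q (f j)}, Mat F⟮α j⟯ :=
  (AlgHom.fst F _ _).comp
    ((AlgHom.snd F _ _).comp ((AlgHom.snd F _ _).comp (AlgHom.snd F _ _)))

/-- The projection to the components of type `J₃`. -/
def proj3 : DecompAlg q f α →ₐ[F] ∀ j : {j // IsJ3 q (f j)}, Mat F⟮α j⟯ :=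
  (AlgHom.fst F _ _).comp ((AlgHom.snd F _ _).comp
    ((AlgHom.snd F _ _).comp ((AlgHom.snd F _ _).comp (AlgHom.snd F _ _))))

/-- The projection to the components of type `J₄`. -/
def proj4 : DecompAlg q f α →ₐ[F] ∀ j : {j // IsJ4 q (f j)}, Mat F⟮α j⟯ × Mat F⟮α j ^ q⟯ :=
  (AlgHom.snd F _ _).comp ((AlgHom.snd F _ _).comp
    ((AlgHom.snd F _ _).comp ((AlgHom.snd F _ _).comp (AlgHom.snd F _ _))))

end Projections

omit [Fintype F] in
include hf hα in
lemma ne_zero_root (j : J) : α j ≠ 0 := ne_zero_of_pow_eq_one (hf.pow_eq_one hα j)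

include hq hf hα

/-- The root is `±1`, so the rotation acts as a scalar and the representation takes circulant
values; `F × F` records their eigenvalues. -/
lemma rho_zero (j : {j // IsJ0 q (f j) ∧ ringChar F ≠ 2}) (h2 : (2 : K) ≠ 0)
    (z : MonoidAlgebra F (DihedralGroup n)) :
    circulantHom h2 ((rho hq hf hα z).1 j) = dihedralRep F (α j) (hf.pow_eq_one hα j) z := by
  refine apply_rho_eq_dihedralRep hq hf hα
    ((circulantHom h2).comp ((Pi.evalAlgHom F _ j).comp (proj0 F q f α))) _ ?_ ?_ z
  · show circulantHom h2 (-(f j.1).coeff 0, -(f j.1).coeff 0) = _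
    have h0 := ne_zero_root hf hα j
    have he := algebraMap_neg_coeff_zero
      (j.2.1.root hq (hf.monic j) (hf.irreducible j) h0 (hα j))
    rw [circulantHom_apply, he]
    have hi := j.2.1.inv_root hq (hf.monic j) (hf.irreducible j) h0 (hα j)
    rw [rot, hi]
    ext i j; fin_cases i <;> fin_cases j <;> simp <;> field_simp <;> ring
  · show circulantHom h2 (1, -1) = _
    rw [circulantHom_apply]
    ext i j; fin_cases i <;> fin_cases j <;> simp; all_goals field_simp; norm_num

lemma rho_zero_two (j : {j // IsJ0 q (f j) ∧ ringChar F = 2})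
    (z : MonoidAlgebra F (DihedralGroup n)) :
    ((rho hq hf hα z).2.1 j : Mat F).map (algebraMap F K) =
      dihedralRep F (α j) (hf.pow_eq_one hα j) z := by
  refine apply_rho_eq_dihedralRep hq hf hα
    ((Algebra.ofId F K).mapMatrix.comp
      ((GroupAlgC2 F).val.comp ((Pi.evalAlgHom F _ j).comp (proj0two F q f α)))) _ ?_ ?_ z
  · show (1 : Mat F).map (algebraMap F K) = _
    have h0 := ne_zero_root hf hα j
    rw [j.2.1.root_eq_one hq (hf.monic j) (hf.irreducible j) h0 (hα j) j.2.2]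
    ext i j; fin_cases i <;> fin_cases j <;> simp
  · show (swapMat F).map (algebraMap F K) = _
    exact map_swapMat _

lemma rho_one_left (j : {j // IsJ1 q (f j)}) (z : MonoidAlgebra F (DihedralGroup n)) :
    liftMat ((rho hq hf hα z).2.2.1 j).1 =
      sigma (α j) (dihedralRep F (α j) (hf.pow_eq_one hα j) z) := by
  have h0 := ne_zero_root hf hα j
  have hne := j.2.inv_root_ne hq (hf.monic j) (hf.irreducible j) h0 (hα j)
  exact apply_rho_eq_sigma hq hf hα
    ((liftHom _).comp ((AlgHom.fst F _ _).comp ((Pi.evalAlgHom F _ j).comp (proj1 F q f α)))) _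
    hne (liftMat_companionR h0 hne) (liftMat_companionS hne) z

lemma rho_one_right (j : {j // IsJ1 q (f j)}) (z : MonoidAlgebra F (DihedralGroup n)) :
    liftMat ((rho hq hf hα z).2.2.1 j).2 =
      sigma (α j ^ q) (dihedralRep F (α j ^ q) (hf.pow_q_pow_eq_one hα j) z) := by
  have h0 := ne_zero_root hf hα j
  have hne := inv_pow_q_ne F hq
    (j.2.inv_root_ne hq (hf.monic j) (hf.irreducible j) h0 (hα j))
  exact apply_rho_eq_sigma hq hf hα
    ((liftHom _).comp ((AlgHom.snd F _ _).comp ((Pi.evalAlgHom F _ j).comp (proj1 F q f α)))) _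
    hne (liftMat_companionR (pow_ne_zero q h0) hne) (liftMat_companionS hne) z

lemma rho_two (j : {j // IsJ2 q (f j)}) (z : MonoidAlgebra F (DihedralGroup n)) :
    liftMat ((rho hq hf hα z).2.2.2.1 j) =
      dihedralRep F (α j) (hf.pow_eq_one hα j) z :=
  apply_rho_eq_dihedralRep hq hf hα
    ((liftHom _).comp ((Pi.evalAlgHom F _ j).comp (proj2 F q f α))) _
    (liftMat_rotGen _) (liftMat_swapMat _) z

lemma rho_three (j : {j // IsJ3 q (f j)}) (z : MonoidAlgebra F (DihedralGroup n)) :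
    liftMat ((rho hq hf hα z).2.2.2.2.1 j) =
      dihedralRep F (α j) (hf.pow_eq_one hα j) z :=
  apply_rho_eq_dihedralRep hq hf hα
    ((liftHom _).comp ((Pi.evalAlgHom F _ j).comp (proj3 F q f α))) _
    (liftMat_rotGen _) (liftMat_swapMat _) z

lemma rho_four_left (j : {j // IsJ4 q (f j)}) (z : MonoidAlgebra F (DihedralGroup n)) :
    liftMat ((rho hq hf hα z).2.2.2.2.2 j).1 =
      dihedralRep F (α j) (hf.pow_eq_one hα j) z :=
  apply_rho_eq_dihedralRep hq hf hα
    ((liftHom _).comp ((AlgHom.fst F _ _).comp ((Pi.evalAlgHom F _ j).comp (proj4 F q f α)))) _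
    (liftMat_rotGen _) (liftMat_swapMat _) z

lemma rho_four_right (j : {j // IsJ4 q (f j)}) (z : MonoidAlgebra F (DihedralGroup n)) :
    liftMat ((rho hq hf hα z).2.2.2.2.2 j).2 =
      dihedralRep F (α j ^ q) (hf.pow_q_pow_eq_one hα j) z :=
  apply_rho_eq_dihedralRep hq hf hα
    ((liftHom _).comp ((AlgHom.snd F _ _).comp ((Pi.evalAlgHom F _ j).comp (proj4 F q f α)))) _
    (liftMat_rotGen _) (liftMat_swapMat _) z

omit [Fintype F] [Fintype J] hq hf hα [NeZero n] in
lemma two_ne_zero_of_ringChar (h : ringChar F ≠ 2) : (2 : K) ≠ 0 := by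
  have : (2 : F) ≠ 0 := Ring.two_ne_zero h
  rw [← map_ofNat (algebraMap F K) 2]
  exact (_root_.map_ne_zero _).2 this

/-- Each component determines the representation at its root: directly, after embedding circulants,
or after undoing `sigma`. These are exactly the representations that the vanishing criterion tests.
-/
lemma rho_injective (hqn : Nat.Coprime q n) : Function.Injective (rho hq hf hα) := by
  refine (injective_iff_map_eq_zero _).2 fun z hz => ?_
  have hsig : ∀ {x : K}, x⁻¹ ≠ x → ∀ M : Mat K, sigma x M = 0 → M = 0 := by
    intro x hne M hM
    rw [← zmat_mul_sigma hne M, hM, mul_zero, zero_mul]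
  have hlift0 : ∀ E : IntermediateField F K, liftMat (0 : Mat E) = 0 := fun E =>
    map_zero (liftHom E)
  refine hf.eq_zero_of_dihedralRep hq hqn hα (fun j => ?_) (fun j hj => ?_)
  · obtain h | h | h | h | h := class_cases q (f j)
    · by_cases h2 : ringChar F = 2
      · rw [← rho_zero_two hq hf hα ⟨j, h, h2⟩, hz]
        exact map_zero ((Algebra.ofId F K).mapMatrix (m := Fin 2))
      · rw [← rho_zero hq hf hα ⟨j, h, h2⟩ (two_ne_zero_of_ringChar h2), hz]
        exact map_zero (circulantHom (two_ne_zero_of_ringChar h2))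
    · have h1 := rho_one_left hq hf hα ⟨j, h⟩ z
      rw [hz] at h1
      exact hsig (h.inv_root_ne hq (hf.monic j) (hf.irreducible j) (ne_zero_root hf hα j)
        (hα j)) _ (h1.symm.trans (hlift0 _))
    · rw [← rho_two hq hf hα ⟨j, h⟩, hz]
      exact hlift0 _
    · rw [← rho_three hq hf hα ⟨j, h⟩, hz]
      exact hlift0 _
    · rw [← rho_four_left hq hf hα ⟨j, h⟩, hz]
      exact hlift0 _
  · obtain h | h := hj
    · have h1 := rho_one_right hq hf hα ⟨j, h⟩ z
      rw [hz] at h1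
      exact hsig (inv_pow_q_ne F hq (h.inv_root_ne hq (hf.monic j) (hf.irreducible j)
        (ne_zero_root hf hα j) (hα j))) _ (h1.symm.trans (hlift0 _))
    · rw [← rho_four_right hq hf hα ⟨j, h⟩, hz]
      exact hlift0 _

end Components

end DihedralCode

namespace DihedralCode

/-! ### Dimensions -/

section Dimension

variable {F : Type*} [Field F]

lemma apply_of_mem_groupAlgC2 {M : Mat F} (hM : M ∈ GroupAlgC2 F) :
    M 1 0 = M 0 1 ∧ M 1 1 = M 0 0 := by
  induction hM using Algebra.adjoin_induction with
  | mem x hx => rw [Set.mem_singleton_iff.1 hx]; simp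
  | algebraMap c => simp [Matrix.algebraMap_matrix_apply]
  | add x y _ _ hx hy => simp [hx.1, hx.2, hy.1, hy.2]
  | mul x y _ _ hx hy =>
    simp only [Matrix.mul_apply, Fin.sum_univ_two, hx.1, hx.2, hy.1, hy.2]
    constructor <;> ring

/-- A circulant is determined by its first row. -/
lemma finrank_groupAlgC2_le : Module.finrank F (GroupAlgC2 F) ≤ 2 := by
  let φ : GroupAlgC2 F →ₗ[F] F × F :=
    { toFun := fun M => ((M : Mat F) 0 0, (M : Mat F) 0 1)
      map_add' := fun _ _ => rfl
      map_smul' := fun _ _ => rfl }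
  have hφ : Function.Injective φ := by
    refine (injective_iff_map_eq_zero φ).2 fun M hM => ?_
    have h0 : (M : Mat F) 0 0 = 0 := congrArg Prod.fst hM
    have h1 : (M : Mat F) 0 1 = 0 := congrArg Prod.snd hM
    obtain ⟨h2, h3⟩ := apply_of_mem_groupAlgC2 M.2
    apply Subtype.ext
    ext i j
    fin_cases i <;> fin_cases j <;> simp [h0, h1, h2, h3]
  have := LinearMap.finrank_le_finrank_of_injective hφ
  simpa using this

variable (F) in
/-- The vector space `M` has dimension at most `k`. -/
def DimLE (M : Type*) [AddCommGroup M] [Module F M] (k : ℕ) : Prop :=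
  Module.Finite F M ∧ Module.finrank F M ≤ k

lemma DimLE.mono {M : Type*} [AddCommGroup M] [Module F M] {k l : ℕ} (h : DimLE F M k)
    (hkl : k ≤ l) : DimLE F M l := ⟨h.1, h.2.trans hkl⟩

lemma DimLE.prod {M N : Type*} [AddCommGroup M] [Module F M] [AddCommGroup N] [Module F N]
    {k l : ℕ} (h : DimLE F M k) (h' : DimLE F N l) : DimLE F (M × N) (k + l) := by
  have := h.1
  have := h'.1
  refine ⟨inferInstance, ?_⟩
  rw [Module.finrank_prod]
  exact add_le_add h.2 h'.2

lemma DimLE.pi_subtype {J : Type*} [Fintype J] {p : J → Prop} [DecidablePred p] {M : {j // p j} → Type*}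
    [∀ j, AddCommGroup (M j)] [∀ j, Module F (M j)] (w : J → ℕ)
    (h : ∀ j, DimLE F (M j) (w j)) : DimLE F (∀ j, M j) (∑ j with p j, w j) := by
  have := fun j => (h j).1
  refine ⟨inferInstance, ?_⟩
  rw [Module.finrank_pi_fintype, Finset.sum_subtype (p := p) _ (by simp)]
  exact Finset.sum_le_sum fun j _ => (h j).2

lemma DimLE.mat {E : Type*} [Field E] [Algebra F E] {k : ℕ} (h : DimLE F E k) :
    DimLE F (Mat E) (4 * k) := by
  have := h.1
  refine ⟨inferInstance, ?_⟩
  rw [Module.finrank_matrix]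
  simpa using h.2

lemma natDegree_conjPoly [Fintype F] {q : ℕ} (hq : Fintype.card F = q ^ 2) (g : F[X]) :
    (conjPoly q g).natDegree = g.natDegree := by
  rw [conjPoly_eq_map hq, natDegree_map]

lemma natDegree_recipPoly {g : F[X]} (hg : g.coeff 0 ≠ 0) :
    (recipPoly g).natDegree = g.natDegree := by
  rw [recipPoly, natDegree_C_mul (inv_ne_zero hg), reverse_natDegree,
    natTrailingDegree_eq_zero.2 (Or.inr hg), Nat.sub_zero]

variable [Fintype F] {K J : Type*} [Field K] [Algebra F K] [Fintype J] {q n : ℕ}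
  [NeZero n] {f : J → F[X]} {α : J → K}

open Classical in
-- Degrees of both sides of the factorisation; conjugation preserves the degree, and so does
-- reciprocation, as the constant terms are nonzero.
lemma IsFactorisation.sum_natDegree (hq : Fintype.card F = q ^ 2) (hf : IsFactorisation q n f)
    (hα : ∀ j, aeval (α j) (f j) = 0) :
    n = ∑ j with IsJ0 q (f j), (f j).natDegree + ∑ j with IsJ1 q (f j), 2 * (f j).natDegree +
      ∑ j with IsJ2 q (f j) ∨ IsJ3 q (f j), 2 * (f j).natDegree +
      ∑ j with IsJ4 q (f j), 4 * (f j).natDegree := by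
  have hcoeff : ∀ j, (f j).coeff 0 ≠ 0 := fun j =>
    coeff_zero_ne_zero_of_root (hf.irreducible j) (hf.monic j) (ne_zero_root hf hα j) (hα j)
  have hdeg := congrArg natDegree hf.prod_eq
  have hne : (X ^ n - 1 : F[X]) ≠ 0 := X_pow_sub_C_ne_zero (NeZero.pos n) 1
  have hn : (X ^ n - 1 : F[X]).natDegree = n := natDegree_X_pow_sub_C (r := (1 : F))
  rw [hf.prod_eq] at hne
  have h123 := left_ne_zero_of_mul hne
  have h12 := left_ne_zero_of_mul h123
  have h1 := left_ne_zero_of_mul h12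
  have h2 := right_ne_zero_of_mul h12
  have h3 := right_ne_zero_of_mul h123
  have h4 := right_ne_zero_of_mul hne
  rw [hn, natDegree_mul h123 h4, natDegree_mul h12 h3, natDegree_mul h1 h2,
    natDegree_prod _ _ (Finset.prod_ne_zero_iff.1 h1),
    natDegree_prod _ _ (Finset.prod_ne_zero_iff.1 h2),
    natDegree_prod _ _ (Finset.prod_ne_zero_iff.1 h3),
    natDegree_prod _ _ (Finset.prod_ne_zero_iff.1 h4)] at hdeg
  refine hdeg.trans ?_
  congr 1
  · congr 1
    · congr 1
      refine Finset.sum_congr rfl fun j hj => ?_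
      have := Finset.prod_ne_zero_iff.1 h2 j hj
      rw [natDegree_mul (left_ne_zero_of_mul this) (right_ne_zero_of_mul this),
        natDegree_conjPoly hq]
      ring
    · refine Finset.sum_congr rfl fun j hj => ?_
      have := Finset.prod_ne_zero_iff.1 h3 j hj
      rw [natDegree_mul (left_ne_zero_of_mul this) (right_ne_zero_of_mul this),
        natDegree_recipPoly (hcoeff j)]
      ring
  · refine Finset.sum_congr rfl fun j hj => ?_
    have h := Finset.prod_ne_zero_iff.1 h4 j hj
    have h' := left_ne_zero_of_mul h
    have h'' := left_ne_zero_of_mul h'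
    rw [natDegree_mul h' (right_ne_zero_of_mul h), natDegree_mul h'' (right_ne_zero_of_mul h'),
      natDegree_mul (left_ne_zero_of_mul h'') (right_ne_zero_of_mul h''), natDegree_conjPoly hq,
      natDegree_conjPoly hq, natDegree_recipPoly (hcoeff j)]
    ring

omit [Fintype F] in
lemma DimLE.of_mem {a b : K} {k : ℕ} (h : DimLE F F⟮a⟯ k) (hb : b ∈ F⟮a⟯) :
    DimLE F F⟮b⟯ k := by
  have := h.1
  have hle : F⟮b⟯ ≤ F⟮a⟯ := IntermediateField.adjoin_simple_le_iff.2 hb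
  exact ⟨FiniteDimensional.of_injective (IntermediateField.inclusion hle).toLinearMap
      (IntermediateField.inclusion_injective hle),
    (LinearMap.finrank_le_finrank_of_injective
      (f := (IntermediateField.inclusion hle).toLinearMap)
      (IntermediateField.inclusion_injective hle)).trans h.2⟩

lemma pow_add_inv (hq : Fintype.card F = q ^ 2) (x : K) :
    (x + x⁻¹) ^ q = x ^ q + (x ^ q)⁻¹ := by
  rw [← powHom_apply F K hq, map_add, map_inv₀]
  rfl

/-- Each component has dimension at most twice the degree of its block in the factorisation: `2r`
for `J₀`, `4r` for `J₁`, `J₂` and `J₃`, `8r` for `J₄`. Upper bounds are enough, since injectivity of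
`rho` gives the other inequality. -/
lemma dimLE_decompAlg (hq : Fintype.card F = q ^ 2) (hf : IsFactorisation q n f)
    (hα : ∀ j, aeval (α j) (f j) = 0) : DimLE F (DecompAlg q f α) (2 * n) := by
  classical
  have hr : ∀ j, DimLE F F⟮α j⟯ (f j).natDegree := fun j =>
    ⟨IntermediateField.adjoin.finiteDimensional ⟨f j, hf.monic j, hα j⟩,
      (finrank_adjoin_root (hf.monic j) (hf.irreducible j) (hα j)).le⟩
  have hrq : ∀ j, DimLE F F⟮α j ^ q⟯ (f j).natDegree := fun j =>
    (hr j).of_mem (pow_mem (IntermediateField.mem_adjoin_simple_self F _) q)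
  have hpos : ∀ j, 1 ≤ (f j).natDegree := fun j => (hf.irreducible j).natDegree_pos
  have h0 : DimLE F (∀ _ : {j // IsJ0 q (f j) ∧ ringChar F ≠ 2}, F × F) _ :=
    .pi_subtype (fun j => 2 * (f j).natDegree) fun j => by
      refine ⟨inferInstance, ?_⟩
      have := hpos j
      simp
      omega
  have h0' : DimLE F (∀ _ : {j // IsJ0 q (f j) ∧ ringChar F = 2}, GroupAlgC2 F) _ :=
    .pi_subtype (fun j => 2 * (f j).natDegree) fun j => by
      refine ⟨inferInstance, finrank_groupAlgC2_le.trans ?_⟩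
      have := hpos j
      omega
  have h1 : DimLE F (∀ j : {j // IsJ1 q (f j)},
      Mat F⟮α j + (α j)⁻¹⟯ × Mat F⟮α j ^ q + (α j ^ q)⁻¹⟯) _ :=
    .pi_subtype (fun j => 4 * (f j).natDegree) fun j => by
      have hle := two_mul_finrank_adjoin_add_inv_le (hf.monic j) (hf.irreducible j) (hα j)
        (aeval_inv_of_eq_recipPoly (hf.monic j) (hf.irreducible j) (ne_zero_root hf hα j) (hα j)
          j.2.1)
        (j.2.inv_root_ne hq (hf.monic j) (hf.irreducible j) (ne_zero_root hf hα j) (hα j))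
      -- Both trace fields have degree at most `r / 2`, so the two matrix algebras together have
      -- dimension at most `2 * 4 * (r / 2) ≤ 4 * r`.
      have hs : DimLE F F⟮α j + (α j : K)⁻¹⟯ ((f j).natDegree / 2) := by
        refine ⟨((hr j).of_mem ?_).1, by omega⟩
        exact add_mem (IntermediateField.mem_adjoin_simple_self F _)
          (inv_mem (IntermediateField.mem_adjoin_simple_self F _))
      refine (hs.mat.prod (hs.of_mem ?_).mat).mono (by omega)
      rw [← pow_add_inv hq]
      exact pow_mem (IntermediateField.mem_adjoin_simple_self F _) q
  have h2 : DimLE F (∀ j : {j // IsJ2 q (f j)}, Mat F⟮α j⟯) _ :=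
    .pi_subtype (fun j => 4 * (f j).natDegree) fun j => (hr j).mat
  have h3 : DimLE F (∀ j : {j // IsJ3 q (f j)}, Mat F⟮α j⟯) _ :=
    .pi_subtype (fun j => 4 * (f j).natDegree) fun j => (hr j).mat
  have h4 : DimLE F (∀ j : {j // IsJ4 q (f j)}, Mat F⟮α j⟯ × Mat F⟮α j ^ q⟯) _ :=
    .pi_subtype (fun j => 8 * (f j).natDegree) fun j =>
      ((hr j).mat.prod (hrq j).mat).mono (by omega)
  refine (h0.prod (h0'.prod (h1.prod (h2.prod (h3.prod h4))))).mono ?_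
  have hn := hf.sum_natDegree hq hα
  have e0 : ∑ j with IsJ0 q (f j) ∧ ringChar F ≠ 2, 2 * (f j).natDegree +
      ∑ j with IsJ0 q (f j) ∧ ringChar F = 2, 2 * (f j).natDegree =
      2 * ∑ j with IsJ0 q (f j), (f j).natDegree := by
    by_cases hc : ringChar F = 2 <;> simp [hc, Finset.mul_sum]
  have e23 : ∑ j with IsJ2 q (f j), 4 * (f j).natDegree +
      ∑ j with IsJ3 q (f j), 4 * (f j).natDegree =
      2 * ∑ j with IsJ2 q (f j) ∨ IsJ3 q (f j), 2 * (f j).natDegree := by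
    rw [Finset.filter_or, Finset.sum_union, mul_add, Finset.mul_sum, Finset.mul_sum]
    · simp only [← mul_assoc, Nat.reduceMul]
    · rw [Finset.disjoint_filter]
      intro j _ h2 h3
      exact h2.2 (h2.1.trans h3.1)
  have e1 : ∑ j with IsJ1 q (f j), 4 * (f j).natDegree =
      2 * ∑ j with IsJ1 q (f j), 2 * (f j).natDegree := by
    simp only [Finset.mul_sum, ← mul_assoc, Nat.reduceMul]
  have e4 : ∑ j with IsJ4 q (f j), 8 * (f j).natDegree =
      2 * ∑ j with IsJ4 q (f j), 4 * (f j).natDegree := by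
    simp only [Finset.mul_sum, ← mul_assoc, Nat.reduceMul]
  omega

omit [Fintype F] in
lemma finrank_dihedral : Module.finrank F (MonoidAlgebra F (DihedralGroup n)) = 2 * n := by
  rw [← DihedralGroup.card (n := n)]
  exact (LinearEquiv.finrank_eq (MonoidAlgebra.coeffLinearEquiv F)).trans
    (Module.finrank_finsupp_self F)

lemma rho_bijective (hq : Fintype.card F = q ^ 2) (hqn : Nat.Coprime q n)
    (hf : IsFactorisation q n f) (hα : ∀ j, aeval (α j) (f j) = 0) :
    Function.Bijective (rho hq hf hα) := by
  have hinj := rho_injective hq hf hα hqn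
  obtain ⟨hfin, hle⟩ := dimLE_decompAlg hq hf hα
  refine ⟨hinj, ?_⟩
  have hfin' : FiniteDimensional F (MonoidAlgebra F (DihedralGroup n)) :=
    FiniteDimensional.of_injective (rho hq hf hα).toLinearMap hinj
  have hge := LinearMap.finrank_le_finrank_of_injective (f := (rho hq hf hα).toLinearMap) hinj
  have heq : Module.finrank F (MonoidAlgebra F (DihedralGroup n)) =
      Module.finrank F (DecompAlg q f α) := by
    refine le_antisymm hge ?_
    rwa [finrank_dihedral]
  exact (LinearMap.injective_iff_surjective_of_finrank_eq_finrank
    (f := (rho hq hf hα).toLinearMap) heq).1 hinj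

/-- The isomorphism of the group algebra with its decomposition. -/
noncomputable def rhoEquiv (hq : Fintype.card F = q ^ 2) (hqn : Nat.Coprime q n)
    (hf : IsFactorisation q n f) (hα : ∀ j, aeval (α j) (f j) = 0) :
    MonoidAlgebra F (DihedralGroup n) ≃ₐ[F] DecompAlg q f α :=
  AlgEquiv.ofBijective (rho hq hf hα) (rho_bijective hq hqn hf hα)

lemma isStandard_rhoEquiv (hq : Fintype.card F = q ^ 2) (hqn : Nat.Coprime q n)
    (hf : IsFactorisation q n f) (hα : ∀ j, aeval (α j) (f j) = 0) :
    IsStandard (rhoEquiv hq hqn hf hα) := by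
  have hr : rhoEquiv hq hqn hf hα (MonoidAlgebra.single (.r 1) 1) = imageR q f α :=
    rho_r hq hf hα
  have hs : rhoEquiv hq hqn hf hα (MonoidAlgebra.single (.sr 0) 1) = imageS q f α :=
    rho_sr hq hf hα
  have h0 := ne_zero_root hf hα
  have hne : ∀ j : {j // IsJ1 q (f j)}, (α j)⁻¹ ≠ α j := fun j =>
    j.2.inv_root_ne hq (hf.monic j) (hf.irreducible j) (h0 j) (hα j)
  constructor <;> intro j <;> simp only [hr, hs]
  · intro h
    simp [imageR, h]
  · intro h
    simp [imageR, h]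
  · rfl
  · rfl
  · rfl
  · exact liftMat_companionR (h0 j) (hne j)
  · exact liftMat_companionR (pow_ne_zero q (h0 j)) (inv_pow_q_ne F hq (hne j))
  · exact liftMat_companionS (hne j)
  · exact liftMat_companionS (inv_pow_q_ne F hq (hne j))
  · exact liftMat_rotGen _
  · exact liftMat_swapMat _
  · exact liftMat_rotGen _
  · exact liftMat_swapMat _
  · exact liftMat_rotGen _
  · exact liftMat_rotGen _
  · exact liftMat_swapMat _
  · exact liftMat_swapMat _

end Dimension

end DihedralCode

namespace DihedralCode

/-! ### Left ideals of the decomposition -/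

section Ideals

lemma exists_ideal_prod {R S : Type*} [Ring R] [Ring S] (I : Ideal (R × S)) :
    ∃ (A : Ideal R) (B : Ideal S), ∀ x, x ∈ I ↔ x.1 ∈ A ∧ x.2 ∈ B := by
  refine ⟨I.map (RingHom.fst R S), I.map (RingHom.snd R S), fun x => ?_⟩
  rw [← Ideal.mem_prod, ← Ideal.ideal_prod_eq]

lemma exists_ideal_pi {ι : Type*} [Finite ι] {R : ι → Type*} [∀ i, Ring (R i)]
    (I : Ideal (∀ i, R i)) : ∃ A : ∀ i, Ideal (R i), ∀ x, x ∈ I ↔ ∀ i, x i ∈ A i := by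
  refine ⟨Ideal.piOrderIso I, fun x => ?_⟩
  rw [← Ideal.mem_pi]
  exact (congrArg (x ∈ ·) (Ideal.piOrderIso.symm_apply_apply I)).symm.to_iff

variable {F K J : Type*} [Field F] [Field K] [Algebra F K] [Finite J] {q : ℕ} {f : J → F[X]}
  {α : J → K}

lemma exists_idealFamily (I : Ideal (DecompAlg q f α)) :
    ∃ S : IdealFamily q f α, (I : Set (DecompAlg q f α)) = S.directSum := by
  obtain ⟨I0, I', h⟩ := exists_ideal_prod I
  obtain ⟨I0two, I'', h'⟩ := exists_ideal_prod I'
  obtain ⟨I1, I', h''⟩ := exists_ideal_prod I''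
  obtain ⟨I2, I'', h2⟩ := exists_ideal_prod I'
  obtain ⟨I3, I4, h3⟩ := exists_ideal_prod I''
  obtain ⟨A0, hA0⟩ := exists_ideal_pi I0
  obtain ⟨A0two, hA0two⟩ := exists_ideal_pi I0two
  obtain ⟨A1, hA1⟩ := exists_ideal_pi I1
  obtain ⟨A2, hA2⟩ := exists_ideal_pi I2
  obtain ⟨A3, hA3⟩ := exists_ideal_pi I3
  obtain ⟨A4, hA4⟩ := exists_ideal_pi I4
  choose B1 C1 h1 using fun j => exists_ideal_prod (A1 j)
  choose B4 C4 h4 using fun j => exists_ideal_prod (A4 j)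
  refine ⟨⟨A0, A0two, B1, C1, A2, A3, B4, C4⟩, ?_⟩
  ext y
  rw [SetLike.mem_coe, h, h', h'', h2, h3, hA0, hA0two, hA1, hA2, hA3, hA4]
  simp only [h1, h4]
  rfl

variable {S : IdealFamily q f α}

namespace IdealFamily

omit [Finite J]

/-- Extension by zero shows that a component is the projection of the direct sum. This and its
analogues below give uniqueness of the family and translate conditions on `I` into conditions on one
component. -/
lemma mem_I0_iff {j : {j // IsJ0 q (f j) ∧ ringChar F ≠ 2}} {a : F × F} :
    a ∈ S.I0 j ↔ ∃ y ∈ S.directSum, y.1 j = a := by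
  classical
  refine ⟨fun h => ⟨(Pi.single j a, 0), ⟨fun i => ?_, ?_⟩, by simp⟩, ?_⟩
  · obtain rfl | hi := eq_or_ne i j
    · simpa using h
    · simp [hi]
  · simp
  · rintro ⟨y, hy, rfl⟩
    exact hy.1 j

lemma mem_I0two_iff {j : {j // IsJ0 q (f j) ∧ ringChar F = 2}} {a : GroupAlgC2 F} :
    a ∈ S.I0two j ↔ ∃ y ∈ S.directSum, y.2.1 j = a := by
  classical
  refine ⟨fun h => ⟨(0, Pi.single j a, 0), ⟨?_, fun i => ?_, ?_⟩, by simp⟩, ?_⟩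
  · simp
  · obtain rfl | hi := eq_or_ne i j
    · simpa using h
    · simp [hi]
  · simp
  · rintro ⟨y, hy, rfl⟩
    exact hy.2.1 j

lemma mem_I1_iff {j : {j // IsJ1 q (f j)}}
    {a : Mat F⟮α j + (α j)⁻¹⟯ × Mat F⟮α j ^ q + (α j ^ q)⁻¹⟯} :
    a.1 ∈ S.I1left j ∧ a.2 ∈ S.I1right j ↔ ∃ y ∈ S.directSum, y.2.2.1 j = a := by
  classical
  refine ⟨fun h => ⟨(0, 0, Pi.single j a, 0), ⟨?_, ?_, fun i => ?_, ?_⟩, by simp⟩, ?_⟩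
  · simp
  · simp
  · obtain rfl | hi := eq_or_ne i j
    · simpa using h
    · simp [hi]
  · simp
  · rintro ⟨y, hy, rfl⟩
    exact hy.2.2.1 j

lemma mem_I2_iff {j : {j // IsJ2 q (f j)}} {a : Mat F⟮α j⟯} :
    a ∈ S.I2 j ↔ ∃ y ∈ S.directSum, y.2.2.2.1 j = a := by
  classical
  refine ⟨fun h => ⟨(0, 0, 0, Pi.single j a, 0), ⟨?_, ?_, ?_, fun i => ?_, ?_⟩, by simp⟩, ?_⟩
  · simp
  · simp
  · simp
  · obtain rfl | hi := eq_or_ne i j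
    · simpa using h
    · simp [hi]
  · simp
  · rintro ⟨y, hy, rfl⟩
    exact hy.2.2.2.1 j

lemma mem_I3_iff {j : {j // IsJ3 q (f j)}} {a : Mat F⟮α j⟯} :
    a ∈ S.I3 j ↔ ∃ y ∈ S.directSum, y.2.2.2.2.1 j = a := by
  classical
  refine ⟨fun h => ⟨(0, 0, 0, 0, Pi.single j a, 0), ⟨?_, ?_, ?_, ?_, fun i => ?_, ?_⟩, by simp⟩, ?_⟩
  · simp
  · simp
  · simp
  · simp
  · obtain rfl | hi := eq_or_ne i j
    · simpa using h
    · simp [hi]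
  · simp
  · rintro ⟨y, hy, rfl⟩
    exact hy.2.2.2.2.1 j

lemma mem_I4_iff {j : {j // IsJ4 q (f j)}} {a : Mat F⟮α j⟯ × Mat F⟮α j ^ q⟯} :
    a.1 ∈ S.I4left j ∧ a.2 ∈ S.I4right j ↔ ∃ y ∈ S.directSum, y.2.2.2.2.2 j = a := by
  classical
  refine ⟨fun h => ⟨(0, 0, 0, 0, 0, Pi.single j a), ⟨?_, ?_, ?_, ?_, ?_, fun i => ?_⟩, by simp⟩, ?_⟩
  · simp
  · simp
  · simp
  · simp
  · simp
  · obtain rfl | hi := eq_or_ne i j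
    · simpa using h
    · simp [hi]
  · rintro ⟨y, hy, rfl⟩
    exact hy.2.2.2.2.2 j

lemma directSum_injective {S S' : IdealFamily q f α} (h : S.directSum = S'.directSum) :
    S = S' := by
  have h0 : S.I0 = S'.I0 := by
    ext j a : 2
    rw [mem_I0_iff, mem_I0_iff, h]
  have h0two : S.I0two = S'.I0two := by
    ext j a : 2
    rw [mem_I0two_iff, mem_I0two_iff, h]
  have h1 : ∀ (j : {j // IsJ1 q (f j)})
      (a : Mat F⟮α j + (α j)⁻¹⟯ × Mat F⟮α j ^ q + (α j ^ q)⁻¹⟯), (a.1 ∈ S.I1left j ∧ a.2 ∈ S.I1right j) ↔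
      (a.1 ∈ S'.I1left j ∧ a.2 ∈ S'.I1right j) := fun j a => by
    rw [mem_I1_iff, mem_I1_iff, h]
  have h1l : S.I1left = S'.I1left := by
    ext j a : 2
    simpa using h1 j (a, 0)
  have h1r : S.I1right = S'.I1right := by
    ext j a : 2
    simpa using h1 j (0, a)
  have h2 : S.I2 = S'.I2 := by
    ext j a : 2
    rw [mem_I2_iff, mem_I2_iff, h]
  have h3 : S.I3 = S'.I3 := by
    ext j a : 2
    rw [mem_I3_iff, mem_I3_iff, h]
  have h4 : ∀ (j : {j // IsJ4 q (f j)}) (a : Mat F⟮α j⟯ × Mat F⟮α j ^ q⟯), (a.1 ∈ S.I4left j ∧ a.2 ∈ S.I4right j) ↔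
      (a.1 ∈ S'.I4left j ∧ a.2 ∈ S'.I4right j) := fun j a => by
    rw [mem_I4_iff, mem_I4_iff, h]
  have h4l : S.I4left = S'.I4left := by
    ext j a : 2
    simpa using h4 j (a, 0)
  have h4r : S.I4right = S'.I4right := by
    ext j a : 2
    simpa using h4 j (0, a)
  cases S
  cases S'
  simp only [IdealFamily.mk.injEq]
  exact ⟨h0, h0two, h1l, h1r, h2, h3, h4l, h4r⟩

end IdealFamily

lemma existsUnique_idealFamily {A : Type*} [Ring A] [Algebra F A] (ρ : A ≃ₐ[F] DecompAlg q f α)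
    (I : Ideal A) : ∃! S : IdealFamily q f α, ρ '' I = S.directSum := by
  obtain ⟨S, hS⟩ := exists_idealFamily (I.comap (ρ.symm : DecompAlg q f α →+* A))
  have hI : ρ '' I = (I.comap (ρ.symm : DecompAlg q f α →+* A) : Set (DecompAlg q f α)) := by
    ext y
    constructor
    · rintro ⟨x, hx, rfl⟩
      show ρ.symm (ρ x) ∈ I
      rwa [ρ.symm_apply_apply]
    · intro hy
      exact ⟨ρ.symm y, hy, ρ.apply_symm_apply y⟩
  refine ⟨S, hI.trans hS, fun S' hS' => ?_⟩
  exact IdealFamily.directSum_injective (hS'.symm.trans (hI.trans hS))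

end Ideals

end DihedralCode

namespace DihedralCode

/-! ### The local conditions -/

section Local

open scoped Matrix

/-! ### Semilinear forms on matrices -/

section Helpers

variable {K L : Type*} [Field K] [Field L]

lemma map_matrix_eq_zero_iff (θ : K →+* L) {M : Mat K} : M.map θ = 0 ↔ M = 0 := by
  rw [← Matrix.map_zero θ (map_zero θ)]
  exact (Matrix.map_injective θ.injective).eq_iff

lemma transpose_eq_zero_iff {M : Mat K} : Mᵀ = 0 ↔ M = 0 := by
  rw [← Matrix.transpose_inj (A := M), Matrix.transpose_zero]

lemma swapMat_mul_eq_zero_iff (M : Mat K) : swapMat K * M = 0 ↔ M = 0 := by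
  refine ⟨fun h => ?_, fun h => by rw [h, mul_zero]⟩
  rw [← one_mul M, ← swapMat_mul_self, mul_assoc, h, mul_zero]

/-- A twist common to both arguments can be stripped, as `θ` is injective; transposing then
exchanges the arguments. -/
lemma map_mul_mul_transpose_map_eq_zero_iff (θ : K →+* L) {C : Mat K} {C' : Mat L}
    (hC : C.map θ = C') (hCt : Cᵀ = C) (A B : Mat K) :
    A.map θ * C' * (B.map θ)ᵀ = 0 ↔ B * C * Aᵀ = 0 := by
  rw [← hC, ← Matrix.transpose_map, ← Matrix.map_mul, ← Matrix.map_mul, map_matrix_eq_zero_iff,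
    ← transpose_eq_zero_iff, Matrix.transpose_mul, Matrix.transpose_mul, Matrix.transpose_transpose,
    hCt, mul_assoc]

/-- Change of basis: `Z` carries the form `B` to a multiple of `C`, and neither invertible factors
nor a nonzero scalar affect vanishing. -/
lemma conj_form_eq_zero_iff {Z X Y M N B C : Mat K} {c : K} (hZ : IsUnit Z) (hc : c ≠ 0)
    (hX : X * Z = Z * N) (hY : Y * Z = Z * M) (hform : Z * B * Zᵀ = c • C) :
    X * C * Yᵀ = 0 ↔ N * B * Mᵀ = 0 := by
  have hZt : IsUnit Zᵀ := (Matrix.isUnit_transpose Z).2 hZ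
  have h : Z * (N * B * Mᵀ) * Zᵀ = c • (X * C * Yᵀ) := by
    calc Z * (N * B * Mᵀ) * Zᵀ = (Z * N) * B * (Z * M)ᵀ := by
          rw [Matrix.transpose_mul]; simp only [mul_assoc]
      _ = X * (Z * B * Zᵀ) * Yᵀ := by
          rw [← hX, ← hY, Matrix.transpose_mul]; simp only [mul_assoc]
      _ = _ := by rw [hform, Matrix.mul_smul, Matrix.smul_mul]
  rw [← smul_eq_zero_iff_right hc, ← h, hZt.mul_left_eq_zero, hZ.mul_right_eq_zero]

lemma mul_zmat_eq {β : K} (h : β⁻¹ ≠ β) (M : Mat K) : M * zmat β = zmat β * sigma β M := by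
  rw [sigma, ← mul_assoc, ← mul_assoc, Matrix.mul_nonsing_inv _ (isUnit_det_zmat h), one_mul]

end Helpers

variable {F : Type*} [Field F] [Fintype F] {K : Type*} [Field K] [Algebra F K] {q : ℕ}

lemma powHom_pow_apply (hq : Fintype.card F = q ^ 2) (k : ℕ) (x : K) :
    (powHom F K hq ^ k) x = x ^ q ^ k := by
  rw [RingHom.coe_pow, powHom_iterate]

/-- For even `k`, `q ^ k` is a power of the cardinality of `F`, so the power map fixes the
coefficients in `F`. For odd `k` this may fail. -/
lemma dihedralRep_pow_even {n : ℕ} [NeZero n] (hq : Fintype.card F = q ^ 2) {k : ℕ} (hk : Even k)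
    {x : K} (hx : x ^ n = 1) (hxk : (x ^ q ^ k) ^ n = 1) (z : MonoidAlgebra F (DihedralGroup n)) :
    dihedralRep F (x ^ q ^ k) hxk z = (dihedralRep F x hx z).map (powHom F K hq ^ k) := by
  obtain ⟨m, rfl⟩ := hk
  have hfun : ∀ y : K, (FiniteField.frobeniusAlgHom F K ^ m) y = y ^ q ^ (m + m) := fun y => by
    rw [frobenius_pow_apply, hq, ← pow_mul, two_mul]
  rw [dihedralRep_congr (hfun x).symm _ (by rw [hfun]; exact hxk), dihedralRep_map _ hx]
  ext i j
  rw [Matrix.map_apply, Matrix.map_apply, hfun, powHom_pow_apply]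

lemma pow_mem_adjoin (hq : Fintype.card F = q ^ 2) {a b : K} (hab : a ^ q = b) {x : K}
    (hx : x ∈ F⟮a⟯) : x ^ q ∈ F⟮b⟯ := by
  induction hx using IntermediateField.adjoin_induction with
  | mem x hx =>
    rw [Set.mem_singleton_iff.1 hx, hab]
    exact IntermediateField.mem_adjoin_simple_self F b
  | algebraMap c => exact pow_mem (algebraMap_mem _ c) q
  | add x y _ _ hx hy =>
    rw [← powHom_apply F K hq, map_add]
    exact add_mem hx hy
  | inv x _ hx =>
    rw [inv_pow]
    exact inv_mem hx
  | mul x y _ _ hx hy =>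
    rw [mul_pow]
    exact mul_mem hx hy

/-- The homomorphism `F(a) → F(a ^ q)`, `x ↦ x ^ q`. -/
def powHomAdjoin (hq : Fintype.card F = q ^ 2) {a b : K} (hab : a ^ q = b) : F⟮a⟯ →+* F⟮b⟯ :=
  ((powHom F K hq).comp (algebraMap F⟮a⟯ K)).codRestrict F⟮b⟯ fun x => pow_mem_adjoin hq hab x.2

lemma liftMat_map_powHomAdjoin (hq : Fintype.card F = q ^ 2) {a b : K} (hab : a ^ q = b)
    (M : Mat F⟮a⟯) : liftMat (M.map (powHomAdjoin hq hab)) = (liftMat M).map (powHom F K hq) := rfl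

omit [Fintype F] in
lemma liftMat_eq_zero_iff {E : IntermediateField F K} {M : Mat E} : liftMat M = 0 ↔ M = 0 :=
  map_matrix_eq_zero_iff _

omit [Fintype F] in
lemma liftMat_mul {E : IntermediateField F K} (M N : Mat E) :
    liftMat (M * N) = liftMat M * liftMat N := map_mul (liftHom E) M N

variable {J : Type*} [Fintype J] {n : ℕ} [NeZero n] {f : J → F[X]} {α : J → K}
  (hq : Fintype.card F = q ^ 2) (hf : IsFactorisation q n f)
  (hα : ∀ j, aeval (α j) (f j) = 0)

/-- The condition on a left ideal of the group algebra at the root of `f j`. -/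
def LocallyOrthogonal (I : Ideal (MonoidAlgebra F (DihedralGroup n))) (j : J) : Prop :=
  ∀ x ∈ I, ∀ y ∈ I,
    dihedralRep F (α j ^ q) (hf.pow_q_pow_eq_one hα j) x * swapMat K *
      ((dihedralRep F (α j) (hf.pow_eq_one hα j) y).map (powHom F K hq))ᵀ = 0

variable {I : Ideal (MonoidAlgebra F (DihedralGroup n))} {S : IdealFamily q f α}

include hf hα in
/-- Rewriting a statement about all pairs of elements of `I` as one about the pairs of components
at one place. -/
lemma forall_forall_iff {A : Type*} {P : A → Prop} {π : DecompAlg q f α → A}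
    (hP : ∀ a, P a ↔ ∃ y ∈ S.directSum, π y = a)
    (hS : rho hq hf hα '' I = S.directSum) {Q : A → A → Prop} :
    (∀ x ∈ I, ∀ y ∈ I, Q (π (rho hq hf hα x)) (π (rho hq hf hα y))) ↔
      ∀ a, P a → ∀ b, P b → Q a b := by
  constructor
  · intro h a ha b hb
    obtain ⟨_, hy, rfl⟩ := (hP a).1 ha
    obtain ⟨_, hz, rfl⟩ := (hP b).1 hb
    rw [← hS] at hy hz
    obtain ⟨x, hx, rfl⟩ := hy
    obtain ⟨y, hy, rfl⟩ := hz
    exact h x hx y hy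
  · intro h x hx y hy
    exact h _ ((hP _).2 ⟨_, hS ▸ ⟨x, hx, rfl⟩, rfl⟩) _ ((hP _).2 ⟨_, hS ▸ ⟨y, hy, rfl⟩, rfl⟩)

omit [Fintype F] in
lemma generatedByRow_zero_one_iff {E : IntermediateField F K} {I : Ideal (Mat E)} :
    GeneratedByRow I 0 1 ↔ I = rowIdeal 0 1 :=
  generatedByRow_iff 0 1 (ZeroMemClass.coe_zero E) (OneMemClass.coe_one E)

omit [Fintype F] in
lemma generatedByRow_one_iff {E : IntermediateField F K} {I : Ideal (Mat E)} (l : E) :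
    GeneratedByRow I 1 (l : K) ↔ I = rowIdeal 1 l :=
  generatedByRow_iff 1 l (OneMemClass.coe_one E) rfl

omit [Fintype F] in
lemma liftMat_mul_mul_transpose_eq_zero_iff {E : IntermediateField F K} {C : Mat E} (A B : Mat E) :
    liftMat B * liftMat C * (liftMat A)ᵀ = 0 ↔ B * C * Aᵀ = 0 := by
  rw [← liftMat_eq_zero_iff (M := B * C * Aᵀ), liftMat_mul, liftMat_mul]
  rfl

/-- Splits off one `q`-th power, to be cancelled against the one on the other argument of the form;
the remaining `q ^ r` acts inside `E`. -/
lemma liftMat_map_pow_succ {E : IntermediateField F K} (r : ℕ) (A : Mat E) :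
    (liftMat A).map (powHom F K hq ^ (r + 1)) =
      (liftMat (A.map (powHom F E hq ^ r))).map (powHom F K hq) := by
  ext a b
  simp only [Matrix.map_apply]
  rw [powHom_pow_apply, powHom_pow_apply, map_pow, powHom_apply, ← pow_mul, ← pow_succ]

/-- Here `α ^ q = α ^ (q ^ (r + 1))` with `r + 1` even, so the image of `x` at `α ^ q` is a twist of
its image at `α`. Cancelling one `q`-th power leaves the form with matrix `S` and twist `q ^ r` on a
single ideal. -/
lemma locallyOrthogonal_two_iff (hS : rho hq hf hα '' I = S.directSum)
    (j : {j // IsJ2 q (f j)}) :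
    LocallyOrthogonal hq hf hα I j.1 ↔ S.I2 j = ⊥ ∨ GeneratedByRow (S.I2 j) 0 1 ∨
      ∃ l : F⟮α j⟯, l = -l ^ q ^ (f j).natDegree ∧ GeneratedByRow (S.I2 j) 1 l := by
  obtain ⟨hodd, hroot⟩ := j.2.root_pow hq (hf.monic j) (hf.irreducible j) (hα j)
  set r := (f j).natDegree
  have heven : Even (r + 1) := hodd.add_one
  have key : ∀ x y, dihedralRep F (α j ^ q) (hf.pow_q_pow_eq_one hα j) x * swapMat K *
      ((dihedralRep F (α j) (hf.pow_eq_one hα j) y).map (powHom F K hq))ᵀ = 0 ↔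
      (rho hq hf hα y).2.2.2.1 j * swapMat _ *
        (((rho hq hf hα x).2.2.2.1 j).map (powHom F F⟮α j⟯ hq ^ r))ᵀ = 0 := by
    intro x y
    have hn := hf.pow_q_pow_eq_one hα j
    rw [dihedralRep_congr hroot _ (hroot ▸ hn), dihedralRep_pow_even hq heven
      (hf.pow_eq_one hα j), ← rho_two hq hf hα j x, ← rho_two hq hf hα j y, liftMat_map_pow_succ,
      map_mul_mul_transpose_map_eq_zero_iff (powHom F K hq) (map_swapMat _) transpose_swapMat,
      ← liftMat_swapMat F⟮α j⟯, liftMat_mul_mul_transpose_eq_zero_iff]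
  unfold LocallyOrthogonal
  simp only [key, generatedByRow_zero_one_iff, generatedByRow_one_iff]
  rw [forall_forall_iff hq hf hα (π := fun y => y.2.2.2.1 j) (fun a => IdealFamily.mem_I2_iff) hS
    (Q := fun a b => b * swapMat _ * (a.map (powHom F F⟮α j⟯ hq ^ r))ᵀ = 0),
    self_orthogonal_swapMat_iff]
  simp only [powHom_pow_apply]

/-- As for `J₂`, but `α ^ q` is the inverse of `α ^ (q ^ (r + 1))`. Passing to the inverse
conjugates by `S`; one of these factors cancels the `S` of the form and the other is a unit on the
left, so the form has matrix `1`. -/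
lemma locallyOrthogonal_three_iff (hS : rho hq hf hα '' I = S.directSum)
    (j : {j // IsJ3 q (f j)}) :
    LocallyOrthogonal hq hf hα I j.1 ↔ S.I3 j = ⊥ ∨
      ∃ l : F⟮α j⟯, l ≠ 0 ∧ l = -(l ^ q ^ (f j).natDegree)⁻¹ ∧ GeneratedByRow (S.I3 j) 1 l := by
  obtain ⟨hodd, hroot⟩ := j.2.root_pow hq (hf.monic j) (hf.irreducible j)
    (ne_zero_root hf hα j) (hα j)
  set r := (f j).natDegree
  have heven : Even (r + 1) := hodd.add_one
  have hroot' : α j ^ q = (α j ^ q ^ (r + 1))⁻¹ := by rw [← hroot, inv_inv]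
  have key : ∀ x y, dihedralRep F (α j ^ q) (hf.pow_q_pow_eq_one hα j) x * swapMat K *
      ((dihedralRep F (α j) (hf.pow_eq_one hα j) y).map (powHom F K hq))ᵀ = 0 ↔
      (rho hq hf hα y).2.2.2.2.1 j *
        (((rho hq hf hα x).2.2.2.2.1 j).map (powHom F F⟮α j⟯ hq ^ r))ᵀ = 0 := by
    intro x y
    have hn := hf.pow_q_pow_eq_one hα j
    rw [dihedralRep_congr hroot' _ (hroot' ▸ hn),
      dihedralRep_inv (pow_pow_eq_one (hf.pow_eq_one hα j) _),
      dihedralRep_pow_even hq heven (hf.pow_eq_one hα j),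
      ← rho_three hq hf hα j x, ← rho_three hq hf hα j y, liftMat_map_pow_succ,
      mul_assoc _ (swapMat K) (swapMat K), swapMat_mul_self, mul_assoc, mul_assoc,
      swapMat_mul_eq_zero_iff, ← mul_assoc,
      map_mul_mul_transpose_map_eq_zero_iff (powHom F K hq)
        (Matrix.map_one _ (map_zero _) (map_one _)) Matrix.transpose_one,
      ← map_one (liftHom F⟮α j⟯), liftHom_apply, liftMat_mul_mul_transpose_eq_zero_iff, mul_one]
  unfold LocallyOrthogonal
  simp only [key, generatedByRow_one_iff]
  rw [forall_forall_iff hq hf hα (π := fun y => y.2.2.2.2.1 j) (fun a => IdealFamily.mem_I3_iff) hS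
    (Q := fun a b => b * (a.map (powHom F F⟮α j⟯ hq ^ r))ᵀ = 0),
    self_orthogonal_one_iff]
  simp only [powHom_pow_apply]

/-- The relation sees only the right summand of `a` and the left summand of `b`; padding with zeros
makes them independent. -/
lemma forall_pair_iff {A B : Type*} [Zero A] [Zero B] {P : A → Prop} {Q : B → Prop}
    (hP : P 0) (hQ : Q 0) {R : A → B → Prop} :
    (∀ a : A × B, P a.1 ∧ Q a.2 → ∀ b : A × B, P b.1 ∧ Q b.2 → R b.1 a.2) ↔
      ∀ M, P M → ∀ N, Q N → R M N :=
  ⟨fun h M hM N hN => h (0, N) ⟨hP, hN⟩ (M, 0) ⟨hM, hQ⟩,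
    fun h _ ha _ hb => h _ hb.1 _ ha.2⟩

/-- The summands carry the representations at `α` and `α ^ q`, so the condition is orthogonality
between two independent ideals, twisted by `x ↦ x ^ q` from `F(α)` to `F(α ^ q)`. -/
lemma locallyOrthogonal_four_iff (hS : rho hq hf hα '' I = S.directSum)
    (j : {j // IsJ4 q (f j)}) :
    LocallyOrthogonal hq hf hα I j.1 ↔ S.I4left j = ⊥ ∨ S.I4right j = ⊥ ∨
      (GeneratedByRow (S.I4left j) 0 1 ∧ GeneratedByRow (S.I4right j) 0 1) ∨
      ∃ l : F⟮α j⟯, GeneratedByRow (S.I4left j) 1 l ∧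
        GeneratedByRow (S.I4right j) 1 (-(l : K) ^ q) := by
  set θ : F⟮α j⟯ →+* F⟮α j ^ q⟯ := powHomAdjoin hq rfl
  have key : ∀ x y, dihedralRep F (α j ^ q) (hf.pow_q_pow_eq_one hα j) x * swapMat K *
      ((dihedralRep F (α j) (hf.pow_eq_one hα j) y).map (powHom F K hq))ᵀ = 0 ↔
      ((rho hq hf hα x).2.2.2.2.2 j).2 * swapMat _ *
        (((rho hq hf hα y).2.2.2.2.2 j).1.map θ)ᵀ = 0 := by
    intro x y
    rw [← rho_four_right hq hf hα j x, ← rho_four_left hq hf hα j y,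
      ← liftMat_map_powHomAdjoin hq rfl, ← liftMat_swapMat F⟮α j ^ q⟯,
      liftMat_mul_mul_transpose_eq_zero_iff]
  unfold LocallyOrthogonal
  simp only [key, generatedByRow_zero_one_iff, generatedByRow_one_iff]
  rw [forall_forall_iff hq hf hα (π := fun y => y.2.2.2.2.2 j)
    (P := fun a => a.1 ∈ S.I4left j ∧ a.2 ∈ S.I4right j) (fun a => IdealFamily.mem_I4_iff) hS
    (Q := fun a b => a.2 * swapMat _ * (b.1.map θ)ᵀ = 0),
    forall_pair_iff (P := (· ∈ S.I4left j)) (Q := (· ∈ S.I4right j)) (zero_mem _) (zero_mem _)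
      (R := fun M N => N * swapMat _ * (M.map θ)ᵀ = 0), orthogonal_swapMat_iff]
  have hgen : ∀ l : F⟮α j⟯, GeneratedByRow (S.I4right j) 1 (-(l : K) ^ q) ↔
      S.I4right j = rowIdeal 1 (-θ l) := fun l => generatedByRow_one_iff (-θ l)
  simp only [hgen]

/-- As for `J₄`, except that both summands are written in the basis given by `zmat`, where the form
has the matrix `!![2, s; s, 2]` over the trace field. -/
lemma locallyOrthogonal_one_iff (hS : rho hq hf hα '' I = S.directSum)
    (j : {j // IsJ1 q (f j)}) :
    LocallyOrthogonal hq hf hα I j.1 ↔ S.I1left j = ⊥ ∨ S.I1right j = ⊥ ∨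
      (GeneratedByRow (S.I1left j) 0 1 ∧
        GeneratedByRow (S.I1right j) 2 (-(α j ^ q + (α j ^ q)⁻¹))) ∨
      ∃ l : F⟮α j + (α j : K)⁻¹⟯, GeneratedByRow (S.I1left j) 1 l ∧
        GeneratedByRow (S.I1right j)
          ((2 * l + (α j + (α j)⁻¹)) ^ q) ((-2 - l * (α j + (α j)⁻¹)) ^ q) := by
  have h0 := ne_zero_root hf hα j
  have hne := j.2.inv_root_ne hq (hf.monic j) (hf.irreducible j) h0 (hα j)
  have hneq := inv_pow_q_ne F hq hne
  have h0q := pow_ne_zero q h0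
  unfold LocallyOrthogonal
  set β : K := α j ^ q with hβ
  set θ : F⟮α j + (α j : K)⁻¹⟯ →+* F⟮β + β⁻¹⟯ := powHomAdjoin hq (pow_add_inv hq _)
  set s : F⟮β + β⁻¹⟯ := IntermediateField.AdjoinSimple.gen F (β + β⁻¹)
  have hs : (s : K) = β + β⁻¹ := IntermediateField.AdjoinSimple.coe_gen F _
  have h2 : ((2 : F⟮β + β⁻¹⟯) : K) = 2 := map_ofNat (algebraMap F⟮β + β⁻¹⟯ K) 2
  have hd : β - β⁻¹ ≠ 0 := sub_ne_zero.2 hneq.symm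
  -- The determinant `4 - s ^ 2` equals `-(β - β⁻¹) ^ 2`, nonzero because `β` is not its own
  -- inverse.
  have hB : (!![2, s; s, 2] : Mat F⟮β + β⁻¹⟯).det ≠ 0 := by
    have hdet : (((!![2, s; s, 2] : Mat F⟮β + β⁻¹⟯).det : F⟮β + β⁻¹⟯) : K) =
        -(β - β⁻¹) ^ 2 := by
      rw [Matrix.det_fin_two]
      simp [hs, h2]
      field_simp
      ring
    intro h
    rw [h] at hdet
    simp [hd] at hdet
  have hform : zmat β * liftMat (!![2, s; s, 2] : Mat F⟮β + β⁻¹⟯) * (zmat β)ᵀ =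
      (-(β - β⁻¹) ^ 2) • swapMat K := by
    have hl : liftMat (!![2, s; s, 2] : Mat F⟮β + β⁻¹⟯) = !![2, β + β⁻¹; β + β⁻¹, 2] := by
      ext a b; fin_cases a <;> fin_cases b <;> simp [hs, h2]
    rw [hl]
    ext a b
    fin_cases a <;> fin_cases b <;> simp [Matrix.mul_apply, Fin.sum_univ_two] <;>
      field_simp <;> ring
  have hz : (zmat (α j)).map (powHom F K hq) = zmat β := by
    ext a b
    fin_cases a <;> fin_cases b <;> simp [-powHom_apply] <;> simp [hβ]
  have key : ∀ x y, dihedralRep F β (hf.pow_q_pow_eq_one hα j) x * swapMat K *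
      ((dihedralRep F (α j) (hf.pow_eq_one hα j) y).map (powHom F K hq))ᵀ = 0 ↔
      ((rho hq hf hα x).2.2.1 j).2 * !![2, s; s, 2] *
        (((rho hq hf hα y).2.2.1 j).1.map θ)ᵀ = 0 := by
    intro x y
    have hX := mul_zmat_eq hneq (dihedralRep F β (hf.pow_q_pow_eq_one hα j) x)
    have hY₀ := mul_zmat_eq hne (dihedralRep F (α j) (hf.pow_eq_one hα j) y)
    rw [← rho_one_right hq hf hα j x] at hX
    rw [← rho_one_left hq hf hα j y] at hY₀
    have hY := congrArg (fun M : Mat K => M.map (powHom F K hq)) hY₀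
    simp only [Matrix.map_mul, hz] at hY
    rw [← liftMat_map_powHomAdjoin hq (pow_add_inv hq _)] at hY
    rw [conj_form_eq_zero_iff ((Matrix.isUnit_iff_isUnit_det _).2 (isUnit_det_zmat hneq))
      (neg_ne_zero.2 (pow_ne_zero 2 hd)) hX hY hform, liftMat_mul_mul_transpose_eq_zero_iff]
  -- The orthogonals of `(0, 1)` and `(1, l)` under `!![2, s; s, 2]` are spanned by `(2, -s)` and
  -- `(s + 2 θ l, -(2 + s θ l))`; in `K` the latter entries are `q`-th powers of expressions in `l`
  -- and `α + α⁻¹`.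
  have h01 : GeneratedByRow (S.I1right j) 2 (-(α j ^ q + (α j ^ q)⁻¹)) ↔ S.I1right j = rowIdeal 2 (-s) :=
    generatedByRow_iff 2 (-s) h2 (by simp [hs, hβ])
  have h1l : ∀ l : F⟮α j + (α j : K)⁻¹⟯, GeneratedByRow (S.I1right j)
      ((2 * l + (α j + (α j)⁻¹)) ^ q) ((-2 - l * (α j + (α j)⁻¹)) ^ q) ↔
      S.I1right j = rowIdeal (s + 2 * θ l) (-(2 + s * θ l)) := fun l => by
    have hθ : (θ l : K) = powHom F K hq l := rfl
    have hsp : powHom F K hq (α j + (α j)⁻¹) = β + β⁻¹ := pow_add_inv hq _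
    have e₁ : (2 * (l : K) + (α j + (α j)⁻¹)) ^ q = 2 * powHom F K hq l + (β + β⁻¹) := by
      rw [← powHom_apply F K hq, map_add, map_mul, hsp, map_ofNat]
    have e₂ : (-2 - (l : K) * (α j + (α j)⁻¹)) ^ q = -2 - powHom F K hq l * (β + β⁻¹) := by
      rw [← powHom_apply F K hq, map_sub, map_mul, hsp, map_neg, map_ofNat]
    refine generatedByRow_iff _ _ (Eq.trans ?_ e₁.symm) (Eq.trans ?_ e₂.symm)
    · simp only [IntermediateField.coe_add, IntermediateField.coe_mul, hs, h2, hθ]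
      ring
    · simp only [IntermediateField.coe_add, IntermediateField.coe_mul, IntermediateField.coe_neg,
        hs, h2, hθ]
      ring
  have key' : ∀ x y, dihedralRep F (α j ^ q) (hf.pow_q_pow_eq_one hα j) x * swapMat K *
      ((dihedralRep F (α j) (hf.pow_eq_one hα j) y).map (powHom F K hq))ᵀ = 0 ↔
      ((rho hq hf hα x).2.2.1 j).2 * !![2, s; s, 2] *
        (((rho hq hf hα y).2.2.1 j).1.map θ)ᵀ = 0 := key
  simp only [h01, h1l, key', generatedByRow_zero_one_iff, generatedByRow_one_iff]
  rw [forall_forall_iff hq hf hα (π := fun y => y.2.2.1 j)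
    (P := fun a => a.1 ∈ S.I1left j ∧ a.2 ∈ S.I1right j) (fun a => IdealFamily.mem_I1_iff) hS
    (Q := fun a b => a.2 * !![2, s; s, 2] * (b.1.map θ)ᵀ = 0),
    forall_pair_iff (P := (· ∈ S.I1left j)) (Q := (· ∈ S.I1right j)) (zero_mem _) (zero_mem _)
      (R := fun M N => N * !![2, s; s, 2] * (M.map θ)ᵀ = 0), orthogonal_iff θ hB]
  simp

/-- In eigenvalue coordinates the swap matrix is `(1, -1)` and transposition does nothing, so
pairing an element with itself gives `±a ^ (q + 1)` in each coordinate. No nonzero element survives.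
-/
lemma locallyOrthogonal_zero_iff (hS : rho hq hf hα '' I = S.directSum)
    (j : {j // IsJ0 q (f j) ∧ ringChar F ≠ 2}) :
    LocallyOrthogonal hq hf hα I j.1 ↔ S.I0 j = ⊥ := by
  have h2 : (2 : K) ≠ 0 := two_ne_zero_of_ringChar j.2.2
  have hroot := j.2.1.pow_root hq (hf.monic j) (hf.irreducible j) (ne_zero_root hf hα j) (hα j)
  have hswap : swapMat K = circulantHom h2 ((1, -1) : F × F) := by
    rw [circulantHom_apply]
    ext a b; fin_cases a <;> fin_cases b <;> simp; all_goals field_simp; norm_num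
  have hpow : ∀ p : F × F, ((circulantHom h2 p : Mat K).map (powHom F K hq)).transpose =
      circulantHom h2 (p.1 ^ q, p.2 ^ q) := by
    intro p
    have h2q : (2 : K) ^ q = 2 := by rw [← powHom_apply F K hq, map_ofNat]
    rw [circulantHom_apply, circulantHom_apply]
    ext a b
    fin_cases a <;> fin_cases b <;> simp [-powHom_apply] <;> simp [h2q]
  have key : ∀ x y, dihedralRep F (α j ^ q) (hf.pow_q_pow_eq_one hα j) x * swapMat K *
      ((dihedralRep F (α j) (hf.pow_eq_one hα j) y).map (powHom F K hq))ᵀ = 0 ↔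
      (rho hq hf hα x).1 j * (1, -1) *
        (((rho hq hf hα y).1 j).1 ^ q, ((rho hq hf hα y).1 j).2 ^ q) = 0 := by
    intro x y
    rw [dihedralRep_congr hroot _ (hf.pow_eq_one hα j), ← rho_zero hq hf hα j h2 x,
      ← rho_zero hq hf hα j h2 y, hpow, hswap, ← map_mul, ← map_mul]
    exact map_eq_zero_iff (circulantHom h2) (circulantHom_injective h2)
  unfold LocallyOrthogonal
  simp only [key]
  rw [forall_forall_iff hq hf hα (π := fun y => y.1 j) (fun a => IdealFamily.mem_I0_iff) hS
    (Q := fun a b => a * (1, -1) * (b.1 ^ q, b.2 ^ q) = 0), Submodule.eq_bot_iff]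
  constructor
  · intro h p hp
    have := h p hp p hp
    rw [Prod.ext_iff] at this
    simpa [Prod.ext_iff, ne_zero_of_card_eq_sq hq] using this
  · intro h a ha b _
    rw [h a ha, zero_mul, zero_mul]

omit [Fintype F] in
-- Circulants with equal entries form the line over `F` through the all-ones matrix.
lemma eq_bot_or_span_of_groupAlgC2 {I : Ideal (GroupAlgC2 F)}
    (h : ∀ M ∈ I, (M : Mat F) 0 0 = (M : Mat F) 0 1) :
    I = ⊥ ∨ ∃ M : GroupAlgC2 F, (M : Mat F) = !![1, 1; 1, 1] ∧ I = Ideal.span {M} := by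
  refine or_iff_not_imp_left.2 fun hI => ?_
  let A : GroupAlgC2 F := 1 + swapC2 F
  have hA : (A : Mat F) = !![1, 1; 1, 1] := by
    show (1 : Mat F) + swapMat F = _
    ext a b; fin_cases a <;> fin_cases b <;> simp
  have key : ∀ M ∈ I, M = (M : Mat F) 0 0 • A := fun M hM => by
    obtain ⟨h1, h2⟩ := apply_of_mem_groupAlgC2 M.2
    have h3 := h M hM
    apply Subtype.ext
    show (M : Mat F) = (M : Mat F) 0 0 • (A : Mat F)
    rw [hA]
    ext a b
    fin_cases a <;> fin_cases b <;> simp [h1, h2, ← h3]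
  refine ⟨A, hA, le_antisymm (fun M hM => ?_) ?_⟩
  · rw [key M hM, Algebra.smul_def]
    exact Ideal.mul_mem_left _ _ (Ideal.mem_span_singleton_self A)
  · obtain ⟨M, hM, hM0⟩ := Submodule.exists_mem_ne_zero_of_ne_bot hI
    rw [Ideal.span_singleton_le_iff_mem]
    have hc : (M : Mat F) 0 0 ≠ 0 := fun hc => hM0 (by rw [key M hM, hc, zero_smul])
    have hkey := key M hM
    -- `M` also occurs inside its own scalar; naming the scalar keeps the rewriting by `hkey` away
    -- from it.
    generalize (M : Mat F) 0 0 = c at hc hkey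
    have : A = algebraMap F (GroupAlgC2 F) c⁻¹ * M := by
      rw [← Algebra.smul_def, hkey, smul_smul, inv_mul_cancel₀ hc, one_smul]
    rw [this]
    exact I.mul_mem_left _ hM

lemma locallyOrthogonal_zero_two_iff (hS : rho hq hf hα '' I = S.directSum)
    (j : {j // IsJ0 q (f j) ∧ ringChar F = 2}) :
    LocallyOrthogonal hq hf hα I j.1 ↔ S.I0two j = ⊥ ∨
      ∃ M : GroupAlgC2 F, (M : Mat F) = !![1, 1; 1, 1] ∧ S.I0two j = Ideal.span {M} := by
  have hroot := j.2.1.pow_root hq (hf.monic j) (hf.irreducible j) (ne_zero_root hf hα j) (hα j)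
  have key : ∀ x y, dihedralRep F (α j ^ q) (hf.pow_q_pow_eq_one hα j) x * swapMat K *
      ((dihedralRep F (α j) (hf.pow_eq_one hα j) y).map (powHom F K hq))ᵀ = 0 ↔
      ((rho hq hf hα x).2.1 j : Mat F) * swapMat F *
        (((rho hq hf hα y).2.1 j : Mat F).map (powHom F F hq))ᵀ = 0 := by
    intro x y
    rw [dihedralRep_congr hroot _ (hf.pow_eq_one hα j), ← rho_zero_two hq hf hα j x,
      ← rho_zero_two hq hf hα j y, ← map_swapMat (algebraMap F K),
      ← map_matrix_eq_zero_iff (algebraMap F K), Matrix.map_mul, Matrix.map_mul]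
    have : ∀ M : Mat F, ((M.map (algebraMap F K)).map (powHom F K hq))ᵀ =
        ((M.map (powHom F F hq))ᵀ).map (algebraMap F K) := fun M => by
      ext a b
      simp
    rw [this]
  unfold LocallyOrthogonal
  simp only [key]
  rw [forall_forall_iff hq hf hα (π := fun y => y.2.1 j) (fun a => IdealFamily.mem_I0two_iff) hS
    (Q := fun a b => (a : Mat F) * swapMat F * ((b : Mat F).map (powHom F F hq))ᵀ = 0)]
  constructor
  · intro h
    refine eq_bot_or_span_of_groupAlgC2 fun M hM => ?_
    obtain ⟨h1, h2⟩ := apply_of_mem_groupAlgC2 M.2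
    have hMM := h M hM M hM
    have h00 := congrFun (congrFun hMM 0) 0
    have h01 := congrFun (congrFun hMM 0) 1
    simp only [Matrix.mul_apply, Fin.sum_univ_two, Matrix.transpose_apply, Matrix.map_apply,
      Matrix.zero_apply, h1, h2] at h00 h01
    simp [-powHom_apply] at h00 h01
    -- With `M = !![x, y; y, x]`, the two entries of the first row of the product add up to `(x + y)
    -- * (x ^ q + y ^ q)`; hence `x + y = 0`, which is `x = y` in characteristic two.
    have hsum : ((M : Mat F) 0 0 + (M : Mat F) 0 1) *
        powHom F F hq ((M : Mat F) 0 0 + (M : Mat F) 0 1) = 0 := by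
      rw [map_add]
      linear_combination h00 + h01
    have h0 : (M : Mat F) 0 0 + (M : Mat F) 0 1 = 0 := by
      simpa [ne_zero_of_card_eq_sq hq] using hsum
    have hneg := neg_one_eq_one_of_ringChar (K := F) j.2.2
    linear_combination h0 + (M : Mat F) 0 1 * hneg
  · rintro (h | ⟨A, hA, h⟩) M hM N hN
    · rw [h] at hM
      rw [(Submodule.mem_bot _).1 hM]
      simp
    · rw [h, Ideal.mem_span_singleton'] at hM hN
      obtain ⟨M, rfl⟩ := hM
      obtain ⟨N, rfl⟩ := hN
      rw [MulMemClass.coe_mul, MulMemClass.coe_mul, Matrix.map_mul, Matrix.transpose_mul, hA]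
      have h2 : (1 + 1 : F) = 0 := by
        have hneg := neg_one_eq_one_of_ringChar (K := F) j.2.2
        linear_combination -hneg
      -- The entries of this product are sums of two ones, zero in characteristic two.
      have hzero : !![1, 1; 1, 1] * swapMat F *
          ((!![1, 1; 1, 1] : Mat F).map (powHom F F hq))ᵀ = 0 := by
        ext a b
        fin_cases a <;> fin_cases b <;> simp [Matrix.mul_apply, Fin.sum_univ_two, h2]
      calc _ = (M : Mat F) * (!![1, 1; 1, 1] * swapMat F *
          ((!![1, 1; 1, 1] : Mat F).map (powHom F F hq))ᵀ) *
          ((N : Mat F).map (powHom F F hq))ᵀ := by simp only [mul_assoc]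
        _ = 0 := by rw [hzero, mul_zero, zero_mul]

lemma isAdmissible_iff (hS : rho hq hf hα '' I = S.directSum) :
    (∀ j, LocallyOrthogonal hq hf hα I j) ↔ S.IsAdmissible := by
  constructor
  · intro h
    exact ⟨fun j => (locallyOrthogonal_zero_iff hq hf hα hS j).1 (h j),
      fun j => (locallyOrthogonal_zero_two_iff hq hf hα hS j).1 (h j),
      fun j => (locallyOrthogonal_one_iff hq hf hα hS j).1 (h j),
      fun j => (locallyOrthogonal_two_iff hq hf hα hS j).1 (h j),
      fun j => (locallyOrthogonal_three_iff hq hf hα hS j).1 (h j),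
      fun j => (locallyOrthogonal_four_iff hq hf hα hS j).1 (h j)⟩
  · intro h j
    obtain hj | hj | hj | hj | hj := class_cases q (f j)
    · by_cases h2 : ringChar F = 2
      · exact (locallyOrthogonal_zero_two_iff hq hf hα hS ⟨j, hj, h2⟩).2 (h.h0two _)
      · exact (locallyOrthogonal_zero_iff hq hf hα hS ⟨j, hj, h2⟩).2 (h.h0 _)
    · exact (locallyOrthogonal_one_iff hq hf hα hS ⟨j, hj⟩).2 (h.h1 _)
    · exact (locallyOrthogonal_two_iff hq hf hα hS ⟨j, hj⟩).2 (h.h2 _)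
    · exact (locallyOrthogonal_three_iff hq hf hα hS ⟨j, hj⟩).2 (h.h3 _)
    · exact (locallyOrthogonal_four_iff hq hf hα hS ⟨j, hj⟩).2 (h.h4 _)

end Local

end DihedralCode

theorem theorem3p7 {F K J : Type*} [Field F] [Fintype F] [Field K] [Algebra F K] [Fintype J]
    (q n : ℕ) (hq : Fintype.card F = q ^ 2) (hqn : Nat.Coprime q n)
    (f : J → F[X]) (hf : IsFactorisation q n f)
    (α : J → K) (hα : ∀ j, aeval (α j) (f j) = 0) :
    ∃ ρ : MonoidAlgebra F (DihedralGroup n) ≃ₐ[F] DecompAlg q f α, IsStandard ρ ∧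
      ∀ (C : Submodule F (Fin (2 * n) → F)) (φ : Fin (2 * n) ≃ DihedralGroup n)
        (I : Ideal (MonoidAlgebra F (DihedralGroup n))), (I : Set _) = codeSet φ C →
        (∃! S : IdealFamily q f α, ρ '' I = S.directSum) ∧
        ∀ S : IdealFamily q f α, ρ '' I = S.directSum →
          ((C : Set (Fin (2 * n) → F)) ⊆ hermitianDual q C ↔ S.IsAdmissible) := by
  -- For `n = 0` coprimality would give `q = 1`, a field with one element.
  have hn : NeZero n := ⟨by
    rintro rfl
    have h := Fintype.one_lt_card (α := F)
    rw [hq, (Nat.coprime_zero_right q).1 hqn] at h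
    simp at h⟩
  refine ⟨rhoEquiv hq hqn hf hα, isStandard_rhoEquiv hq hqn hf hα, fun C φ I hI =>
    ⟨existsUnique_idealFamily _ I, fun S hS => ?_⟩⟩
  rw [subset_hermitianDual_iff hq φ C I hI, hf.mul_hat_eq_zero_iff hq hqn hα I]
  exact isAdmissible_iff hq hf hα hS
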